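/- \textbf{Variance decomposition for $n$-play Deuces Wild.} The game is played with a standard 52-card deck in which the four deuces are wild (each may be played as an arbitrary card). The player receives a five-card hand, all $\binom{52}{5}$ hands being equally likely, and chooses which cards to hold. If he holds $k$ cards, then, $n$ times conditionally independently given the initial hand, the $5-k$ discards are replaced by $5-k$ cards uniformly distributed over the $\binom{47}{5-k}$ sets of that size among the 47 cards outside the initial hand. The final hand of the $i$-th play returns $R_i$ per unit bet on that play, according to the full-pay Deuces Wild schedule: natural royal flush $800$, four deuces $200$, wild royal flush $25$, five of a kind $15$, straight flush $9$, four of a kind $5$, full house $3$, flush $2$, straight $2$, three of a kind $1$, anything else $0$, where the first applicable entry counts. A strategy assigns to each initial hand the set of cards held; it is optimal if it maximizes $\mathbb E[R_1]$, and minimum-variance optimal if it minimizes $\mathrm{Var}(R_1)$ among the optimal strategies. Let $X$ be the equivalence class of the initial hand, two hands being equivalent if they have the same denominations and if, after a permutation of the suits, the corresponding non-deuce cards have the same suits. Put $V_{\rm deal}=\mathrm{Var}(\mathbb E[R_1\mid X])$ and $V_{\rm draw}=\mathbb E[\mathrm{Var}(R_1\mid X)]$. A minimum-variance optimal strategy exists,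 and under every such strategy $$\mathbb E[R_1]=\frac{32187682693}{31944279675}\approx1.007620,$$ $$\mathrm{Var}(R_1)=\frac{342713803167529293506213}{13265681051410035373125}\approx25.834618,$$ $$V_{\rm deal}=\frac{27769926596703007394837}{8843787367606690248750}\approx3.140049,$$ $$V_{\rm draw}=\mathrm{Var}(R_1)-V_{\rm deal}=\frac{144566104812712980751}{6370074934650677250}\approx22.694569.$$ Moreover, for all $n\ge1$ the return per unit bet $\bar R_n=(R_1+\cdots+R_n)/n$ of the $n$-play game satisfies $$\mathbb E[\bar R_n]=\mathbb E[R_1],\qquad \mathrm{Var}(\bar R_n)=V_{\rm deal}+\frac1n V_{\rm draw},$$ which gives, to six decimal places, the mean $1.007620$ for every $n$ and the following variances and standard deviations of $\bar R_n$: $$\begin{array}{rcc} n & \text{variance} & \text{standard deviation}\\ 1 & 25.834618 & 5.082777\\ 3 & 10.704905 & 3.271835\\ 5 & 7.678963 & 2.771094\\ 10 & 5.409506 & 2.325834\\ 25 & 4.047832 & 2.011922\\ 50 & 3.593940 & 1.895769\\ 100 & 3.366995 & 1.834937\end{array}$$ (Decimal values are correct to within $\tfrac12\cdot10^{-6}$.)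 -/

import Mathlib

open MeasureTheory ProbabilityTheory

namespace DeucesWild

/-- A card of the 52-card deck, as (denomination, suit).  The denominations `0, 1, …, 12` stand for
2, 3, …, 10, jack, queen, king, ace, in this order; the cards of denomination `0` (the deuces) are
wild.  The four suits are `0, 1, 2, 3`. -/
abbrev Card := Fin 13 × Fin 4

/-- The number of deuces (wild cards) in a hand. -/
def wilds (h : Finset Card) : ℕ := (h.filter fun c => c.1 = 0).card

/-- The cards of a hand that are not wild. -/
def naturals (h : Finset Card) : Finset Card := h.filter fun c => c.1 ≠ 0

/-- The number of natural cards of denomination `r` in a hand. -/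
def mult (h : Finset Card) (r : Fin 13) : ℕ := ((naturals h).filter fun c => c.1 = r).card

/-- The ten sets of five consecutive denominations, the ace being low or high. -/
def runs : List (Finset (Fin 13)) :=
  [{12, 0, 1, 2, 3}, {0, 1, 2, 3, 4}, {1, 2, 3, 4, 5}, {2, 3, 4, 5, 6}, {3, 4, 5, 6, 7},
   {4, 5, 6, 7, 8}, {5, 6, 7, 8, 9}, {6, 7, 8, 9, 10}, {7, 8, 9, 10, 11}, {8, 9, 10, 11, 12}]

/-! The predicates below say that a five-card hand can be completed to the named pattern when
each deuce may be played as an arbitrary card. -/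

/-- Five cards of one suit. -/
abbrev IsFlush (h : Finset Card) : Prop := ∀ c ∈ naturals h, ∀ d ∈ naturals h, c.2 = d.2

/-- Five cards of consecutive denominations: the natural cards have distinct denominations, all
within one run, the wild cards filling the gaps. -/
abbrev IsStraight (h : Finset Card) : Prop :=
  (∀ r, mult h r ≤ 1) ∧ ∃ W ∈ runs, ∀ c ∈ naturals h, c.1 ∈ W

/-- Ten, jack, queen, king and ace of one suit. -/
abbrev IsRoyal (h : Finset Card) : Prop := IsFlush h ∧ ∀ c ∈ naturals h, 8 ≤ c.1

/-- At least `k` cards of one denomination. -/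
abbrev HasKind (k : ℕ) (h : Finset Card) : Prop := ∃ r, k ≤ mult h r + wilds h

/-- Three cards of a denomination `a` and two of another denomination `b`. -/
abbrev IsFullHouse (h : Finset Card) : Prop :=
  ∃ a b, a ≠ b ∧ mult h a ≤ 3 ∧ mult h b ≤ 2 ∧ ∀ c ∈ naturals h, c.1 = a ∨ c.1 = b

/-- The return, per unit bet, of a final five-card hand in full-pay Deuces Wild: natural royal
flush 800, four deuces 200, wild royal flush 25, five of a kind 15, straight flush 9, four of a
kind 5, full house 3, flush 2, straight 2, three of a kind 1, anything else 0; the hand is paid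
according to the first entry of this list that applies. -/
def payout (h : Finset Card) : ℕ :=
  if IsRoyal h ∧ wilds h = 0 then 800
  else if wilds h = 4 then 200
  else if IsRoyal h then 25
  else if HasKind 5 h then 15
  else if IsStraight h ∧ IsFlush h then 9
  else if HasKind 4 h then 5
  else if IsFullHouse h then 3
  else if IsFlush h then 2
  else if IsStraight h then 2
  else if HasKind 3 h then 1
  else 0

/-- A five-card hand. -/
def Hand := {h : Finset Card // h.card = 5}

instance : Fintype Hand := inferInstanceAs (Fintype {h : Finset Card // h.card = 5})

instance : Nonempty Hand := ⟨⟨{(0, 0), (1, 0), (2, 0), (3, 0), (4, 0)}, by decide⟩⟩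

/-- Two initial hands are equivalent if they have the same denominations and if, after a permutation
of the four suits, the corresponding non-deuce cards have the same suits.  (Both hands have
five cards, so they then also have the same number of deuces.) -/
instance handSetoid : Setoid Hand where
  r h h' := ∃ σ : Equiv.Perm (Fin 4),
    (naturals h.1).image (fun c => (c.1, σ c.2)) = naturals h'.1
  iseqv :=
    { refl := fun h => ⟨1, by simp⟩
      symm := by
        rintro h h' ⟨σ, hσ⟩
        refine ⟨σ⁻¹, ?_⟩
        rw [← hσ, Finset.image_image]
        simp [Function.comp_def]
      trans := by
        rintro h h' h'' ⟨σ, hσ⟩ ⟨τ, hτ⟩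
        refine ⟨τ * σ, ?_⟩
        rw [← hτ, ← hσ, Finset.image_image]
        simp [Function.comp_def] }

/-- The equivalence classes of initial hands. -/
abbrev HandClass := Quotient handSetoid

/-- A strategy tells, for every initial hand, which of its cards to hold. -/
structure Strategy where
  hold : Hand → Finset Card
  hold_subset : ∀ h, hold h ⊆ h.1

/-- Outcomes of the `n`-play game: the initial hand, and for each of the `n` plays the set of
new cards dealt to replace the discards. -/
def Outcome (n : ℕ) := Hand × (Fin n → Finset Card)

/-- Every set of outcomes is an event. -/
instance (n : ℕ) : MeasurableSpace (Outcome n) := ⊤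

/-- For `n` plays with initial hand `h`: all ways to replace, in each play, the `5 - k` discards by
`5 - k` of the 47 cards outside the initial hand, where `k` is the number of cards held. -/
def draws (s : Strategy) (n : ℕ) (h : Hand) : Finset (Fin n → Finset Card) :=
  Fintype.piFinset fun _ => Finset.powersetCard (5 - (s.hold h).card) h.1ᶜ

theorem draws_nonempty (s : Strategy) (n : ℕ) (h : Hand) : (draws s n h).Nonempty := by
  refine Fintype.piFinset_nonempty.2 fun _ => Finset.powersetCard_nonempty.2 ?_
  have h5 : h.1.card = 5 := h.2
  rw [Finset.card_compl, h5]
  simp only [Fintype.card_prod, Fintype.card_fin]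
  omega

/-- The distribution of the outcome of the `n`-play game under the strategy `s`: the initial hand is
uniformly distributed over all hands, and given the initial hand the `n` draws are uniformly
distributed over the product set `draws s n h`, that is, they are independent and each one is
uniformly distributed over its possibilities. -/
noncomputable def outcomePMF (s : Strategy) (n : ℕ) : PMF (Outcome n) :=
  (PMF.uniformOfFintype Hand).bind fun h =>
    (PMF.uniformOfFinset (draws s n h) (draws_nonempty s n h)).map fun d => ((h, d) : Outcome n)

/-- The probability measure of the `n`-play game under the strategy `s`. -/
noncomputable def game (s : Strategy) (n : ℕ) : Measure (Outcome n) := (outcomePMF s n).toMeasure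

/-- The return from the `i`-th play, per unit bet on that play. -/
def ret (s : Strategy) {n : ℕ} (i : Fin n) (ω : Outcome n) : ℝ :=
  (payout (s.hold ω.1 ∪ ω.2 i) : ℝ)

/-- The return per unit bet, `(R₁ + ⋯ + Rₙ) / n`, from the `n`-play game. -/
noncomputable def avgRet (s : Strategy) (n : ℕ) (ω : Outcome n) : ℝ :=
  (∑ i : Fin n, ret s i ω) / n

/-- The equivalence class of the initial hand. -/
def initialClass {n : ℕ} (ω : Outcome n) : HandClass := Quotient.mk handSetoid ω.1

/-- The σ-algebra generated by the equivalence class of the initial hand. -/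
abbrev dealSigma (n : ℕ) : MeasurableSpace (Outcome n) :=
  MeasurableSpace.comap (initialClass (n := n)) ⊤

/-- `E[R₁]` in the single-play game. -/
noncomputable def meanRet (s : Strategy) : ℝ := ∫ ω, ret s 0 ω ∂(game s 1)

/-- `Var(R₁)` in the single-play game. -/
noncomputable def varRet (s : Strategy) : ℝ := variance (ret s 0) (game s 1)

/-- The variance explained by the deal, `Var(E[R₁ ∣ X])`, where `X` is the equivalence class of the
initial hand. -/
noncomputable def varDeal (s : Strategy) : ℝ :=
  variance (condExp (dealSigma 1) (game s 1) (ret s 0)) (game s 1)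

/-- The variance explained by the draw, `E[Var(R₁ ∣ X)]`, where `X` is the equivalence class of the
initial hand. -/
noncomputable def varDraw (s : Strategy) : ℝ :=
  ∫ ω, condVar (dealSigma 1) (ret s 0) (game s 1) ω ∂(game s 1)

/-- A strategy is optimal if it maximizes the expected return. -/
def IsOptimal (s : Strategy) : Prop := ∀ t : Strategy, meanRet t ≤ meanRet s

/-- A minimum-variance optimal strategy: it minimizes the variance of the return among all
optimal strategies. -/
def IsMinVarOptimal (s : Strategy) : Prop :=
  IsOptimal s ∧ ∀ t : Strategy, IsOptimal t → varRet s ≤ varRet t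

/-- Decimal values of the variance and of the standard deviation of the return per unit bet, for
several values of the number `n` of plays, as triples `(n, variance, standard deviation)`. -/
noncomputable def table : List (ℕ × ℝ × ℝ) :=
  [(1, 25.834618, 5.082777),
   (3, 10.704905, 3.271835),
   (5, 7.678963, 2.771094),
   (10, 5.409506, 2.325834),
   (25, 4.047832, 2.011922),
   (50, 3.593940, 1.895769),
   (100, 3.366995, 1.834937)]

/-- `a` is a decimal approximation of `x` that is correct to six decimal places. -/
def Approx (x a : ℝ) : Prop := |x - a| ≤ 1 / 2 * 10 ^ (-6 : ℤ)

end DeucesWild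

namespace DeucesWild

/-! For an initial hand `h` and a held set `S ⊆ h` let M_j(h, S) be 7669695 times the j-th moment of
the return. The factor is the least common multiple of the numbers of draws C(47, i), i ≤ 5, so that
M_j is an integer. All hands are equally likely, hence a strategy is optimal iff it maximizes M_1 in
every hand (`isOptimal_iff`). All optimal strategies have the same mean, so minimizing the variance
means minimizing the sum of M_2 over the hands. Everything asserted about one play then follows from
three integers, the sums of M_1, M_1² and M_2 over the 2598960 hands, each with a hold that is best
in this lexicographic sense (`sum_bestHold`).

Given the hand, the n plays are independent and identically distributed. Therefore the variance of
the average is the variance of the conditional mean plus 1/n times the mean of the conditional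
variance (`variance_avgRet`). Conditioning on the class `X` instead of the hand changes nothing for
an optimal strategy: the largest M_1 is invariant under exchanges of suits
(`moment_bestHold_eq_of_equiv`), so E[R | X] is the conditional mean given the hand (`condExp_ret`),
and the law of total variance gives the other part.

The lexicographic problem is made scalar by scoring a return p as 2^43 p - p². Since M_2 < 2^43, the
maximum k of 2^43 M_1 - M_2 is attained exactly at the best holds, M_1 is k / 2^43 rounded up, and
M_2 = 2^43 M_1 - k (`exists_best_hold`, `decode_eq`).

To find k for all hands, consider the total score of the five-card hands that contain a given set of
cards. It depends only on the denominations and on whether the natural cards are of one suit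
(`Lists.total_eq`). The literal tables of these totals are not taken on trust: a double count
relates the totals for j cards to those for j + 1 cards, and this recursion is checked down to
complete hands. Totals over hands that contain the held cards and avoid the discards arise from
these by successive differences, that is, by inclusion-exclusion (`total_eq_add`, `bestTotal_spec`).
Hands are grouped by their denominations, and all suit patterns for given denominations are treated
at once, in 80-bit lanes of a single natural number (`bestWith_packed`, `sum_lanes`). Finally
`sum_hands` identifies the enumeration by denominations and suits with the sum over all hands.

The numerical work is done by reduction in the kernel. For this reason the functions involved are
built from recursors and from the basic operations on `Nat`, which the kernel evaluates natively;
they are proved correct afterwards. -/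

set_option maxRecDepth 100000

/-! ### Functions for the kernel: totals, payouts, lanes and enumeration of hands. -/

noncomputable section

/-- `table k` holds, for every descending list of `k` denominations, the total score of the hands
that contain given cards of these denominations: without regard to flushes in the lower 64 bits of
the entry, and the excess due to flushes in the upper 64 bits. -/
def table0 : ℕ :=
  0x06505fffffd158d45618ffffffc92440

def table1 : ℕ :=
  0x0093cffffff57cc2060897fffffdb4a9009437fffff57bf1063897fffffda8a9009a1ffffff57228068197fffffd954900a007fffff5685f06ca97fffffd81e900a5effffff55e96071397fffffd6e89006b37ffffffb2c5071397fffffd6e89006b37ffffffb2c5071397fffffd6e89006b37ffffffb2c5071397fffffd6e8900654fffffffbc8e06ca97fffffd81e90062c7ffffffc0db069797fffffd8f09005cdfffffffcaa4064e97fffffda2690056f7ffffffd46d060597fffffdb5c9021ebffffffc48701c0d1fffffd8d584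

def table2 : ℕ :=
  0x013ebfffffff89e000443ffffff5e4e400575fffffffec1800443ffffff5e4e400575fffffffec1800443ffffff5e4e400575fffffffec1800443ffffff5e4e400575fffffffec1800149ffffffffa9c00451ffffffff0f000149ffffffffa9c00451ffffffff0f000149ffffffffa9c00451ffffffff0f000149ffffffffa9c00451ffffffff0f00017fffffffff520004a9fffffffef600017fffffffff520004a9fffffffef600017fffffffff520004a9fffffffef600028efffffffa56a01c7a7fffffecb010000000000000000013ebfffffff89e00046c7fffff5e09700641fffffffe8d00046c7fffff5e09700641fffffffe8d00046c7fffff5e09700641fffffffe8d0001a87fffffff0d300575fffffffec1800149ffffffffa9c00451ffffffff0f000149ffffffffa9c00451ffffffff0f000149ffffffffa9c00451ffffffff0f000149ffffffffa9c00451ffffffff0f000149ffffffffa9c00451ffffffff0f000149ffffffffa9c00451ffffffff0f000287fffffffa62801cfa7fffffec9010000000000000000013ebfffffff89e000494ffffff5dc4a0070dfffffffe58800494ffffff5dc4a0070dfffffffe588001d0fffffffec8600641fffffffe8d0001a87fffffff0d300575fffffffec1800149ffffffffa9c00451ffffffff0f000149ffffffffa9c00451ffffffff0f000149ffffffffa9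c00451ffffffff0f000149ffffffffa9c00451ffffffff0f000149ffffffffa9c00451ffffffff0f0002b07ffffffa20b01e027fffffec4510000000000000000013ebfffffff89e0004bd7fffff5d7fd007d9fffffffe240001f97ffffffe8390070dfffffffe588001d0fffffffec8600641fffffffe8d0001a87fffffff0d300575fffffffec1800149ffffffffa9c00451ffffffff0f000149ffffffffa9c00451ffffffff0f000149ffffffffa9c00451ffffffff0f000149ffffffffa9c00451ffffffff0f0002d8fffffff9dee01f0a7fffffebfa10000000000000000013ebfffffff89e000221fffffffe3ec007d9fffffffe240001f97ffffffe8390070dfffffffe588001d0fffffffec8600641fffffffe8d0001a87fffffff0d300575fffffffec1800149ffffffffa9c00451ffffffff0f000149ffffffffa9c00451ffffffff0f000149ffffffffa9c00451ffffffff0f0003017ffffff99d1020127fffffebaf10000000000000000013ebfffffff89e000221fffffffe3ec007d9fffffffe240001f97ffffffe8390070dfffffffe588001d0fffffffec8600641fffffffe8d0001a87fffffff0d300575fffffffec1800149ffffffffa9c00451ffffffff0f000149ffffffffa9c00451ffffffff0f0001f17ffffffe211020127fffffebaf10000000000000000013ebfffffff89e000221fffffffe3ec007d9fffffffe240001f9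7ffffffe8390070dfffffffe588001d0fffffffec8600641fffffffe8d0001a87fffffff0d300575fffffffec1800149ffffffffa9c00451ffffffff0f0001f17ffffffe211020127fffffebaf10000000000000000013ebfffffff89e000221fffffffe3ec007d9fffffffe240001f97ffffffe8390070dfffffffe588001d0fffffffec8600641fffffffe8d0001a87fffffff0d300575fffffffec18001f17ffffffe211020127fffffebaf10000000000000000013ebfffffff89e0001f97ffffffe8390070dfffffffe588001d0fffffffec8600641fffffffe8d0001a87fffffff0d300575fffffffec18001c8fffffffe62e01f0a7fffffebfa10000000000000000013ebfffffff89e0001ecfffffffe9a60068dfffffffe788001c47ffffffedf3005c1fffffffead0001bafffffffe79e01e727fffffec2310000000000000000013ebfffffff89e0001c47ffffffedf3005c1fffffffead0001927ffffffebbb01d6a7fffffec6e10000000000000000013ebfffffff89e000169fffffffefd801c627fffffecb9100a9bffffffe6f5806e4ffffffdfa760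

def table3 : ℕ :=
  0x0048bfffffffdbf80000000000000000000bcffffffffcdc0000000000000000000bcffffffffcdc0000000000000000000bcffffffffcdc0000000000000000000bcffffffffcdc0000000000000000000bcffffffffcdc0000000000000000000bcffffffffcdc0000000000000000000bcffffffffcdc0000000000000000000bcffffffffcdc0000000000000000000bcffffffffcdc0000000000000000000bcffffffffcdc0000000000000000000bcffffffffcdc00000000000000000048bfffffffdbf80000000000000000000bcffffffffcdc0026effffff619120004c7fffffffefb0026effffff619120004c7fffffffefb0026effffff619120004c7fffffffefb0004affffffffece000197ffffffffcd0004affffffffece000197ffffffffcd0004affffffffece000197ffffffffcd0004affffffffece000197ffffffffcd0004affffffffece000197ffffffffcd0004affffffffece000197ffffffffcd0004affffffffece000197ffffffffcd000dc7ffffffdaf500164ffffffffa3c0000000000000000000bcffffffffcdc0026effffff619120004c7fffffffefb0026effffff619120004c7fffffffefb0004affffffffece000197ffffffffcd0004affffffffece000197ffffffffcd0004affffffffece000197ffffffffcd0004affffffffece000197ffffffffcd0004affffffffece000197ffffffffcd0004affffffffece000197ffffffffcd0004affffffffece000197ffffffffcd000dc7ffffffdaf500164ffffffffa3c0000000000000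000000bcffffffffcdc0026effffff619120004c7fffffffefb0004affffffffece000197ffffffffcd0004affffffffece000197ffffffffcd0004affffffffece000197ffffffffcd0004affffffffece000197ffffffffcd0004affffffffece000197ffffffffcd0004affffffffece000197ffffffffcd0004affffffffece000197ffffffffcd000dc7ffffffdaf500164ffffffffa3c0000000000000000000bcffffffffcdc0004affffffffece000197ffffffffcd0004affffffffece000197ffffffffcd0004affffffffece000197ffffffffcd0004affffffffece000197ffffffffcd0004affffffffece000197ffffffffcd0004affffffffece000197ffffffffcd0004affffffffece000197ffffffffcd000dc7ffffffdaf500164ffffffffa3c0000000000000000000bcffffffffcdc0004affffffffece000197ffffffffcd0004affffffffece000197ffffffffcd0004affffffffece000197ffffffffcd0004affffffffece000197ffffffffcd0004affffffffece000197ffffffffcd0004affffffffece000197ffffffffcd0003bffffffffef200122ffffffffb680000000000000000000bcffffffffcdc0004affffffffece000197ffffffffcd0004affffffffece000197ffffffffcd0004affffffffece000197ffffffffcd0004affffffffece000197ffffffffcd0004affffffffece000197ffffffffcd0003bffffffffef200122ffffffffb680000000000000000000bcffffffffcdc0004affffffffece000197ffffffffcd0004affffffffece000197ffffffffcd0004a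ffffffffece000197ffffffffcd0004affffffffece000197ffffffffcd0003bffffffffef200122ffffffffb680000000000000000000bcffffffffcdc0004affffffffece000197ffffffffcd0004affffffffece000197ffffffffcd0004affffffffece000197ffffffffcd0003bffffffffef200122ffffffffb680000000000000000000bcffffffffcdc00066ffffffffbee0002c7ffffffff7b00066ffffffffbee0002c7ffffffff7b000567fffffffc450013effffffffae00000000000000000000bcffffffffcdc00066ffffffffbee0002c7ffffffff7b000567fffffffc450013effffffffae00000000000000000000bcffffffffcdc000567fffffffc450013effffffffae0000c27ffffffdbf1005727ffffff3ac900000000000000000048bfffffffdbf80000000000000000000bcffffffffcdc0000000000000000000bcffffffffcdc0000000000000000000bcffffffffcdc0000000000000000000bcffffffffcdc0000000000000000000bcffffffffcdc0000000000000000000bcffffffffcdc0000000000000000000bcffffffffcdc0000000000000000000bcffffffffcdc0000000000000000000bcffffffffcdc0000000000000000000bcffffffffcdc00000000000000000048bfffffffdbf80000000000000000000bcffffffffcdc0027b7fffff617a50006c7fffffffe7b0027b7fffff617a50006c7fffffffe7b000737fffffffa810004c7fffffffefb0004affffffffece000197ffffffffcd0004affffffffece000197ffffffffcd0004affffffffe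ce000197ffffffffcd0004affffffffece000197ffffffffcd0004affffffffece000197ffffffffcd0004affffffffece000197ffffffffcd000ea7ffffffd9850018affffffff9980000000000000000000bcffffffffcdc0027b7fffff617a50006c7fffffffe7b000737fffffffa810004c7fffffffefb0004affffffffece000197ffffffffcd0004affffffffece000197ffffffffcd0004affffffffece000197ffffffffcd0004affffffffece000197ffffffffcd0004affffffffece000197ffffffffcd0004affffffffece000197ffffffffcd000ea7ffffffd9850018affffffff9980000000000000000000bcffffffffcdc000737fffffffa810004c7fffffffefb0004affffffffece000197ffffffffcd0004affffffffece000197ffffffffcd0004affffffffece000197ffffffffcd0004affffffffece000197ffffffffcd0004affffffffece000197ffffffffcd0004affffffffece000197ffffffffcd000ea7ffffffd9850018affffffff9980000000000000000000bcffffffffcdc0004affffffffece000197ffffffffcd0004affffffffece000197ffffffffcd0004affffffffece000197ffffffffcd0004affffffffece000197ffffffffcd0004affffffffece000197ffffffffcd0004affffffffece000197ffffffffcd000647fffffffad500164ffffffffa3c0000000000000000000bcffffffffcdc0004affffffffece000197ffffffffcd0004affffffffece000197ffffffffcd0004affffffffece000197ffffffffcd0004affffffffece000197ffffffffcd0004a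ffffffffece000197ffffffffcd0003bffffffffef200122ffffffffb680000000000000000000bcffffffffcdc0004affffffffece000197ffffffffcd0004affffffffece000197ffffffffcd0004affffffffece000197ffffffffcd0004affffffffece000197ffffffffcd0003bffffffffef200122ffffffffb680000000000000000000bcffffffffcdc0004affffffffece000197ffffffffcd0004affffffffece000197ffffffffcd0004affffffffece000197ffffffffcd0003bffffffffef200122ffffffffb680000000000000000000bcffffffffcdc0004affffffffece000197ffffffffcd0004affffffffece000197ffffffffcd0003bffffffffef200122ffffffffb680000000000000000000bcffffffffcdc0004affffffffece000197ffffffffcd0003bffffffffef200122ffffffffb680000000000000000000bcffffffffcdc0003bffffffffef200122ffffffffb68000ba7ffffffdcd1005727ffffff3ac900000000000000000048bfffffffdbf80000000000000000000bcffffffffcdc0000000000000000000bcffffffffcdc0000000000000000000bcffffffffcdc0000000000000000000bcffffffffcdc0000000000000000000bcffffffffcdc0000000000000000000bcffffffffcdc0000000000000000000bcffffffffcdc0000000000000000000bcffffffffcdc0000000000000000000bcffffffffcdc00000000000000000048bfffffffdbf80000000000000000000bcffffffffcdc00287ffffff616380008c7fffffffdfb0007fffffffff9140006c7fffffffe7b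000737fffffffa810004c7fffffffefb0004affffffffece000197ffffffffcd0004affffffffece000197ffffffffcd0004affffffffece000197ffffffffcd0004affffffffece000197ffffffffcd0004affffffffece000197ffffffffcd000f87ffffffd815001b0ffffffff8f40000000000000000000bcffffffffcdc0007fffffffff9140006c7fffffffe7b000737fffffffa810004c7fffffffefb0004affffffffece000197ffffffffcd0004affffffffece000197ffffffffcd0004affffffffece000197ffffffffcd0004affffffffece000197ffffffffcd0004affffffffece000197ffffffffcd000f87ffffffd815001b0ffffffff8f40000000000000000000bcffffffffcdc000737fffffffa810004c7fffffffefb0004affffffffece000197ffffffffcd0004affffffffece000197ffffffffcd0004affffffffece000197ffffffffcd0004affffffffece000197ffffffffcd0004affffffffece000197ffffffffcd000727fffffff9650018affffffff9980000000000000000000bcffffffffcdc0004affffffffece000197ffffffffcd0004affffffffece000197ffffffffcd0004affffffffece000197ffffffffcd0004affffffffece000197ffffffffcd0004affffffffece000197ffffffffcd000647fffffffad500164ffffffffa3c0000000000000000000bcffffffffcdc0004affffffffece000197ffffffffcd0004affffffffece000197ffffffffcd0004affffffffece000197ffffffffcd0004affffffffece000197ffffffffcd0003bffffffffef200122ffff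ffffb680000000000000000000bcffffffffcdc0004affffffffece000197ffffffffcd0004affffffffece000197ffffffffcd0004affffffffece000197ffffffffcd0003bffffffffef200122ffffffffb680000000000000000000bcffffffffcdc0004affffffffece000197ffffffffcd0004affffffffece000197ffffffffcd0003bffffffffef200122ffffffffb680000000000000000000bcffffffffcdc0004affffffffece000197ffffffffcd0003bffffffffef200122ffffffffb680000000000000000000bcffffffffcdc0003bffffffffef200122ffffffffb68000c77ffffffdb830058a7ffffff3a3900000000000000000048bfffffffdbf80000000000000000000bcffffffffcdc0000000000000000000bcffffffffcdc0000000000000000000bcffffffffcdc0000000000000000000bcffffffffcdc0000000000000000000bcffffffffcdc0000000000000000000bcffffffffcdc0000000000000000000bcffffffffcdc0000000000000000000bcffffffffcdc00000000000000000048bfffffffdbf80000000000000000000bcffffffffcdc0008c7fffffff7a70008c7fffffffdfb0007fffffffff9140006c7fffffffe7b000737fffffffa810004c7fffffffefb0004affffffffece000197ffffffffcd0004affffffffece000197ffffffffcd0004affffffffece000197ffffffffcd0004affffffffece000197ffffffffcd001067ffffffd6a5001d6ffffffff8500000000000000000000bcffffffffcdc0007fffffffff9140006c7fffffffe7b0007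37fffffffa810004c7fffffffefb0004affffffffece000197ffffffffcd0004affffffffece000197ffffffffcd0004affffffffece000197ffffffffcd0004affffffffece000197ffffffffcd000807fffffff7f5001b0ffffffff8f40000000000000000000bcffffffffcdc000737fffffffa810004c7fffffffefb0004affffffffece000197ffffffffcd0004affffffffece000197ffffffffcd0004affffffffece000197ffffffffcd0004affffffffece000197ffffffffcd000727fffffff9650018affffffff9980000000000000000000bcffffffffcdc0004affffffffece000197ffffffffcd0004affffffffece000197ffffffffcd0004affffffffece000197ffffffffcd0004affffffffece000197ffffffffcd000647fffffffad500164ffffffffa3c0000000000000000000bcffffffffcdc0004affffffffece000197ffffffffcd0004affffffffece000197ffffffffcd0004affffffffece000197ffffffffcd0003bffffffffef200122ffffffffb680000000000000000000bcffffffffcdc0004affffffffece000197ffffffffcd0004affffffffece000197ffffffffcd0003bffffffffef200122ffffffffb680000000000000000000bcffffffffcdc0004affffffffece000197ffffffffcd0003bffffffffef200122ffffffffb680000000000000000000bcffffffffcdc0003bffffffffef200122ffffffffb68000d47ffffffda35005a27ffffff39a900000000000000000048bfffffffdbf80000000000000000000bcffffffffcdc0000000000000000000bcffffffffcdc0000000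000000000000bcffffffffcdc0000000000000000000bcffffffffcdc0000000000000000000bcffffffffcdc0000000000000000000bcffffffffcdc0000000000000000000bcffffffffcdc00000000000000000048bfffffffdbf80000000000000000000bcffffffffcdc0008c7fffffff7a70008c7fffffffdfb0007fffffffff9140006c7fffffffe7b000737fffffffa810004c7fffffffefb0004affffffffece000197ffffffffcd0004affffffffece000197ffffffffcd0004affffffffece000197ffffffffcd0008e7fffffff685001d6ffffffff8500000000000000000000bcffffffffcdc0007fffffffff9140006c7fffffffe7b000737fffffffa810004c7fffffffefb0004affffffffece000197ffffffffcd0004affffffffece000197ffffffffcd0004affffffffece000197ffffffffcd000807fffffff7f5001b0ffffffff8f40000000000000000000bcffffffffcdc000737fffffffa810004c7fffffffefb0004affffffffece000197ffffffffcd0004affffffffece000197ffffffffcd0004affffffffece000197ffffffffcd000727fffffff9650018affffffff9980000000000000000000bcffffffffcdc0004affffffffece000197ffffffffcd0004affffffffece000197ffffffffcd0004affffffffece000197ffffffffcd000647fffffffad500164ffffffffa3c0000000000000000000bcffffffffcdc0004affffffffece000197ffffffffcd0004affffffffece000197ffffffffcd0003bffffffffef200122ffffffffb680000000000000000000bcf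fffffffcdc0004affffffffece000197ffffffffcd0003bffffffffef200122ffffffffb680000000000000000000bcffffffffcdc0003bffffffffef200122ffffffffb68000e17ffffffd8e7005ba7ffffff391900000000000000000048bfffffffdbf80000000000000000000bcffffffffcdc0000000000000000000bcffffffffcdc0000000000000000000bcffffffffcdc0000000000000000000bcffffffffcdc0000000000000000000bcffffffffcdc0000000000000000000bcffffffffcdc00000000000000000048bfffffffdbf80000000000000000000bcffffffffcdc0008c7fffffff7a70008c7fffffffdfb0007fffffffff9140006c7fffffffe7b000737fffffffa810004c7fffffffefb0004affffffffece000197ffffffffcd0004affffffffece000197ffffffffcd0008e7fffffff685001d6ffffffff8500000000000000000000bcffffffffcdc0007fffffffff9140006c7fffffffe7b000737fffffffa810004c7fffffffefb0004affffffffece000197ffffffffcd0004affffffffece000197ffffffffcd000807fffffff7f5001b0ffffffff8f40000000000000000000bcffffffffcdc000737fffffffa810004c7fffffffefb0004affffffffece000197ffffffffcd0004affffffffece000197ffffffffcd000727fffffff9650018affffffff9980000000000000000000bcffffffffcdc0004affffffffece000197ffffffffcd0004affffffffece000197ffffffffcd000647fffffffad500164ffffffffa3c0000000000000000000bcfffff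fffcdc0004affffffffece000197ffffffffcd0003bffffffffef200122ffffffffb680000000000000000000bcffffffffcdc0003bffffffffef200122ffffffffb68000717fffffff6a7005ba7ffffff391900000000000000000048bfffffffdbf80000000000000000000bcffffffffcdc0000000000000000000bcffffffffcdc0000000000000000000bcffffffffcdc0000000000000000000bcffffffffcdc0000000000000000000bcffffffffcdc00000000000000000048bfffffffdbf80000000000000000000bcffffffffcdc0008c7fffffff7a70008c7fffffffdfb0007fffffffff9140006c7fffffffe7b000737fffffffa810004c7fffffffefb0004affffffffece000197ffffffffcd0008e7fffffff685001d6ffffffff8500000000000000000000bcffffffffcdc0007fffffffff9140006c7fffffffe7b000737fffffffa810004c7fffffffefb0004affffffffece000197ffffffffcd000807fffffff7f5001b0ffffffff8f40000000000000000000bcffffffffcdc000737fffffffa810004c7fffffffefb0004affffffffece000197ffffffffcd000727fffffff9650018affffffff9980000000000000000000bcffffffffcdc0004affffffffece000197ffffffffcd000647fffffffad500164ffffffffa3c0000000000000000000bcffffffffcdc0003bffffffffef200122ffffffffb68000717fffffff6a7005ba7ffffff391900000000000000000048bfffffffdbf80000000000000000000bcffffffffcdc0000000000000000000bcffffffffc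dc0000000000000000000bcffffffffcdc0000000000000000000bcffffffffcdc00000000000000000048bfffffffdbf80000000000000000000bcffffffffcdc0008c7fffffff7a70008c7fffffffdfb0007fffffffff9140006c7fffffffe7b000737fffffffa810004c7fffffffefb0008e7fffffff685001d6ffffffff8500000000000000000000bcffffffffcdc0007fffffffff9140006c7fffffffe7b000737fffffffa810004c7fffffffefb000807fffffff7f5001b0ffffffff8f40000000000000000000bcffffffffcdc000737fffffffa810004c7fffffffefb000727fffffff9650018affffffff9980000000000000000000bcffffffffcdc000647fffffffad500164ffffffffa3c000717fffffff6a7005ba7ffffff391900000000000000000048bfffffffdbf80000000000000000000bcffffffffcdc0000000000000000000bcffffffffcdc0000000000000000000bcffffffffcdc00000000000000000048bfffffffdbf80000000000000000000bcffffffffcdc0007fffffffff9140006c7fffffffe7b000737fffffffa810004c7fffffffefb000807fffffff7f5001b0ffffffff8f40000000000000000000bcffffffffcdc000737fffffffa810004c7fffffffefb000727fffffff9650018affffffff9980000000000000000000bcffffffffcdc000647fffffffad500164ffffffffa3c000647fffffff7f5005a27ffffff39a900000000000000000048bfffffffdbf80000000000000000000bcffffffffcdc0000000000000000000bcfffffff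fcdc00000000000000000048bfffffffdbf80000000000000000000bcffffffffcdc0007d7fffffff95d0005c7fffffffebb0007dffffffff83e001a0ffffffff9340000000000000000000bcffffffffcdc0006fffffffff9ae0017affffffff9d8000617fffffff83f0059a7ffffff39d900000000000000000048bfffffffdbf80000000000000000000bcffffffffcdc00000000000000000048bfffffffdbf80000000000000000000bcffffffffcdc0006fffffffff9ae0017affffffff9d8000547fffffff98d005827ffffff3a6900000000000000000048bfffffffdbf800000000000000000048bfffffffdbf8000477fffffffadb0056a7ffffff3af900287fffffff872001f2bfffffe20d98

def table4 : ℕ :=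
  0x0008bffffffff830000000000000000000024fffffffff40000000000000000000024fffffffff40000000000000000000024fffffffff40000000000000000000024fffffffff40000000000000000000024fffffffff40000000000000000000024fffffffff40000000000000000000024fffffffff40000000000000000000024fffffffff40000000000000000000024fffffffff40000000000000000000024fffffffff40000000000000000000024fffffffff4000000000000000000008bffffffff83000000000000000000000bfffffffffb8000000000000000000002ffffffffffa000000000000000000002ffffffffffa000000000000000000002ffffffffffa000000000000000000002ffffffffffa000000000000000000002ffffffffffa000000000000000000002ffffffffffa000000000000000000002ffffffffffa000000000000000000002ffffffffffa000000000000000000002ffffffffffa000000000000000000002ffffffffffa000000000000000000024fffffffff4000000000000000000000bfffffffffb8000000000000000000002ffffffffffa000000000000000000002ffffffffffa000000000000000000002ffffffffffa000000000000000000002ffffffffffa000000000000000000002ffffffffffa000000000000000000002ffffffffffa000000000000000000002ffffffffffa000000000000000000002ffffffffffa000000000000000000002ffffffffffa000000000000000000024fffffffff4000000000000000000000bfffffffffb8000000000000000000002ffffffffffa000000000000000000002ffffffffffa000000000000000000002ffffffffffa000000000000000000002ffffffffffa000000000000000000002ffffffffffa000000000000000000002ffffffffffa000000000000000000002ffffff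ffffa000000000000000000002ffffffffffa000000000000000000024fffffffff4000000000000000000000bfffffffffb8000000000000000000002ffffffffffa000000000000000000002ffffffffffa000000000000000000002ffffffffffa000000000000000000002ffffffffffa000000000000000000002ffffffffffa000000000000000000002ffffffffffa000000000000000000002ffffffffffa000000000000000000024fffffffff4000000000000000000000bfffffffffb8000000000000000000002ffffffffffa000000000000000000002ffffffffffa000000000000000000002ffffffffffa000000000000000000002ffffffffffa000000000000000000002ffffffffffa000000000000000000002ffffffffffa000000000000000000024fffffffff4000000000000000000000bfffffffffb8000000000000000000002ffffffffffa000000000000000000002ffffffffffa000000000000000000002ffffffffffa000000000000000000002ffffffffffa000000000000000000002ffffffffffa000000000000000000024fffffffff4000000000000000000000bfffffffffb8000000000000000000002ffffffffffa000000000000000000002ffffffffffa000000000000000000002ffffffffffa000000000000000000002ffffffffffa000000000000000000024fffffffff4000000000000000000000bfffffffffb8000000000000000000002ffffffffffa000000000000000000002ffffffffffa000000000000000000002ffffffffffa000000000000000000024fffffffff4000000000000000000000bfffffffffb8000000000000000000002ffffffffffa000000000000000000002ffffffffffa000000000000000000024fffffffff4000000000000000000000bfffffffffb8000000000000000000002f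fffffffffa000000000000000000024fffffffff4000000000000000000000bfffffffffb8000000000000000000024fffffffff4000000000000000000008bffffffff830000000000000000000024fffffffff40000000000000000000002ffffffffffa000000000000000000002ffffffffffa000000000000000000002ffffffffffa000000000000000000002ffffffffffa000000000000000000002ffffffffffa000000000000000000002ffffffffffa000000000000000000002ffffffffffa000000000000000000002ffffffffffa000000000000000000002ffffffffffa000000000000000000002ffffffffffa000000000000000000024fffffffff40000000000000000000002ffffffffffa001c3ffffff6323400007fffffffffe0001c3ffffff6323400007fffffffffe00000bfffffffffd000000000000000000000bfffffffffd000000000000000000000bfffffffffd000000000000000000000bfffffffffd000000000000000000000bfffffffffd000000000000000000000bfffffffffd000000000000000000000bfffffffffd00000000000000000000407fffffff3c30000f7ffffffffcb000000000000000000002ffffffffffa001c3ffffff6323400007fffffffffe00000bfffffffffd000000000000000000000bfffffffffd000000000000000000000bfffffffffd000000000000000000000bfffffffffd000000000000000000000bfffffffffd000000000000000000000bfffffffffd000000000000000000000bfffffffffd00000000000000000000407fffffff3c30000f7ffffffffcb000000000000000000002ffffffffffa0000bfffffffffd000000000000000000000bfffffffffd000000000000000000000bfffffffffd0000000000000000000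00bfffffffffd000000000000000000000bfffffffffd000000000000000000000bfffffffffd000000000000000000000bfffffffffd00000000000000000000407fffffff3c30000f7ffffffffcb000000000000000000002ffffffffffa0000bfffffffffd000000000000000000000bfffffffffd000000000000000000000bfffffffffd000000000000000000000bfffffffffd000000000000000000000bfffffffffd000000000000000000000bfffffffffd000000000000000000000a7ffffffffd300005ffffffffff4000000000000000000002ffffffffffa0000bfffffffffd000000000000000000000bfffffffffd000000000000000000000bfffffffffd000000000000000000000bfffffffffd000000000000000000000bfffffffffd000000000000000000000a7ffffffffd300005ffffffffff4000000000000000000002ffffffffffa0000bfffffffffd000000000000000000000bfffffffffd000000000000000000000bfffffffffd000000000000000000000bfffffffffd000000000000000000000a7ffffffffd300005ffffffffff4000000000000000000002ffffffffffa0000bfffffffffd000000000000000000000bfffffffffd000000000000000000000bfffffffffd000000000000000000000a7ffffffffd300005ffffffffff4000000000000000000002ffffffffffa0000bfffffffffd000000000000000000000bfffffffffd000000000000000000000a7ffffffffd300005ffffffffff4000000000000000000002ffffffffffa0000bfffffffffd000000000000000000000a7ffffffffd300005ffffffffff4000000000000000000002ffffffffffa0000a7ffffffffd300005ffffffffff4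00039ffffffff3f40002dffffffffeec000000000000000000024fffffffff40000000000000000000002ffffffffffa000000000000000000002ffffffffffa000000000000000000002ffffffffffa000000000000000000002ffffffffffa000000000000000000002ffffffffffa000000000000000000002ffffffffffa000000000000000000002ffffffffffa000000000000000000002ffffffffffa000000000000000000002ffffffffffa000000000000000000024fffffffff40000000000000000000002ffffffffffa001c3ffffff6323400007fffffffffe00000bfffffffffd000000000000000000000bfffffffffd000000000000000000000bfffffffffd000000000000000000000bfffffffffd000000000000000000000bfffffffffd000000000000000000000bfffffffffd000000000000000000000bfffffffffd00000000000000000000407fffffff3c30000f7ffffffffcb000000000000000000002ffffffffffa0000bfffffffffd000000000000000000000bfffffffffd000000000000000000000bfffffffffd000000000000000000000bfffffffffd000000000000000000000bfffffffffd000000000000000000000bfffffffffd000000000000000000000bfffffffffd00000000000000000000407fffffff3c30000f7ffffffffcb000000000000000000002ffffffffffa0000bfffffffffd000000000000000000000bfffffffffd000000000000000000000bfffffffffd000000000000000000000bfffffffffd000000000000000000000bfffffffffd000000000000000000000bfffffffffd000000000000000000000a7ffffffffd300005ffffffffff4000000000000000000002ffffffffffa0000bfffffffffd000000000000000000000bf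ffffffffd000000000000000000000bfffffffffd000000000000000000000bfffffffffd000000000000000000000bfffffffffd000000000000000000000a7ffffffffd300005ffffffffff4000000000000000000002ffffffffffa0000bfffffffffd000000000000000000000bfffffffffd000000000000000000000bfffffffffd000000000000000000000bfffffffffd000000000000000000000a7ffffffffd300005ffffffffff4000000000000000000002ffffffffffa0000bfffffffffd000000000000000000000bfffffffffd000000000000000000000bfffffffffd000000000000000000000a7ffffffffd300005ffffffffff4000000000000000000002ffffffffffa0000bfffffffffd000000000000000000000bfffffffffd000000000000000000000a7ffffffffd300005ffffffffff4000000000000000000002ffffffffffa0000bfffffffffd000000000000000000000a7ffffffffd300005ffffffffff4000000000000000000002ffffffffffa0000a7ffffffffd300005ffffffffff400039ffffffff3f40002dffffffffeec000000000000000000024fffffffff40000000000000000000002ffffffffffa000000000000000000002ffffffffffa000000000000000000002ffffffffffa000000000000000000002ffffffffffa000000000000000000002ffffffffffa000000000000000000002ffffffffffa000000000000000000002ffffffffffa000000000000000000002ffffffffffa000000000000000000024fffffffff40000000000000000000002ffffffffffa0000bfffffffffd000000000000000000000bfffffffffd000000000000000000000bfffffffffd000000000000000000000bfffffffffd0000000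00000000000000bfffffffffd000000000000000000000bfffffffffd000000000000000000000bfffffffffd00000000000000000000407fffffff3c30000f7ffffffffcb000000000000000000002ffffffffffa0000bfffffffffd000000000000000000000bfffffffffd000000000000000000000bfffffffffd000000000000000000000bfffffffffd000000000000000000000bfffffffffd000000000000000000000bfffffffffd000000000000000000000a7ffffffffd300005ffffffffff4000000000000000000002ffffffffffa0000bfffffffffd000000000000000000000bfffffffffd000000000000000000000bfffffffffd000000000000000000000bfffffffffd000000000000000000000bfffffffffd000000000000000000000a7ffffffffd300005ffffffffff4000000000000000000002ffffffffffa0000bfffffffffd000000000000000000000bfffffffffd000000000000000000000bfffffffffd000000000000000000000bfffffffffd000000000000000000000a7ffffffffd300005ffffffffff4000000000000000000002ffffffffffa0000bfffffffffd000000000000000000000bfffffffffd000000000000000000000bfffffffffd000000000000000000000a7ffffffffd300005ffffffffff4000000000000000000002ffffffffffa0000bfffffffffd000000000000000000000bfffffffffd000000000000000000000a7ffffffffd300005ffffffffff4000000000000000000002ffffffffffa0000bfffffffffd000000000000000000000a7ffffffffd300005ffffffffff4000000000000000000002ffffffffffa0000a7ffffffffd300005ffffffffff400039ffffffff3f4000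2dffffffffeec000000000000000000024fffffffff40000000000000000000002ffffffffffa000000000000000000002ffffffffffa000000000000000000002ffffffffffa000000000000000000002ffffffffffa000000000000000000002ffffffffffa000000000000000000002ffffffffffa000000000000000000002ffffffffffa000000000000000000024fffffffff40000000000000000000002ffffffffffa0000bfffffffffd000000000000000000000bfffffffffd000000000000000000000bfffffffffd000000000000000000000bfffffffffd000000000000000000000bfffffffffd000000000000000000000bfffffffffd000000000000000000000a7ffffffffd300005ffffffffff4000000000000000000002ffffffffffa0000bfffffffffd000000000000000000000bfffffffffd000000000000000000000bfffffffffd000000000000000000000bfffffffffd000000000000000000000bfffffffffd000000000000000000000a7ffffffffd300005ffffffffff4000000000000000000002ffffffffffa0000bfffffffffd000000000000000000000bfffffffffd000000000000000000000bfffffffffd000000000000000000000bfffffffffd000000000000000000000a7ffffffffd300005ffffffffff4000000000000000000002ffffffffffa0000bfffffffffd000000000000000000000bfffffffffd000000000000000000000bfffffffffd000000000000000000000a7ffffffffd300005ffffffffff4000000000000000000002ffffffffffa0000bfffffffffd000000000000000000000bfffffffffd000000000000000000000a7ffffffffd300005ffffffffff4000000000000000000002ffffffffffa0000bfffffffffd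000000000000000000000a7ffffffffd300005ffffffffff4000000000000000000002ffffffffffa0000a7ffffffffd300005ffffffffff400039ffffffff3f40002dffffffffeec000000000000000000024fffffffff40000000000000000000002ffffffffffa000000000000000000002ffffffffffa000000000000000000002ffffffffffa000000000000000000002ffffffffffa000000000000000000002ffffffffffa000000000000000000002ffffffffffa000000000000000000024fffffffff40000000000000000000002ffffffffffa0000bfffffffffd000000000000000000000bfffffffffd000000000000000000000bfffffffffd000000000000000000000bfffffffffd000000000000000000000bfffffffffd000000000000000000000a7ffffffffd300005ffffffffff4000000000000000000002ffffffffffa0000bfffffffffd000000000000000000000bfffffffffd000000000000000000000bfffffffffd000000000000000000000bfffffffffd000000000000000000000a7ffffffffd300005ffffffffff4000000000000000000002ffffffffffa0000bfffffffffd000000000000000000000bfffffffffd000000000000000000000bfffffffffd000000000000000000000a7ffffffffd300005ffffffffff4000000000000000000002ffffffffffa0000bfffffffffd000000000000000000000bfffffffffd000000000000000000000a7ffffffffd300005ffffffffff4000000000000000000002ffffffffffa0000bfffffffffd000000000000000000000a7ffffffffd300005ffffffffff4000000000000000000002ffffffffffa0000a7ffffffffd300005ffffffffff400004fffffffffe2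00027fffffffff10000000000000000000024fffffffff40000000000000000000002ffffffffffa000000000000000000002ffffffffffa000000000000000000002ffffffffffa000000000000000000002ffffffffffa000000000000000000002ffffffffffa000000000000000000024fffffffff40000000000000000000002ffffffffffa0000bfffffffffd000000000000000000000bfffffffffd000000000000000000000bfffffffffd000000000000000000000bfffffffffd000000000000000000000a7ffffffffd300005ffffffffff4000000000000000000002ffffffffffa0000bfffffffffd000000000000000000000bfffffffffd000000000000000000000bfffffffffd000000000000000000000a7ffffffffd300005ffffffffff4000000000000000000002ffffffffffa0000bfffffffffd000000000000000000000bfffffffffd000000000000000000000a7ffffffffd300005ffffffffff4000000000000000000002ffffffffffa0000bfffffffffd000000000000000000000a7ffffffffd300005ffffffffff4000000000000000000002ffffffffffa0000a7ffffffffd300005ffffffffff400004fffffffffe200027fffffffff10000000000000000000024fffffffff40000000000000000000002ffffffffffa000000000000000000002ffffffffffa000000000000000000002ffffffffffa000000000000000000002ffffffffffa000000000000000000024fffffffff40000000000000000000002ffffffffffa0000bfffffffffd000000000000000000000bfffffffffd000000000000000000000bfffffffffd000000000000000000000a7ffffffffd300005ffffffffff4000000000000000000002ffffffffffa0000bfff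ffffffd000000000000000000000bfffffffffd000000000000000000000a7ffffffffd300005ffffffffff4000000000000000000002ffffffffffa0000bfffffffffd000000000000000000000a7ffffffffd300005ffffffffff4000000000000000000002ffffffffffa0000a7ffffffffd300005ffffffffff400004fffffffffe200027fffffffff10000000000000000000024fffffffff40000000000000000000002ffffffffffa000000000000000000002ffffffffffa000000000000000000002ffffffffffa000000000000000000024fffffffff40000000000000000000002ffffffffffa0000bfffffffffd000000000000000000000bfffffffffd000000000000000000000a7ffffffffd300005ffffffffff4000000000000000000002ffffffffffa0000bfffffffffd000000000000000000000a7ffffffffd300005ffffffffff4000000000000000000002ffffffffffa0000a7ffffffffd300005ffffffffff400004fffffffffe200027fffffffff10000000000000000000024fffffffff40000000000000000000002ffffffffffa000000000000000000002ffffffffffa000000000000000000024fffffffff40000000000000000000002ffffffffffa00015ffffffffeac00003ffffffffff000015ffffffffeac0000b7ffffffffdb000000000000000000002ffffffffffa00015ffffffffeac0000b7ffffffffdb0000effffffffede0002bffffffffef8000000000000000000024fffffffff40000000000000000000002ffffffffffa000000000000000000024fffffffff40000000000000000000002ffffffffffa00015ffffffffeac0000b7ffffffffdb0000effffffffede0002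bffffffffef8000000000000000000024fffffffff40000000000000000000024fffffffff400000effffffffede0002bffffffffef80002dffffffff5f8000e87ffffff5cd100000000000000000008bffffffff830000000000000000000024fffffffff40000000000000000000024fffffffff40000000000000000000024fffffffff40000000000000000000024fffffffff40000000000000000000024fffffffff40000000000000000000024fffffffff40000000000000000000024fffffffff40000000000000000000024fffffffff40000000000000000000024fffffffff40000000000000000000024fffffffff4000000000000000000008bffffffff83000000000000000000000bfffffffffb8000000000000000000002ffffffffffa000000000000000000002ffffffffffa000000000000000000002ffffffffffa000000000000000000002ffffffffffa000000000000000000002ffffffffffa000000000000000000002ffffffffffa000000000000000000002ffffffffffa000000000000000000002ffffffffffa000000000000000000002ffffffffffa000000000000000000024fffffffff4000000000000000000000bfffffffffb8000000000000000000002ffffffffffa000000000000000000002ffffffffffa000000000000000000002ffffffffffa000000000000000000002ffffffffffa000000000000000000002ffffffffffa000000000000000000002ffffffffffa000000000000000000002ffffffffffa000000000000000000002ffffffffffa000000000000000000024fffffffff4000000000000000000000bfffffffffb8000000000000000000002ffffffffffa000000000000000000002ffffffffffa000000000000000000002ffffffffffa000000000000000000002ffffffffffa000000000000000000002ffffffff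ffa000000000000000000002ffffffffffa000000000000000000002ffffffffffa000000000000000000024fffffffff4000000000000000000000bfffffffffb8000000000000000000002ffffffffffa000000000000000000002ffffffffffa000000000000000000002ffffffffffa000000000000000000002ffffffffffa000000000000000000002ffffffffffa000000000000000000002ffffffffffa000000000000000000024fffffffff4000000000000000000000bfffffffffb8000000000000000000002ffffffffffa000000000000000000002ffffffffffa000000000000000000002ffffffffffa000000000000000000002ffffffffffa000000000000000000002ffffffffffa000000000000000000024fffffffff4000000000000000000000bfffffffffb8000000000000000000002ffffffffffa000000000000000000002ffffffffffa000000000000000000002ffffffffffa000000000000000000002ffffffffffa000000000000000000024fffffffff4000000000000000000000bfffffffffb8000000000000000000002ffffffffffa000000000000000000002ffffffffffa000000000000000000002ffffffffffa000000000000000000024fffffffff4000000000000000000000bfffffffffb8000000000000000000002ffffffffffa000000000000000000002ffffffffffa000000000000000000024fffffffff4000000000000000000000bfffffffffb8000000000000000000002ffffffffffa000000000000000000024fffffffff4000000000000000000000bfffffffffb8000000000000000000024fffffffff4000000000000000000008bffffffff830000000000000000000024fffffffff40000000000000000000002ffffffffffa000000000000000000002ffffffffffa000000000000000000002ffffffff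ffa000000000000000000002ffffffffffa000000000000000000002ffffffffffa000000000000000000002ffffffffffa000000000000000000002ffffffffffa000000000000000000002ffffffffffa000000000000000000002ffffffffffa000000000000000000024fffffffff40000000000000000000002ffffffffffa001c67fffff631eb0000bfffffffffd0000187fffffffe6300007fffffffffe00000bfffffffffd000000000000000000000bfffffffffd000000000000000000000bfffffffffd000000000000000000000bfffffffffd000000000000000000000bfffffffffd000000000000000000000bfffffffffd0000000000000000000042ffffffff37a000137ffffffffbb000000000000000000002ffffffffffa000187fffffffe6300007fffffffffe00000bfffffffffd000000000000000000000bfffffffffd000000000000000000000bfffffffffd000000000000000000000bfffffffffd000000000000000000000bfffffffffd000000000000000000000bfffffffffd0000000000000000000042ffffffff37a000137ffffffffbb000000000000000000002ffffffffffa0000bfffffffffd000000000000000000000bfffffffffd000000000000000000000bfffffffffd000000000000000000000bfffffffffd000000000000000000000bfffffffffd000000000000000000000bfffffffffd00000000000000000000187fffffffe630000f7ffffffffcb000000000000000000002ffffffffffa0000bfffffffffd000000000000000000000bfffffffffd000000000000000000000bfffffffffd000000000000000000000bfffffffffd000000000000000000000bfffffffffd000000000000000000000a7ffffffffd300005ff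ffffffff4000000000000000000002ffffffffffa0000bfffffffffd000000000000000000000bfffffffffd000000000000000000000bfffffffffd000000000000000000000bfffffffffd000000000000000000000a7ffffffffd300005ffffffffff4000000000000000000002ffffffffffa0000bfffffffffd000000000000000000000bfffffffffd000000000000000000000bfffffffffd000000000000000000000a7ffffffffd300005ffffffffff4000000000000000000002ffffffffffa0000bfffffffffd000000000000000000000bfffffffffd000000000000000000000a7ffffffffd300005ffffffffff4000000000000000000002ffffffffffa0000bfffffffffd000000000000000000000a7ffffffffd300005ffffffffff4000000000000000000002ffffffffffa0000a7ffffffffd300005ffffffffff40003cffffffff3aa0002fffffffffee0000000000000000000024fffffffff40000000000000000000002ffffffffffa000000000000000000002ffffffffffa000000000000000000002ffffffffffa000000000000000000002ffffffffffa000000000000000000002ffffffffffa000000000000000000002ffffffffffa000000000000000000002ffffffffffa000000000000000000002ffffffffffa000000000000000000024fffffffff40000000000000000000002ffffffffffa000187fffffffe6300007fffffffffe00000bfffffffffd000000000000000000000bfffffffffd000000000000000000000bfffffffffd000000000000000000000bfffffffffd000000000000000000000bfffffffffd000000000000000000000bfffffffffd0000000000000000000042ffffffff37a000137ffffffffbb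000000000000000000002ffffffffffa0000bfffffffffd000000000000000000000bfffffffffd000000000000000000000bfffffffffd000000000000000000000bfffffffffd000000000000000000000bfffffffffd000000000000000000000bfffffffffd00000000000000000000187fffffffe630000f7ffffffffcb000000000000000000002ffffffffffa0000bfffffffffd000000000000000000000bfffffffffd000000000000000000000bfffffffffd000000000000000000000bfffffffffd000000000000000000000bfffffffffd000000000000000000000a7ffffffffd300005ffffffffff4000000000000000000002ffffffffffa0000bfffffffffd000000000000000000000bfffffffffd000000000000000000000bfffffffffd000000000000000000000bfffffffffd000000000000000000000a7ffffffffd300005ffffffffff4000000000000000000002ffffffffffa0000bfffffffffd000000000000000000000bfffffffffd000000000000000000000bfffffffffd000000000000000000000a7ffffffffd300005ffffffffff4000000000000000000002ffffffffffa0000bfffffffffd000000000000000000000bfffffffffd000000000000000000000a7ffffffffd300005ffffffffff4000000000000000000002ffffffffffa0000bfffffffffd000000000000000000000a7ffffffffd300005ffffffffff4000000000000000000002ffffffffffa0000a7ffffffffd300005ffffffffff40003cffffffff3aa0002fffffffffee0000000000000000000024fffffffff40000000000000000000002ffffffffffa000000000000000000002ffffffffffa000000000000000000002ffffffffffa0000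00000000000000002ffffffffffa000000000000000000002ffffffffffa000000000000000000002ffffffffffa000000000000000000002ffffffffffa000000000000000000024fffffffff40000000000000000000002ffffffffffa0000bfffffffffd000000000000000000000bfffffffffd000000000000000000000bfffffffffd000000000000000000000bfffffffffd000000000000000000000bfffffffffd000000000000000000000bfffffffffd00000000000000000000187fffffffe630000f7ffffffffcb000000000000000000002ffffffffffa0000bfffffffffd000000000000000000000bfffffffffd000000000000000000000bfffffffffd000000000000000000000bfffffffffd000000000000000000000bfffffffffd000000000000000000000a7ffffffffd300005ffffffffff4000000000000000000002ffffffffffa0000bfffffffffd000000000000000000000bfffffffffd000000000000000000000bfffffffffd000000000000000000000bfffffffffd000000000000000000000a7ffffffffd300005ffffffffff4000000000000000000002ffffffffffa0000bfffffffffd000000000000000000000bfffffffffd000000000000000000000bfffffffffd000000000000000000000a7ffffffffd300005ffffffffff4000000000000000000002ffffffffffa0000bfffffffffd000000000000000000000bfffffffffd000000000000000000000a7ffffffffd300005ffffffffff4000000000000000000002ffffffffffa0000bfffffffffd000000000000000000000a7ffffffffd300005ffffffffff4000000000000000000002ffffffffffa0000a7ffffffffd300005ffffffffff40003cffffffff3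aa0002fffffffffee0000000000000000000024fffffffff40000000000000000000002ffffffffffa000000000000000000002ffffffffffa000000000000000000002ffffffffffa000000000000000000002ffffffffffa000000000000000000002ffffffffffa000000000000000000002ffffffffffa000000000000000000024fffffffff40000000000000000000002ffffffffffa0000bfffffffffd000000000000000000000bfffffffffd000000000000000000000bfffffffffd000000000000000000000bfffffffffd000000000000000000000bfffffffffd000000000000000000000a7ffffffffd300005ffffffffff4000000000000000000002ffffffffffa0000bfffffffffd000000000000000000000bfffffffffd000000000000000000000bfffffffffd000000000000000000000bfffffffffd000000000000000000000a7ffffffffd300005ffffffffff4000000000000000000002ffffffffffa0000bfffffffffd000000000000000000000bfffffffffd000000000000000000000bfffffffffd000000000000000000000a7ffffffffd300005ffffffffff4000000000000000000002ffffffffffa0000bfffffffffd000000000000000000000bfffffffffd000000000000000000000a7ffffffffd300005ffffffffff4000000000000000000002ffffffffffa0000bfffffffffd000000000000000000000a7ffffffffd300005ffffffffff4000000000000000000002ffffffffffa0000a7ffffffffd300005ffffffffff400011ffffffffe940002dffffffffeec000000000000000000024fffffffff40000000000000000000002ffffffffffa000000000000000000002ffffffffffa000000000000000000002ffffffffffa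000000000000000000002ffffffffffa000000000000000000002ffffffffffa000000000000000000024fffffffff40000000000000000000002ffffffffffa0000bfffffffffd000000000000000000000bfffffffffd000000000000000000000bfffffffffd000000000000000000000bfffffffffd000000000000000000000a7ffffffffd300005ffffffffff4000000000000000000002ffffffffffa0000bfffffffffd000000000000000000000bfffffffffd000000000000000000000bfffffffffd000000000000000000000a7ffffffffd300005ffffffffff4000000000000000000002ffffffffffa0000bfffffffffd000000000000000000000bfffffffffd000000000000000000000a7ffffffffd300005ffffffffff4000000000000000000002ffffffffffa0000bfffffffffd000000000000000000000a7ffffffffd300005ffffffffff4000000000000000000002ffffffffffa0000a7ffffffffd300005ffffffffff400004fffffffffe200027fffffffff10000000000000000000024fffffffff40000000000000000000002ffffffffffa000000000000000000002ffffffffffa000000000000000000002ffffffffffa000000000000000000002ffffffffffa000000000000000000024fffffffff40000000000000000000002ffffffffffa0000bfffffffffd000000000000000000000bfffffffffd000000000000000000000bfffffffffd000000000000000000000a7ffffffffd300005ffffffffff4000000000000000000002ffffffffffa0000bfffffffffd000000000000000000000bfffffffffd000000000000000000000a7ffffffffd300005ffffffffff4000000000000000000002ffffffffffa0000bfffffff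ffd000000000000000000000a7ffffffffd300005ffffffffff4000000000000000000002ffffffffffa0000a7ffffffffd300005ffffffffff400004fffffffffe200027fffffffff10000000000000000000024fffffffff40000000000000000000002ffffffffffa000000000000000000002ffffffffffa000000000000000000002ffffffffffa000000000000000000024fffffffff40000000000000000000002ffffffffffa0000bfffffffffd000000000000000000000bfffffffffd000000000000000000000a7ffffffffd300005ffffffffff4000000000000000000002ffffffffffa0000bfffffffffd000000000000000000000a7ffffffffd300005ffffffffff4000000000000000000002ffffffffffa0000a7ffffffffd300005ffffffffff400004fffffffffe200027fffffffff10000000000000000000024fffffffff40000000000000000000002ffffffffffa000000000000000000002ffffffffffa000000000000000000024fffffffff40000000000000000000002ffffffffffa0000bfffffffffd000000000000000000000a7ffffffffd300005ffffffffff4000000000000000000002ffffffffffa0000a7ffffffffd300005ffffffffff400004fffffffffe200027fffffffff10000000000000000000024fffffffff40000000000000000000002ffffffffffa000000000000000000024fffffffff40000000000000000000002ffffffffffa0000a7ffffffffd300005ffffffffff400004fffffffffe200027fffffffff10000000000000000000024fffffffff40000000000000000000024fffffffff4000004fffffffffe200027fffffffff1000029ffffffff668000e87ffffff5cd1000000000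00000000008bffffffff830000000000000000000024fffffffff40000000000000000000024fffffffff40000000000000000000024fffffffff40000000000000000000024fffffffff40000000000000000000024fffffffff40000000000000000000024fffffffff40000000000000000000024fffffffff40000000000000000000024fffffffff40000000000000000000024fffffffff4000000000000000000008bffffffff83000000000000000000000bfffffffffb8000000000000000000002ffffffffffa000000000000000000002ffffffffffa000000000000000000002ffffffffffa000000000000000000002ffffffffffa000000000000000000002ffffffffffa000000000000000000002ffffffffffa000000000000000000002ffffffffffa000000000000000000002ffffffffffa000000000000000000024fffffffff4000000000000000000000bfffffffffb8000000000000000000002ffffffffffa000000000000000000002ffffffffffa000000000000000000002ffffffffffa000000000000000000002ffffffffffa000000000000000000002ffffffffffa000000000000000000002ffffffffffa000000000000000000002ffffffffffa000000000000000000024fffffffff4000000000000000000000bfffffffffb8000000000000000000002ffffffffffa000000000000000000002ffffffffffa000000000000000000002ffffffffffa000000000000000000002ffffffffffa000000000000000000002ffffffffffa000000000000000000002ffffffffffa000000000000000000024fffffffff4000000000000000000000bfffffffffb8000000000000000000002ffffffffffa000000000000000000002ffffffffffa000000000000000000002ffffffffffa000000000000000000002ffffffffffa000000000000000000002ffffff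ffffa000000000000000000024fffffffff4000000000000000000000bfffffffffb8000000000000000000002ffffffffffa000000000000000000002ffffffffffa000000000000000000002ffffffffffa000000000000000000002ffffffffffa000000000000000000024fffffffff4000000000000000000000bfffffffffb8000000000000000000002ffffffffffa000000000000000000002ffffffffffa000000000000000000002ffffffffffa000000000000000000024fffffffff4000000000000000000000bfffffffffb8000000000000000000002ffffffffffa000000000000000000002ffffffffffa000000000000000000024fffffffff4000000000000000000000bfffffffffb8000000000000000000002ffffffffffa000000000000000000024fffffffff4000000000000000000000bfffffffffb8000000000000000000024fffffffff4000000000000000000008bffffffff830000000000000000000024fffffffff40000000000000000000002ffffffffffa000000000000000000002ffffffffffa000000000000000000002ffffffffffa000000000000000000002ffffffffffa000000000000000000002ffffffffffa000000000000000000002ffffffffffa000000000000000000002ffffffffffa000000000000000000002ffffffffffa000000000000000000024fffffffff40000000000000000000002ffffffffffa0001affffffffe1a0000bfffffffffd0000187fffffffe6300007fffffffffe00000bfffffffffd000000000000000000000bfffffffffd000000000000000000000bfffffffffd000000000000000000000bfffffffffd000000000000000000000bfffffffffd00000000000000000000457fffffff331000177ffffffffab000000000000000000002ffffffffffa000187f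ffffffe6300007fffffffffe00000bfffffffffd000000000000000000000bfffffffffd000000000000000000000bfffffffffd000000000000000000000bfffffffffd000000000000000000000bfffffffffd000000000000000000001affffffffe1a000137ffffffffbb000000000000000000002ffffffffffa0000bfffffffffd000000000000000000000bfffffffffd000000000000000000000bfffffffffd000000000000000000000bfffffffffd000000000000000000000bfffffffffd00000000000000000000187fffffffe630000f7ffffffffcb000000000000000000002ffffffffffa0000bfffffffffd000000000000000000000bfffffffffd000000000000000000000bfffffffffd000000000000000000000bfffffffffd000000000000000000000a7ffffffffd300005ffffffffff4000000000000000000002ffffffffffa0000bfffffffffd000000000000000000000bfffffffffd000000000000000000000bfffffffffd000000000000000000000a7ffffffffd300005ffffffffff4000000000000000000002ffffffffffa0000bfffffffffd000000000000000000000bfffffffffd000000000000000000000a7ffffffffd300005ffffffffff4000000000000000000002ffffffffffa0000bfffffffffd000000000000000000000a7ffffffffd300005ffffffffff4000000000000000000002ffffffffffa0000a7ffffffffd300005ffffffffff40003fffffffff36000031ffffffffed4000000000000000000024fffffffff40000000000000000000002ffffffffffa000000000000000000002ffffffffffa000000000000000000002ffffffffffa000000000000000000002ffffffffffa0000000000000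00000002ffffffffffa000000000000000000002ffffffffffa000000000000000000002ffffffffffa000000000000000000024fffffffff40000000000000000000002ffffffffffa000187fffffffe6300007fffffffffe00000bfffffffffd000000000000000000000bfffffffffd000000000000000000000bfffffffffd000000000000000000000bfffffffffd000000000000000000000bfffffffffd000000000000000000001affffffffe1a000137ffffffffbb000000000000000000002ffffffffffa0000bfffffffffd000000000000000000000bfffffffffd000000000000000000000bfffffffffd000000000000000000000bfffffffffd000000000000000000000bfffffffffd00000000000000000000187fffffffe630000f7ffffffffcb000000000000000000002ffffffffffa0000bfffffffffd000000000000000000000bfffffffffd000000000000000000000bfffffffffd000000000000000000000bfffffffffd000000000000000000000a7ffffffffd300005ffffffffff4000000000000000000002ffffffffffa0000bfffffffffd000000000000000000000bfffffffffd000000000000000000000bfffffffffd000000000000000000000a7ffffffffd300005ffffffffff4000000000000000000002ffffffffffa0000bfffffffffd000000000000000000000bfffffffffd000000000000000000000a7ffffffffd300005ffffffffff4000000000000000000002ffffffffffa0000bfffffffffd000000000000000000000a7ffffffffd300005ffffffffff4000000000000000000002ffffffffffa0000a7ffffffffd300005ffffffffff40003fffffffff36000031ffffffffed4000000000000000000024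fffffffff40000000000000000000002ffffffffffa000000000000000000002ffffffffffa000000000000000000002ffffffffffa000000000000000000002ffffffffffa000000000000000000002ffffffffffa000000000000000000002ffffffffffa000000000000000000024fffffffff40000000000000000000002ffffffffffa0000bfffffffffd000000000000000000000bfffffffffd000000000000000000000bfffffffffd000000000000000000000bfffffffffd000000000000000000000bfffffffffd00000000000000000000187fffffffe630000f7ffffffffcb000000000000000000002ffffffffffa0000bfffffffffd000000000000000000000bfffffffffd000000000000000000000bfffffffffd000000000000000000000bfffffffffd000000000000000000000a7ffffffffd300005ffffffffff4000000000000000000002ffffffffffa0000bfffffffffd000000000000000000000bfffffffffd000000000000000000000bfffffffffd000000000000000000000a7ffffffffd300005ffffffffff4000000000000000000002ffffffffffa0000bfffffffffd000000000000000000000bfffffffffd000000000000000000000a7ffffffffd300005ffffffffff4000000000000000000002ffffffffffa0000bfffffffffd000000000000000000000a7ffffffffd300005ffffffffff4000000000000000000002ffffffffffa0000a7ffffffffd300005ffffffffff400014ffffffffe4a0002fffffffffee0000000000000000000024fffffffff40000000000000000000002ffffffffffa000000000000000000002ffffffffffa000000000000000000002ffffffffffa000000000000000000002ffffffffffa0000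00000000000000002ffffffffffa000000000000000000024fffffffff40000000000000000000002ffffffffffa0000bfffffffffd000000000000000000000bfffffffffd000000000000000000000bfffffffffd000000000000000000000bfffffffffd000000000000000000000a7ffffffffd300005ffffffffff4000000000000000000002ffffffffffa0000bfffffffffd000000000000000000000bfffffffffd000000000000000000000bfffffffffd000000000000000000000a7ffffffffd300005ffffffffff4000000000000000000002ffffffffffa0000bfffffffffd000000000000000000000bfffffffffd000000000000000000000a7ffffffffd300005ffffffffff4000000000000000000002ffffffffffa0000bfffffffffd000000000000000000000a7ffffffffd300005ffffffffff4000000000000000000002ffffffffffa0000a7ffffffffd300005ffffffffff400011ffffffffe940002dffffffffeec000000000000000000024fffffffff40000000000000000000002ffffffffffa000000000000000000002ffffffffffa000000000000000000002ffffffffffa000000000000000000002ffffffffffa000000000000000000024fffffffff40000000000000000000002ffffffffffa0000bfffffffffd000000000000000000000bfffffffffd000000000000000000000bfffffffffd000000000000000000000a7ffffffffd300005ffffffffff4000000000000000000002ffffffffffa0000bfffffffffd000000000000000000000bfffffffffd000000000000000000000a7ffffffffd300005ffffffffff4000000000000000000002ffffffffffa0000bfffffffffd000000000000000000000a7ffff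ffffd300005ffffffffff4000000000000000000002ffffffffffa0000a7ffffffffd300005ffffffffff400004fffffffffe200027fffffffff10000000000000000000024fffffffff40000000000000000000002ffffffffffa000000000000000000002ffffffffffa000000000000000000002ffffffffffa000000000000000000024fffffffff40000000000000000000002ffffffffffa0000bfffffffffd000000000000000000000bfffffffffd000000000000000000000a7ffffffffd300005ffffffffff4000000000000000000002ffffffffffa0000bfffffffffd000000000000000000000a7ffffffffd300005ffffffffff4000000000000000000002ffffffffffa0000a7ffffffffd300005ffffffffff400004fffffffffe200027fffffffff10000000000000000000024fffffffff40000000000000000000002ffffffffffa000000000000000000002ffffffffffa000000000000000000024fffffffff40000000000000000000002ffffffffffa0000bfffffffffd000000000000000000000a7ffffffffd300005ffffffffff4000000000000000000002ffffffffffa0000a7ffffffffd300005ffffffffff400004fffffffffe200027fffffffff10000000000000000000024fffffffff40000000000000000000002ffffffffffa000000000000000000024fffffffff40000000000000000000002ffffffffffa0000a7ffffffffd300005ffffffffff400004fffffffffe200027fffffffff10000000000000000000024fffffffff40000000000000000000024fffffffff4000004fffffffffe200027fffffffff100002bffffffff630000e87ffffff5cd100000000000000000008bffffffff8300000000000000000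00024fffffffff40000000000000000000024fffffffff40000000000000000000024fffffffff40000000000000000000024fffffffff40000000000000000000024fffffffff40000000000000000000024fffffffff40000000000000000000024fffffffff40000000000000000000024fffffffff4000000000000000000008bffffffff83000000000000000000000bfffffffffb8000000000000000000002ffffffffffa000000000000000000002ffffffffffa000000000000000000002ffffffffffa000000000000000000002ffffffffffa000000000000000000002ffffffffffa000000000000000000002ffffffffffa000000000000000000002ffffffffffa000000000000000000024fffffffff4000000000000000000000bfffffffffb8000000000000000000002ffffffffffa000000000000000000002ffffffffffa000000000000000000002ffffffffffa000000000000000000002ffffffffffa000000000000000000002ffffffffffa000000000000000000002ffffffffffa000000000000000000024fffffffff4000000000000000000000bfffffffffb8000000000000000000002ffffffffffa000000000000000000002ffffffffffa000000000000000000002ffffffffffa000000000000000000002ffffffffffa000000000000000000002ffffffffffa000000000000000000024fffffffff4000000000000000000000bfffffffffb8000000000000000000002ffffffffffa000000000000000000002ffffffffffa000000000000000000002ffffffffffa000000000000000000002ffffffffffa000000000000000000024fffffffff4000000000000000000000bfffffffffb8000000000000000000002ffffffffffa000000000000000000002ffffffffffa000000000000000000002ffffffffffa000000000000000000024ffffff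fff4000000000000000000000bfffffffffb8000000000000000000002ffffffffffa000000000000000000002ffffffffffa000000000000000000024fffffffff4000000000000000000000bfffffffffb8000000000000000000002ffffffffffa000000000000000000024fffffffff4000000000000000000000bfffffffffb8000000000000000000024fffffffff4000000000000000000008bffffffff830000000000000000000024fffffffff40000000000000000000002ffffffffffa000000000000000000002ffffffffffa000000000000000000002ffffffffffa000000000000000000002ffffffffffa000000000000000000002ffffffffffa000000000000000000002ffffffffffa000000000000000000002ffffffffffa000000000000000000024fffffffff40000000000000000000002ffffffffffa0001affffffffe1a0000bfffffffffd0000187fffffffe6300007fffffffffe00000bfffffffffd000000000000000000000bfffffffffd000000000000000000000bfffffffffd000000000000000000000bfffffffffd000000000000000000001d7fffffffdd1000177ffffffffab000000000000000000002ffffffffffa000187fffffffe6300007fffffffffe00000bfffffffffd000000000000000000000bfffffffffd000000000000000000000bfffffffffd000000000000000000000bfffffffffd000000000000000000001affffffffe1a000137ffffffffbb000000000000000000002ffffffffffa0000bfffffffffd000000000000000000000bfffffffffd000000000000000000000bfffffffffd000000000000000000000bfffffffffd00000000000000000000187fffffffe630000f7ffffffffcb000000000000000000002ffffffffffa0000b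fffffffffd000000000000000000000bfffffffffd000000000000000000000bfffffffffd000000000000000000000a7ffffffffd300005ffffffffff4000000000000000000002ffffffffffa0000bfffffffffd000000000000000000000bfffffffffd000000000000000000000a7ffffffffd300005ffffffffff4000000000000000000002ffffffffffa0000bfffffffffd000000000000000000000a7ffffffffd300005ffffffffff4000000000000000000002ffffffffffa0000a7ffffffffd300005ffffffffff400042ffffffff31600033ffffffffec8000000000000000000024fffffffff40000000000000000000002ffffffffffa000000000000000000002ffffffffffa000000000000000000002ffffffffffa000000000000000000002ffffffffffa000000000000000000002ffffffffffa000000000000000000002ffffffffffa000000000000000000024fffffffff40000000000000000000002ffffffffffa000187fffffffe6300007fffffffffe00000bfffffffffd000000000000000000000bfffffffffd000000000000000000000bfffffffffd000000000000000000000bfffffffffd000000000000000000001affffffffe1a000137ffffffffbb000000000000000000002ffffffffffa0000bfffffffffd000000000000000000000bfffffffffd000000000000000000000bfffffffffd000000000000000000000bfffffffffd00000000000000000000187fffffffe630000f7ffffffffcb000000000000000000002ffffffffffa0000bfffffffffd000000000000000000000bfffffffffd000000000000000000000bfffffffffd000000000000000000000a7ffffffffd300005ffffffffff4000000000000000000002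ffffffffffa0000bfffffffffd000000000000000000000bfffffffffd000000000000000000000a7ffffffffd300005ffffffffff4000000000000000000002ffffffffffa0000bfffffffffd000000000000000000000a7ffffffffd300005ffffffffff4000000000000000000002ffffffffffa0000a7ffffffffd300005ffffffffff400017ffffffffe0000031ffffffffed4000000000000000000024fffffffff40000000000000000000002ffffffffffa000000000000000000002ffffffffffa000000000000000000002ffffffffffa000000000000000000002ffffffffffa000000000000000000002ffffffffffa000000000000000000024fffffffff40000000000000000000002ffffffffffa0000bfffffffffd000000000000000000000bfffffffffd000000000000000000000bfffffffffd000000000000000000000bfffffffffd00000000000000000000187fffffffe630000f7ffffffffcb000000000000000000002ffffffffffa0000bfffffffffd000000000000000000000bfffffffffd000000000000000000000bfffffffffd000000000000000000000a7ffffffffd300005ffffffffff4000000000000000000002ffffffffffa0000bfffffffffd000000000000000000000bfffffffffd000000000000000000000a7ffffffffd300005ffffffffff4000000000000000000002ffffffffffa0000bfffffffffd000000000000000000000a7ffffffffd300005ffffffffff4000000000000000000002ffffffffffa0000a7ffffffffd300005ffffffffff400014ffffffffe4a0002fffffffffee0000000000000000000024fffffffff40000000000000000000002ffffffffffa0000000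00000000000002ffffffffffa000000000000000000002ffffffffffa000000000000000000002ffffffffffa000000000000000000024fffffffff40000000000000000000002ffffffffffa0000bfffffffffd000000000000000000000bfffffffffd000000000000000000000bfffffffffd000000000000000000000a7ffffffffd300005ffffffffff4000000000000000000002ffffffffffa0000bfffffffffd000000000000000000000bfffffffffd000000000000000000000a7ffffffffd300005ffffffffff4000000000000000000002ffffffffffa0000bfffffffffd000000000000000000000a7ffffffffd300005ffffffffff4000000000000000000002ffffffffffa0000a7ffffffffd300005ffffffffff400011ffffffffe940002dffffffffeec000000000000000000024fffffffff40000000000000000000002ffffffffffa000000000000000000002ffffffffffa000000000000000000002ffffffffffa000000000000000000024fffffffff40000000000000000000002ffffffffffa0000bfffffffffd000000000000000000000bfffffffffd000000000000000000000a7ffffffffd300005ffffffffff4000000000000000000002ffffffffffa0000bfffffffffd000000000000000000000a7ffffffffd300005ffffffffff4000000000000000000002ffffffffffa0000a7ffffffffd300005ffffffffff400004fffffffffe200027fffffffff10000000000000000000024fffffffff40000000000000000000002ffffffffffa000000000000000000002ffffffffffa000000000000000000024fffffffff40000000000000000000002ffffffffffa0000bfffffffffd000000000000000000000a7ffffffff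d300005ffffffffff4000000000000000000002ffffffffffa0000a7ffffffffd300005ffffffffff400004fffffffffe200027fffffffff10000000000000000000024fffffffff40000000000000000000002ffffffffffa000000000000000000024fffffffff40000000000000000000002ffffffffffa0000a7ffffffffd300005ffffffffff400004fffffffffe200027fffffffff10000000000000000000024fffffffff40000000000000000000024fffffffff4000004fffffffffe200027fffffffff100002dffffffff5f8000e87ffffff5cd100000000000000000008bffffffff830000000000000000000024fffffffff40000000000000000000024fffffffff40000000000000000000024fffffffff40000000000000000000024fffffffff40000000000000000000024fffffffff40000000000000000000024fffffffff40000000000000000000024fffffffff4000000000000000000008bffffffff83000000000000000000000bfffffffffb8000000000000000000002ffffffffffa000000000000000000002ffffffffffa000000000000000000002ffffffffffa000000000000000000002ffffffffffa000000000000000000002ffffffffffa000000000000000000002ffffffffffa000000000000000000024fffffffff4000000000000000000000bfffffffffb8000000000000000000002ffffffffffa000000000000000000002ffffffffffa000000000000000000002ffffffffffa000000000000000000002ffffffffffa000000000000000000002ffffffffffa000000000000000000024fffffffff4000000000000000000000bfffffffffb8000000000000000000002ffffffffffa000000000000000000002ffffffffffa000000000000000000002ffffffffffa000000000000000000002ff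ffffffffa000000000000000000024fffffffff4000000000000000000000bfffffffffb8000000000000000000002ffffffffffa000000000000000000002ffffffffffa000000000000000000002ffffffffffa000000000000000000024fffffffff4000000000000000000000bfffffffffb8000000000000000000002ffffffffffa000000000000000000002ffffffffffa000000000000000000024fffffffff4000000000000000000000bfffffffffb8000000000000000000002ffffffffffa000000000000000000024fffffffff4000000000000000000000bfffffffffb8000000000000000000024fffffffff4000000000000000000008bffffffff830000000000000000000024fffffffff40000000000000000000002ffffffffffa000000000000000000002ffffffffffa000000000000000000002ffffffffffa000000000000000000002ffffffffffa000000000000000000002ffffffffffa000000000000000000002ffffffffffa000000000000000000024fffffffff40000000000000000000002ffffffffffa0001affffffffe1a0000bfffffffffd0000187fffffffe6300007fffffffffe00000bfffffffffd000000000000000000000bfffffffffd000000000000000000000bfffffffffd000000000000000000001d7fffffffdd1000177ffffffffab000000000000000000002ffffffffffa000187fffffffe6300007fffffffffe00000bfffffffffd000000000000000000000bfffffffffd000000000000000000000bfffffffffd000000000000000000001affffffffe1a000137ffffffffbb000000000000000000002ffffffffffa0000bfffffffffd000000000000000000000bfffffffffd000000000000000000000bfffffffffd00000000000000000000187ffff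fffe630000f7ffffffffcb000000000000000000002ffffffffffa0000bfffffffffd000000000000000000000bfffffffffd000000000000000000000a7ffffffffd300005ffffffffff4000000000000000000002ffffffffffa0000bfffffffffd000000000000000000000a7ffffffffd300005ffffffffff4000000000000000000002ffffffffffa0000a7ffffffffd300005ffffffffff40001affffffffdb600033ffffffffec8000000000000000000024fffffffff40000000000000000000002ffffffffffa000000000000000000002ffffffffffa000000000000000000002ffffffffffa000000000000000000002ffffffffffa000000000000000000002ffffffffffa000000000000000000024fffffffff40000000000000000000002ffffffffffa000187fffffffe6300007fffffffffe00000bfffffffffd000000000000000000000bfffffffffd000000000000000000000bfffffffffd000000000000000000001affffffffe1a000137ffffffffbb000000000000000000002ffffffffffa0000bfffffffffd000000000000000000000bfffffffffd000000000000000000000bfffffffffd00000000000000000000187fffffffe630000f7ffffffffcb000000000000000000002ffffffffffa0000bfffffffffd000000000000000000000bfffffffffd000000000000000000000a7ffffffffd300005ffffffffff4000000000000000000002ffffffffffa0000bfffffffffd000000000000000000000a7ffffffffd300005ffffffffff4000000000000000000002ffffffffffa0000a7ffffffffd300005ffffffffff400017ffffffffe0000031ffffffffed4000000000000000000024ffff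fffff40000000000000000000002ffffffffffa000000000000000000002ffffffffffa000000000000000000002ffffffffffa000000000000000000002ffffffffffa000000000000000000024fffffffff40000000000000000000002ffffffffffa0000bfffffffffd000000000000000000000bfffffffffd000000000000000000000bfffffffffd00000000000000000000187fffffffe630000f7ffffffffcb000000000000000000002ffffffffffa0000bfffffffffd000000000000000000000bfffffffffd000000000000000000000a7ffffffffd300005ffffffffff4000000000000000000002ffffffffffa0000bfffffffffd000000000000000000000a7ffffffffd300005ffffffffff4000000000000000000002ffffffffffa0000a7ffffffffd300005ffffffffff400014ffffffffe4a0002fffffffffee0000000000000000000024fffffffff40000000000000000000002ffffffffffa000000000000000000002ffffffffffa000000000000000000002ffffffffffa000000000000000000024fffffffff40000000000000000000002ffffffffffa0000bfffffffffd000000000000000000000bfffffffffd000000000000000000000a7ffffffffd300005ffffffffff4000000000000000000002ffffffffffa0000bfffffffffd000000000000000000000a7ffffffffd300005ffffffffff4000000000000000000002ffffffffffa0000a7ffffffffd300005ffffffffff400011ffffffffe940002dffffffffeec000000000000000000024fffffffff40000000000000000000002ffffffffffa000000000000000000002ffffffffffa000000000000000000024fffffffff40000000000000000000002ffffffffffa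0000bfffffffffd000000000000000000000a7ffffffffd300005ffffffffff4000000000000000000002ffffffffffa0000a7ffffffffd300005ffffffffff400004fffffffffe200027fffffffff10000000000000000000024fffffffff40000000000000000000002ffffffffffa000000000000000000024fffffffff40000000000000000000002ffffffffffa0000a7ffffffffd300005ffffffffff400004fffffffffe200027fffffffff10000000000000000000024fffffffff40000000000000000000024fffffffff4000004fffffffffe200027fffffffff100002fffffffff5c0000e87ffffff5cd100000000000000000008bffffffff830000000000000000000024fffffffff40000000000000000000024fffffffff40000000000000000000024fffffffff40000000000000000000024fffffffff40000000000000000000024fffffffff40000000000000000000024fffffffff4000000000000000000008bffffffff83000000000000000000000bfffffffffb8000000000000000000002ffffffffffa000000000000000000002ffffffffffa000000000000000000002ffffffffffa000000000000000000002ffffffffffa000000000000000000002ffffffffffa000000000000000000024fffffffff4000000000000000000000bfffffffffb8000000000000000000002ffffffffffa000000000000000000002ffffffffffa000000000000000000002ffffffffffa000000000000000000002ffffffffffa000000000000000000024fffffffff4000000000000000000000bfffffffffb8000000000000000000002ffffffffffa000000000000000000002ffffffffffa000000000000000000002ffffffffffa000000000000000000024fffffffff4000000000000000000000bfffffffffb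8000000000000000000002ffffffffffa000000000000000000002ffffffffffa000000000000000000024fffffffff4000000000000000000000bfffffffffb8000000000000000000002ffffffffffa000000000000000000024fffffffff4000000000000000000000bfffffffffb8000000000000000000024fffffffff4000000000000000000008bffffffff830000000000000000000024fffffffff40000000000000000000002ffffffffffa000000000000000000002ffffffffffa000000000000000000002ffffffffffa000000000000000000002ffffffffffa000000000000000000002ffffffffffa000000000000000000024fffffffff40000000000000000000002ffffffffffa0001affffffffe1a0000bfffffffffd0000187fffffffe6300007fffffffffe00000bfffffffffd000000000000000000000bfffffffffd000000000000000000001d7fffffffdd1000177ffffffffab000000000000000000002ffffffffffa000187fffffffe6300007fffffffffe00000bfffffffffd000000000000000000000bfffffffffd000000000000000000001affffffffe1a000137ffffffffbb000000000000000000002ffffffffffa0000bfffffffffd000000000000000000000bfffffffffd00000000000000000000187fffffffe630000f7ffffffffcb000000000000000000002ffffffffffa0000bfffffffffd000000000000000000000a7ffffffffd300005ffffffffff4000000000000000000002ffffffffffa0000a7ffffffffd300005ffffffffff40001affffffffdb600033ffffffffec8000000000000000000024fffffffff40000000000000000000002ffffffffffa000000000000000000002ffffffffffa000000000000000000002ff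ffffffffa000000000000000000002ffffffffffa000000000000000000024fffffffff40000000000000000000002ffffffffffa000187fffffffe6300007fffffffffe00000bfffffffffd000000000000000000000bfffffffffd000000000000000000001affffffffe1a000137ffffffffbb000000000000000000002ffffffffffa0000bfffffffffd000000000000000000000bfffffffffd00000000000000000000187fffffffe630000f7ffffffffcb000000000000000000002ffffffffffa0000bfffffffffd000000000000000000000a7ffffffffd300005ffffffffff4000000000000000000002ffffffffffa0000a7ffffffffd300005ffffffffff400017ffffffffe0000031ffffffffed4000000000000000000024fffffffff40000000000000000000002ffffffffffa000000000000000000002ffffffffffa000000000000000000002ffffffffffa000000000000000000024fffffffff40000000000000000000002ffffffffffa0000bfffffffffd000000000000000000000bfffffffffd00000000000000000000187fffffffe630000f7ffffffffcb000000000000000000002ffffffffffa0000bfffffffffd000000000000000000000a7ffffffffd300005ffffffffff4000000000000000000002ffffffffffa0000a7ffffffffd300005ffffffffff400014ffffffffe4a0002fffffffffee0000000000000000000024fffffffff40000000000000000000002ffffffffffa000000000000000000002ffffffffffa000000000000000000024fffffffff40000000000000000000002ffffffffffa0000bfffffffffd000000000000000000000a7ffffffffd300005ffffffffff4000000000000000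000002ffffffffffa0000a7ffffffffd300005ffffffffff400011ffffffffe940002dffffffffeec000000000000000000024fffffffff40000000000000000000002ffffffffffa000000000000000000024fffffffff40000000000000000000002ffffffffffa0000a7ffffffffd300005ffffffffff400004fffffffffe200027fffffffff10000000000000000000024fffffffff40000000000000000000024fffffffff4000004fffffffffe200027fffffffff100000fffffffffe40000e87ffffff5cd100000000000000000008bffffffff830000000000000000000024fffffffff40000000000000000000024fffffffff40000000000000000000024fffffffff40000000000000000000024fffffffff40000000000000000000024fffffffff4000000000000000000008bffffffff83000000000000000000000bfffffffffb8000000000000000000002ffffffffffa000000000000000000002ffffffffffa000000000000000000002ffffffffffa000000000000000000002ffffffffffa000000000000000000024fffffffff4000000000000000000000bfffffffffb8000000000000000000002ffffffffffa000000000000000000002ffffffffffa000000000000000000002ffffffffffa000000000000000000024fffffffff4000000000000000000000bfffffffffb8000000000000000000002ffffffffffa000000000000000000002ffffffffffa000000000000000000024fffffffff4000000000000000000000bfffffffffb8000000000000000000002ffffffffffa000000000000000000024fffffffff4000000000000000000000bfffffffffb8000000000000000000024fffffffff4000000000000000000008bffffffff830000000000000000000024fffffffff40000000000000000000002ffffff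ffffa000000000000000000002ffffffffffa000000000000000000002ffffffffffa000000000000000000002ffffffffffa000000000000000000024fffffffff40000000000000000000002ffffffffffa0001affffffffe1a0000bfffffffffd0000187fffffffe6300007fffffffffe00000bfffffffffd000000000000000000001d7fffffffdd1000177ffffffffab000000000000000000002ffffffffffa000187fffffffe6300007fffffffffe00000bfffffffffd000000000000000000001affffffffe1a000137ffffffffbb000000000000000000002ffffffffffa0000bfffffffffd00000000000000000000187fffffffe630000f7ffffffffcb000000000000000000002ffffffffffa0000a7ffffffffd300005ffffffffff40001affffffffdb600033ffffffffec8000000000000000000024fffffffff40000000000000000000002ffffffffffa000000000000000000002ffffffffffa000000000000000000002ffffffffffa000000000000000000024fffffffff40000000000000000000002ffffffffffa000187fffffffe6300007fffffffffe00000bfffffffffd000000000000000000001affffffffe1a000137ffffffffbb000000000000000000002ffffffffffa0000bfffffffffd00000000000000000000187fffffffe630000f7ffffffffcb000000000000000000002ffffffffffa0000a7ffffffffd300005ffffffffff400017ffffffffe0000031ffffffffed4000000000000000000024fffffffff40000000000000000000002ffffffffffa000000000000000000002ffffffffffa000000000000000000024fffffffff40000000000000000000002ffffffffffa0000bfffff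ffffd00000000000000000000187fffffffe630000f7ffffffffcb000000000000000000002ffffffffffa0000a7ffffffffd300005ffffffffff400014ffffffffe4a0002fffffffffee0000000000000000000024fffffffff40000000000000000000002ffffffffffa000000000000000000024fffffffff40000000000000000000002ffffffffffa0000a7ffffffffd300005ffffffffff400011ffffffffe940002dffffffffeec000000000000000000024fffffffff40000000000000000000024fffffffff4000004fffffffffe200027fffffffff100000fffffffffe40000e87ffffff5cd100000000000000000008bffffffff830000000000000000000024fffffffff40000000000000000000024fffffffff40000000000000000000024fffffffff40000000000000000000024fffffffff4000000000000000000008bffffffff83000000000000000000000bfffffffffb8000000000000000000002ffffffffffa000000000000000000002ffffffffffa000000000000000000002ffffffffffa000000000000000000024fffffffff4000000000000000000000bfffffffffb8000000000000000000002ffffffffffa000000000000000000002ffffffffffa000000000000000000024fffffffff4000000000000000000000bfffffffffb8000000000000000000002ffffffffffa000000000000000000024fffffffff4000000000000000000000bfffffffffb8000000000000000000024fffffffff4000000000000000000008bffffffff830000000000000000000024fffffffff40000000000000000000002ffffffffffa000000000000000000002ffffffffffa000000000000000000002ffffffffffa000000000000000000024fffffffff40000000000000000000002ffffffffffa0001a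ffffffffe1a0000bfffffffffd0000187fffffffe6300007fffffffffe00001d7fffffffdd1000177ffffffffab000000000000000000002ffffffffffa000187fffffffe6300007fffffffffe00001affffffffe1a000137ffffffffbb000000000000000000002ffffffffffa000187fffffffe630000f7ffffffffcb0001affffffffdb600033ffffffffec8000000000000000000024fffffffff40000000000000000000002ffffffffffa000000000000000000002ffffffffffa000000000000000000024fffffffff40000000000000000000002ffffffffffa000187fffffffe6300007fffffffffe00001affffffffe1a000137ffffffffbb000000000000000000002ffffffffffa000187fffffffe630000f7ffffffffcb00017ffffffffe0000031ffffffffed4000000000000000000024fffffffff40000000000000000000002ffffffffffa000000000000000000024fffffffff40000000000000000000002ffffffffffa000187fffffffe630000f7ffffffffcb00014ffffffffe4a0002fffffffffee0000000000000000000024fffffffff40000000000000000000024fffffffff4000011ffffffffe940002dffffffffeec0000fffffffffe40000e87ffffff5cd100000000000000000008bffffffff830000000000000000000024fffffffff40000000000000000000024fffffffff40000000000000000000024fffffffff4000000000000000000008bffffffff83000000000000000000000bfffffffffb8000000000000000000002ffffffffffa000000000000000000002ffffffffffa000000000000000000024fffffffff4000000000000000000000bfffffffffb8000000000000000000002ff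ffffffffa000000000000000000024fffffffff4000000000000000000000bfffffffffb8000000000000000000024fffffffff4000000000000000000008bffffffff830000000000000000000024fffffffff40000000000000000000002ffffffffffa000000000000000000002ffffffffffa000000000000000000024fffffffff40000000000000000000002ffffffffffa000187fffffffe6300007fffffffffe00001affffffffe1a000137ffffffffbb000000000000000000002ffffffffffa000187fffffffe630000f7ffffffffcb00017ffffffffe0000031ffffffffed4000000000000000000024fffffffff40000000000000000000002ffffffffffa000000000000000000024fffffffff40000000000000000000002ffffffffffa000187fffffffe630000f7ffffffffcb00014ffffffffe4a0002fffffffffee0000000000000000000024fffffffff40000000000000000000024fffffffff4000011ffffffffe940002dffffffffeec0000dffffffffe78000e87ffffff5cd100000000000000000008bffffffff830000000000000000000024fffffffff40000000000000000000024fffffffff4000000000000000000008bffffffff83000000000000000000000bfffffffffb8000000000000000000002ffffffffffa000000000000000000024fffffffff4000000000000000000000bfffffffffb8000000000000000000024fffffffff4000000000000000000008bffffffff830000000000000000000024fffffffff40000000000000000000002ffffffffffa000000000000000000024fffffffff40000000000000000000002ffffffffffa0001affffffffe1a000137ffffffffbb00017ffffffffe0000031ffffffffed4000000000000000000024ffff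fffff40000000000000000000024fffffffff4000014ffffffffe4a0002fffffffffee00000dffffffffe78000e87ffffff5cd100000000000000000008bffffffff830000000000000000000024fffffffff4000000000000000000008bffffffff83000000000000000000000bfffffffffb8000000000000000000024fffffffff4000000000000000000008bffffffff830000000000000000000024fffffffff40000000000000000000024fffffffff4000014ffffffffe4a0002fffffffffee00000bffffffffeb0000e87ffffff5cd100000000000000000008bffffffff83000000000000000000008bffffffff83000000000000000000008bffffffff83000009ffffffffee8000e87ffffff5cd10000000000000000012bffffffe2b400

/-- `bsel b x y` is `x` if `b` holds and `y` otherwise. -/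
def bsel {α : Type} (b : Bool) (x y : α) : α := Bool.rec y x b

/-- The number of occurrences of `x` in `l`. -/
def cnt (x : ℕ) (l : List ℕ) : ℕ :=
  List.rec 0 (fun a _ ih => Nat.add (bsel (Nat.beq a x) 1 0) ih) l

/-- The entries of `l` other than `0`. -/
def nonzeros (l : List ℕ) : List ℕ :=
  List.rec [] (fun a _ ih => bsel (Nat.beq a 0) ih (List.cons a ih)) l

/-- Whether all entries of `l` satisfy `f`. -/
def allb (f : ℕ → Bool) (l : List ℕ) : Bool := List.rec true (fun a _ ih => bsel (f a) ih false) l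

def nmax (a b : ℕ) : ℕ := bsel (Nat.ble a b) b a

def nmin (a b : ℕ) : ℕ := bsel (Nat.ble a b) a b

/-- The largest multiplicity of an entry of `l`. -/
def maxCnt (l : List ℕ) : ℕ := List.rec 0 (fun a t ih => nmax (Nat.succ (cnt a t)) ih) l

def maxL (l : List ℕ) : ℕ := List.rec 0 (fun a _ ih => nmax a ih) l

def minL (l : List ℕ) : ℕ := List.rec 12 (fun a _ ih => nmin a ih) l

/-- Whether the denominations in `l` lie in one run. -/
def inRun (l : List ℕ) : Bool :=
  bsel (Nat.ble (maxL l) (Nat.add (minL l) 4)) true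
    (allb (fun r => bsel (Nat.ble r 3) true (Nat.beq r 12)) l)

/-- The number of distinct entries of `l`. -/
def distinctCount (l : List ℕ) : ℕ :=
  List.rec 0 (fun a t ih => Nat.add (bsel (Nat.beq (cnt a t) 0) 1 0) ih) l

/-- The return of a hand that is not a flush, given the number `w` of deuces, the denominations `l`
of the other cards and their largest multiplicity `m`. -/
def plainPay (w m : ℕ) (l : List ℕ) : ℕ :=
  bsel (Nat.beq w 4) 200 (bsel (Nat.ble 5 (Nat.add m w)) 15 (bsel (Nat.ble 4 (Nat.add m w)) 5
    (bsel (Nat.beq (distinctCount l) 2) 3 (bsel (bsel (Nat.beq m 1) (inRun l) false) 2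
      (bsel (Nat.ble 3 (Nat.add m w)) 1 0)))))

/-- The return of a flush, given the number `w` of deuces and the denominations `l` of the other
cards. -/
def flushPay (w : ℕ) (l : List ℕ) : ℕ :=
  bsel (Nat.beq w 4) 200 (bsel (Nat.ble 8 (minL l)) (bsel (Nat.beq w 0) 800 25)
    (bsel (inRun l) 9 (bsel (Nat.ble 3 w) 5 2)))

/-- The score of a return `p`: maximal expected score means maximal expected return and, subject to
that, minimal second moment. -/
def score (p : ℕ) : ℕ := Nat.sub (Nat.mul p 0x80000000000) (Nat.mul p p)

/-- The entry for the denominations `l` of a complete hand, in the format of the tables. -/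
def handEntry (l : List ℕ) : ℕ :=
  (fun w n => (fun m => (fun g => Nat.add g (bsel (Nat.beq m 1)
    (Nat.mul (Nat.sub (score (flushPay w n)) g) 0x10000000000000000) 0)) (score (plainPay w m n)))
    (maxCnt n)) (cnt 0 l) (nonzeros l)

/-- Entries are 128 bits wide, entry 0 being the least significant one, at the right end of the
literal. -/
def tableEntry (t i : ℕ) : ℕ :=
  Nat.mod (Nat.shiftRight t (Nat.mul 128 i)) 0x100000000000000000000000000000000

/-- Multisets of 2, 3 and 4 elements out of `n` are counted by these three functions. The sums in
`look` therefore rank the descending lists of each length lexicographically: `choose4 d` lists of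
length four have a first entry below `d`, and so on. -/
def choose2 (n : ℕ) : ℕ := Nat.div (Nat.mul n (Nat.add n 1)) 2

def choose3 (n : ℕ) : ℕ := Nat.div (Nat.mul n (Nat.mul (Nat.add n 1) (Nat.add n 2))) 6

def choose4 (n : ℕ) : ℕ :=
  Nat.div (Nat.mul n (Nat.mul (Nat.add n 1) (Nat.mul (Nat.add n 2) (Nat.add n 3)))) 24

/-- The entry for the denominations in the descending list `l`. -/
def look : List ℕ → ℕ
  | [] => table0
  | [a] => tableEntry table1 a
  | [b, a] => tableEntry table2 (Nat.add a (choose2 b))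
  | [c, b, a] => tableEntry table3 (Nat.add a (Nat.add (choose2 b) (choose3 c)))
  | [d, c, b, a] =>
    tableEntry table4 (Nat.add a (Nat.add (choose2 b) (Nat.add (choose3 c) (choose4 d))))
  | l => handEntry l

def lower (x : ℕ) : ℕ := Nat.mod x 0x10000000000000000

def upper (x : ℕ) : ℕ := Nat.div x 0x10000000000000000

/-- Inserts `r` into a descending list. -/
def ins (r : ℕ) (l : List ℕ) : List ℕ :=
  List.rec [r] (fun a t ih => bsel (Nat.ble r a) (List.cons a ih) (List.cons r (List.cons a t))) l

def ranks : List ℕ := [0, 1, 2, 3, 4, 5, 6, 7, 8, 9, 10, 11, 12]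

def sumRanks (f : ℕ → ℕ) : ℕ := List.rec 0 (fun a _ ih => Nat.add (f a) ih) ranks

/-- The number of cards of denomination `r` that extend cards of one suit with denominations `l` to
cards of one suit. -/
def suitedCount (r : ℕ) (l : List ℕ) : ℕ :=
  bsel (allb (fun a => Nat.beq a 0) l) (Nat.sub 4 (cnt r l))
    (bsel (Nat.beq r 0) (Nat.sub 4 (cnt r l)) (Nat.sub 1 (cnt r l)))

/-- The consistency of the entry for `l`, a list of `5 - n` denominations, with the entries for one
more card. -/
def checkEntry (n : ℕ) (l : List ℕ) : Bool :=
  bsel (Nat.beq (Nat.mul n (lower (look l)))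
      (sumRanks fun r => Nat.mul (Nat.sub 4 (cnt r l)) (lower (look (ins r l)))))
    (Nat.beq (Nat.mul n (upper (look l)))
      (sumRanks fun r => Nat.mul (suitedCount r l) (upper (look (ins r l))))) false

/-- Whether `f` holds for all lists that arise from `acc` by adding, in ascending order, `k` entries
of the list `rest`. -/
def allLists (f : List ℕ → Bool) (k : ℕ) : List ℕ → List ℕ → Bool :=
  Nat.rec (fun acc _ => f acc) (fun _ ih acc rest =>
    List.rec true (fun a t r => bsel (ih (List.cons a acc) (List.cons a t)) r false) rest) k

/-- The lanewise maximum of two packed vectors; `H` has the highest bit of each lane. -/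
def packedMax (H a b : ℕ) : ℕ :=
  (fun t => (fun h => Nat.add b (Nat.land t (Nat.sub h (Nat.shiftRight h 79)))) (Nat.land t H))
    (Nat.sub (Nat.add a H) b)

/-- The totals `x_i` are indexed by sets of required cards, the highest binary digit of `i`
belonging to the card decided on first. Holding this card keeps the upper half of the totals and
advances the weights. Discarding it replaces the totals by the differences of the lower and the
upper half, the totals over the hands without the card. -/
def best1 (H c0 c1 x0 x1 : ℕ) : ℕ :=
  packedMax H (Nat.mul c1 x1) (Nat.mul c0 (Nat.sub x0 x1))

def best2 (H c0 c1 c2 x0 x1 x2 x3 : ℕ) : ℕ :=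
  packedMax H (best1 H c1 c2 x2 x3)
    (best1 H c0 c1 (Nat.sub x0 x2) (Nat.sub x1 x3))

def best3 (H c0 c1 c2 c3 x0 x1 x2 x3 x4 x5 x6 x7 : ℕ) : ℕ :=
  packedMax H (best2 H c1 c2 c3 x4 x5 x6 x7)
    (best2 H c0 c1 c2 (Nat.sub x0 x4) (Nat.sub x1 x5) (Nat.sub x2 x6) (Nat.sub x3 x7))

def best4 (H c0 c1 c2 c3 c4 x0 x1 x2 x3 x4 x5 x6 x7 x8 x9 x10 x11 x12 x13 x14 x15 : ℕ) : ℕ :=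
  packedMax H (best3 H c1 c2 c3 c4 x8 x9 x10 x11 x12 x13 x14 x15)
    (best3 H c0 c1 c2 c3 (Nat.sub x0 x8) (Nat.sub x1 x9) (Nat.sub x2 x10) (Nat.sub x3 x11)
    (Nat.sub x4 x12) (Nat.sub x5 x13) (Nat.sub x6 x14) (Nat.sub x7 x15))

def best5 (H c0 c1 c2 c3 c4 c5 x0 x1 x2 x3 x4 x5 x6 x7 x8 x9 x10 x11 x12 x13 x14 x15 x16 x17 x18
    x19 x20 x21 x22 x23 x24 x25 x26 x27 x28 x29 x30 x31 : ℕ) : ℕ :=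
  packedMax H (best4 H c1 c2 c3 c4 c5 x16 x17 x18 x19 x20 x21 x22 x23 x24 x25 x26 x27 x28 x29 x30
    x31)
    (best4 H c0 c1 c2 c3 c4 (Nat.sub x0 x16) (Nat.sub x1 x17) (Nat.sub x2 x18) (Nat.sub x3 x19)
    (Nat.sub x4 x20) (Nat.sub x5 x21) (Nat.sub x6 x22) (Nat.sub x7 x23) (Nat.sub x8 x24) (Nat.sub
    x9 x25) (Nat.sub x10 x26) (Nat.sub x11 x27) (Nat.sub x12 x28) (Nat.sub x13 x29) (Nat.sub x14
    x30) (Nat.sub x15 x31))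

/-- The packed vector of the total scores of the hands that contain certain cards with denominations
`l`; the lanes of `m` tell where these cards are of one suit. -/
def leaf (o m : ℕ) (l : List ℕ) : ℕ :=
  (fun x => Nat.add (Nat.mul (Nat.mod x 0x10000000000000000) o)
    (Nat.mul (Nat.div x 0x10000000000000000) m)) (look l)

/-- In the binary index of a leaf the highest digit belongs to `a` and the lowest to `e`; every leaf
lists its cards from `e` towards `a`, the descending order in which `look` expects them. The six
numbers are 7669695 / C(47, 5 - k) for `k` held cards. -/
def cell (o m0 m1 m2 m3 m4 m5 m6 m7 m8 m9 m10 m11 m12 m13 m14 m15 m16 m17 m18 m19 m20 m21 m22 m23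
    m24 m25 m26 m27 m28 m29 m30 m31 a b c d e : ℕ) : ℕ :=
  best5 (Nat.mul o 0x80000000000000000000) 5 43 473 7095 163185 7669695
    (leaf o m0 [])
    (leaf o m1 [e])
    (leaf o m2 [d])
    (leaf o m3 [e, d])
    (leaf o m4 [c])
    (leaf o m5 [e, c])
    (leaf o m6 [d, c])
    (leaf o m7 [e, d, c])
    (leaf o m8 [b])
    (leaf o m9 [e, b])
    (leaf o m10 [d, b])
    (leaf o m11 [e, d, b])
    (leaf o m12 [c, b])
    (leaf o m13 [e, c, b])
    (leaf o m14 [d, c, b])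
    (leaf o m15 [e, d, c, b])
    (leaf o m16 [a])
    (leaf o m17 [e, a])
    (leaf o m18 [d, a])
    (leaf o m19 [e, d, a])
    (leaf o m20 [c, a])
    (leaf o m21 [e, c, a])
    (leaf o m22 [d, c, a])
    (leaf o m23 [e, d, c, a])
    (leaf o m24 [b, a])
    (leaf o m25 [e, b, a])
    (leaf o m26 [d, b, a])
    (leaf o m27 [e, d, b, a])
    (leaf o m28 [c, b, a])
    (leaf o m29 [e, c, b, a])
    (leaf o m30 [d, c, b, a])
    (leaf o m31 [e, d, c, b, a])

/-- Whether all entries of `l` are equal. -/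
def constant (l : List ℕ) : Bool := List.rec true (fun a t _ => allb (fun b => Nat.beq a b) t) l

/-- The positions `i ∈ V` with `w ≤ i`, replaced by the entries of `s` there. -/
def restrict (w : ℕ) (s V : List ℕ) : List ℕ :=
  List.rec [] (fun i _ ih => bsel (Nat.ble w i) (List.cons (s.getD i 0) ih) ih) V

/-- The packed vector that tells for which suit patterns the cards at the positions in `V`, except for
the first `w` positions, are of one suit. -/
def maskVec (ls : List (ℕ × List ℕ)) (w : ℕ) (V : List ℕ) : ℕ :=
  List.rec 0 (fun s _ ih => Nat.add (bsel (constant (restrict w s.2 V)) 1 0)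
    (Nat.mul 0x100000000000000000000 ih)) ls

def ones (ls : List (ℕ × List ℕ)) : ℕ :=
  List.rec 0 (fun _ _ ih => Nat.add 1 (Nat.mul 0x100000000000000000000 ih)) ls

/-- The contribution of one hand whose best hold has the value `k`. -/
def decode (k : ℕ) : ℕ :=
  (fun e => Nat.add (Nat.mul e (Nat.add 1 (Nat.shiftLeft e 200))) (Nat.shiftLeft k 100))
    (Nat.shiftRight (Nat.add k 0x7ffffffffff) 43)

/-- The weighted sum of the contributions of all lanes. -/
def decodeSum (ls : List (ℕ × List ℕ)) : ℕ → ℕ :=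
  List.rec (fun _ => 0) (fun p _ ih v =>
    Nat.add (Nat.mul p.1 (decode (Nat.mod v 0x100000000000000000000)))
      (ih (Nat.shiftRight v 80))) ls

/-- The suit patterns of five cards sorted by denomination, with the numbers of ways to realize them;
the `i`-th Boolean tells whether card `i + 1` has the denomination of card `i`, in which case its
suit has to be larger. -/
def lanes : List Bool → List (ℕ × List ℕ)
  | [false, false, false, false] => [(4, [0, 0, 0, 0, 0]), (12, [0, 0, 0, 0, 4]), (12, [0, 0, 0,
      3, 0]), (12, [0, 0, 0, 3, 3]), (24, [0, 0, 0, 3, 4]), (12, [0, 0, 2, 0, 0]), (12, [0, 0, 2,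
      0, 2]), (24, [0, 0, 2, 0, 4]), (12, [0, 0, 2, 2, 0]), (12, [0, 0, 2, 2, 2]), (24, [0, 0, 2,
      2, 4]), (24, [0, 0, 2, 3, 0]), (24, [0, 0, 2, 3, 2]), (24, [0, 0, 2, 3, 3]), (24, [0, 0, 2,
      3, 4]), (12, [0, 1, 0, 0, 0]), (12, [0, 1, 0, 0, 1]), (24, [0, 1, 0, 0, 4]), (12, [0, 1, 0,
      1, 0]), (12, [0, 1, 0, 1, 1]), (24, [0, 1, 0, 1, 4]), (24, [0, 1, 0, 3, 0]), (24, [0, 1, 0,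
      3, 1]), (24, [0, 1, 0, 3, 3]), (24, [0, 1, 0, 3, 4]), (12, [0, 1, 1, 0, 0]), (12, [0, 1, 1,
      0, 1]), (24, [0, 1, 1, 0, 4]), (12, [0, 1, 1, 1, 0]), (12, [0, 1, 1, 1, 1]), (24, [0, 1, 1,
      1, 4]), (24, [0, 1, 1, 3, 0]), (24, [0, 1, 1, 3, 1]), (24, [0, 1, 1, 3, 3]), (24, [0, 1, 1,
      3, 4]), (24, [0, 1, 2, 0, 0]), (24, [0, 1, 2, 0, 1]), (24, [0, 1, 2, 0, 2]), (24, [0, 1, 2,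
      0, 4]), (24, [0, 1, 2, 1, 0]), (24, [0, 1, 2, 1, 1]), (24, [0, 1, 2, 1, 2]), (24, [0, 1, 2,
      1, 4]), (24, [0, 1, 2, 2, 0]), (24, [0, 1, 2, 2, 1]), (24, [0, 1, 2, 2, 2]), (24, [0, 1, 2,
      2, 4]), (24, [0, 1, 2, 3, 0]), (24, [0, 1, 2, 3, 1]), (24, [0, 1, 2, 3, 2]), (24, [0, 1, 2,
      3, 3])]
  | [false, false, false, true] => [(6, [0, 0, 0, 0, 4]), (6, [0, 0, 0, 3, 0]), (12, [0, 0, 0, 3,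
      4]), (6, [0, 0, 2, 0, 2]), (12, [0, 0, 2, 0, 4]), (6, [0, 0, 2, 2, 0]), (12, [0, 0, 2, 2,
      4]), (12, [0, 0, 2, 3, 0]), (12, [0, 0, 2, 3, 2]), (12, [0, 0, 2, 3, 4]), (6, [0, 1, 0, 0,
      1]), (12, [0, 1, 0, 0, 4]), (6, [0, 1, 0, 1, 0]), (12, [0, 1, 0, 1, 4]), (12, [0, 1, 0, 3,
      0]), (12, [0, 1, 0, 3, 1]), (12, [0, 1, 0, 3, 4]), (6, [0, 1, 1, 0, 1]), (12, [0, 1, 1, 0,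
      4]), (6, [0, 1, 1, 1, 0]), (12, [0, 1, 1, 1, 4]), (12, [0, 1, 1, 3, 0]), (12, [0, 1, 1, 3,
      1]), (12, [0, 1, 1, 3, 4]), (12, [0, 1, 2, 0, 1]), (12, [0, 1, 2, 0, 2]), (12, [0, 1, 2, 0,
      4]), (12, [0, 1, 2, 1, 0]), (12, [0, 1, 2, 1, 2]), (12, [0, 1, 2, 1, 4]), (12, [0, 1, 2, 2,
      0]), (12, [0, 1, 2, 2, 1]), (12, [0, 1, 2, 2, 4]), (12, [0, 1, 2, 3, 0]), (12, [0, 1, 2, 3,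
      1]), (12, [0, 1, 2, 3, 2])]
  | [false, false, true, false] => [(6, [0, 0, 0, 3, 0]), (6, [0, 0, 0, 3, 3]), (12, [0, 0, 0, 3,
      4]), (6, [0, 0, 2, 0, 0]), (6, [0, 0, 2, 0, 2]), (12, [0, 0, 2, 0, 4]), (12, [0, 0, 2, 3,
      0]), (12, [0, 0, 2, 3, 2]), (12, [0, 0, 2, 3, 3]), (12, [0, 0, 2, 3, 4]), (6, [0, 1, 0, 1,
      0]), (6, [0, 1, 0, 1, 1]), (12, [0, 1, 0, 1, 4]), (12, [0, 1, 0, 3, 0]), (12, [0, 1, 0, 3,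
      1]), (12, [0, 1, 0, 3, 3]), (12, [0, 1, 0, 3, 4]), (6, [0, 1, 1, 0, 0]), (6, [0, 1, 1, 0,
      1]), (12, [0, 1, 1, 0, 4]), (12, [0, 1, 1, 3, 0]), (12, [0, 1, 1, 3, 1]), (12, [0, 1, 1, 3,
      3]), (12, [0, 1, 1, 3, 4]), (12, [0, 1, 2, 0, 0]), (12, [0, 1, 2, 0, 1]), (12, [0, 1, 2, 0,
      2]), (12, [0, 1, 2, 0, 4]), (12, [0, 1, 2, 1, 0]), (12, [0, 1, 2, 1, 1]), (12, [0, 1, 2, 1,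
      2]), (12, [0, 1, 2, 1, 4]), (12, [0, 1, 2, 3, 0]), (12, [0, 1, 2, 3, 1]), (12, [0, 1, 2, 3,
      2]), (12, [0, 1, 2, 3, 3])]
  | [false, false, true, true] => [(4, [0, 0, 0, 3, 4]), (4, [0, 0, 2, 0, 4]), (4, [0, 0, 2, 3,
      0]), (4, [0, 0, 2, 3, 4]), (4, [0, 1, 0, 1, 4]), (4, [0, 1, 0, 3, 1]), (4, [0, 1, 0, 3,
      4]), (4, [0, 1, 1, 0, 4]), (4, [0, 1, 1, 3, 0]), (4, [0, 1, 1, 3, 4]), (4, [0, 1, 2, 0,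
      1]), (4, [0, 1, 2, 0, 4]), (4, [0, 1, 2, 1, 0]), (4, [0, 1, 2, 1, 4]), (4, [0, 1, 2, 3,
      0]), (4, [0, 1, 2, 3, 1])]
  | [false, true, false, false] => [(6, [0, 0, 2, 0, 0]), (6, [0, 0, 2, 0, 2]), (12, [0, 0, 2, 0,
      4]), (6, [0, 0, 2, 2, 0]), (6, [0, 0, 2, 2, 2]), (12, [0, 0, 2, 2, 4]), (12, [0, 0, 2, 3,
      0]), (12, [0, 0, 2, 3, 2]), (12, [0, 0, 2, 3, 3]), (12, [0, 0, 2, 3, 4]), (6, [0, 1, 0, 0,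
      0]), (6, [0, 1, 0, 0, 1]), (12, [0, 1, 0, 0, 4]), (6, [0, 1, 0, 1, 0]), (6, [0, 1, 0, 1,
      1]), (12, [0, 1, 0, 1, 4]), (12, [0, 1, 0, 3, 0]), (12, [0, 1, 0, 3, 1]), (12, [0, 1, 0, 3,
      3]), (12, [0, 1, 0, 3, 4]), (12, [0, 1, 2, 0, 0]), (12, [0, 1, 2, 0, 1]), (12, [0, 1, 2, 0,
      2]), (12, [0, 1, 2, 0, 4]), (12, [0, 1, 2, 1, 0]), (12, [0, 1, 2, 1, 1]), (12, [0, 1, 2, 1,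
      2]), (12, [0, 1, 2, 1, 4]), (12, [0, 1, 2, 2, 0]), (12, [0, 1, 2, 2, 1]), (12, [0, 1, 2, 2,
      2]), (12, [0, 1, 2, 2, 4]), (12, [0, 1, 2, 3, 0]), (12, [0, 1, 2, 3, 1]), (12, [0, 1, 2, 3,
      2]), (12, [0, 1, 2, 3, 3])]
  | [false, true, false, true] => [(6, [0, 0, 2, 0, 2]), (8, [0, 0, 2, 0, 4]), (4, [0, 0, 2, 2,
      4]), (4, [0, 0, 2, 3, 0]), (8, [0, 0, 2, 3, 2]), (6, [0, 0, 2, 3, 4]), (4, [0, 1, 0, 0,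
      4]), (6, [0, 1, 0, 1, 0]), (8, [0, 1, 0, 1, 4]), (8, [0, 1, 0, 3, 0]), (4, [0, 1, 0, 3,
      1]), (6, [0, 1, 0, 3, 4]), (4, [0, 1, 2, 0, 1]), (8, [0, 1, 2, 0, 2]), (6, [0, 1, 2, 0,
      4]), (8, [0, 1, 2, 1, 0]), (12, [0, 1, 2, 1, 2]), (8, [0, 1, 2, 1, 4]), (4, [0, 1, 2, 2,
      0]), (4, [0, 1, 2, 2, 4]), (6, [0, 1, 2, 3, 0]), (4, [0, 1, 2, 3, 1]), (8, [0, 1, 2, 3, 2])]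
  | [false, true, true, false] => [(4, [0, 0, 2, 3, 0]), (4, [0, 0, 2, 3, 2]), (4, [0, 0, 2, 3,
      3]), (4, [0, 0, 2, 3, 4]), (4, [0, 1, 0, 3, 0]), (4, [0, 1, 0, 3, 1]), (4, [0, 1, 0, 3,
      3]), (4, [0, 1, 0, 3, 4]), (4, [0, 1, 2, 0, 0]), (4, [0, 1, 2, 0, 1]), (4, [0, 1, 2, 0,
      2]), (4, [0, 1, 2, 0, 4]), (4, [0, 1, 2, 3, 0]), (4, [0, 1, 2, 3, 1]), (4, [0, 1, 2, 3,
      2]), (4, [0, 1, 2, 3, 3])]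
  | [false, true, true, true] => [(1, [0, 0, 2, 3, 4]), (1, [0, 1, 0, 3, 4]), (1, [0, 1, 2, 0,
      4]), (1, [0, 1, 2, 3, 0])]
  | [true, false, false, false] => [(6, [0, 1, 0, 0, 0]), (6, [0, 1, 0, 0, 1]), (12, [0, 1, 0, 0,
      4]), (6, [0, 1, 0, 1, 0]), (6, [0, 1, 0, 1, 1]), (12, [0, 1, 0, 1, 4]), (12, [0, 1, 0, 3,
      0]), (12, [0, 1, 0, 3, 1]), (12, [0, 1, 0, 3, 3]), (12, [0, 1, 0, 3, 4]), (6, [0, 1, 1, 0,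
      0]), (6, [0, 1, 1, 0, 1]), (12, [0, 1, 1, 0, 4]), (6, [0, 1, 1, 1, 0]), (6, [0, 1, 1, 1,
      1]), (12, [0, 1, 1, 1, 4]), (12, [0, 1, 1, 3, 0]), (12, [0, 1, 1, 3, 1]), (12, [0, 1, 1, 3,
      3]), (12, [0, 1, 1, 3, 4]), (12, [0, 1, 2, 0, 0]), (12, [0, 1, 2, 0, 1]), (12, [0, 1, 2, 0,
      2]), (12, [0, 1, 2, 0, 4]), (12, [0, 1, 2, 1, 0]), (12, [0, 1, 2, 1, 1]), (12, [0, 1, 2, 1,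
      2]), (12, [0, 1, 2, 1, 4]), (12, [0, 1, 2, 2, 0]), (12, [0, 1, 2, 2, 1]), (12, [0, 1, 2, 2,
      2]), (12, [0, 1, 2, 2, 4]), (12, [0, 1, 2, 3, 0]), (12, [0, 1, 2, 3, 1]), (12, [0, 1, 2, 3,
      2]), (12, [0, 1, 2, 3, 3])]
  | [true, false, false, true] => [(6, [0, 1, 0, 0, 1]), (8, [0, 1, 0, 0, 4]), (4, [0, 1, 0, 1,
      4]), (4, [0, 1, 0, 3, 0]), (8, [0, 1, 0, 3, 1]), (6, [0, 1, 0, 3, 4]), (6, [0, 1, 1, 0,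
      1]), (8, [0, 1, 1, 0, 4]), (4, [0, 1, 1, 1, 4]), (4, [0, 1, 1, 3, 0]), (8, [0, 1, 1, 3,
      1]), (6, [0, 1, 1, 3, 4]), (12, [0, 1, 2, 0, 1]), (8, [0, 1, 2, 0, 2]), (8, [0, 1, 2, 0,
      4]), (4, [0, 1, 2, 1, 2]), (4, [0, 1, 2, 1, 4]), (4, [0, 1, 2, 2, 0]), (8, [0, 1, 2, 2,
      1]), (6, [0, 1, 2, 2, 4]), (4, [0, 1, 2, 3, 0]), (8, [0, 1, 2, 3, 1]), (6, [0, 1, 2, 3, 2])]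
  | [true, false, true, false] => [(6, [0, 1, 0, 1, 0]), (6, [0, 1, 0, 1, 1]), (12, [0, 1, 0, 1,
      4]), (8, [0, 1, 0, 3, 0]), (8, [0, 1, 0, 3, 1]), (8, [0, 1, 0, 3, 3]), (8, [0, 1, 0, 3,
      4]), (4, [0, 1, 1, 3, 0]), (4, [0, 1, 1, 3, 1]), (4, [0, 1, 1, 3, 3]), (4, [0, 1, 1, 3,
      4]), (4, [0, 1, 2, 0, 0]), (4, [0, 1, 2, 0, 1]), (4, [0, 1, 2, 0, 2]), (4, [0, 1, 2, 0,
      4]), (8, [0, 1, 2, 1, 0]), (8, [0, 1, 2, 1, 1]), (8, [0, 1, 2, 1, 2]), (8, [0, 1, 2, 1,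
      4]), (6, [0, 1, 2, 3, 0]), (6, [0, 1, 2, 3, 1]), (6, [0, 1, 2, 3, 2]), (6, [0, 1, 2, 3, 3])]
  | [true, false, true, true] => [(4, [0, 1, 0, 1, 4]), (4, [0, 1, 0, 3, 1]), (3, [0, 1, 0, 3,
      4]), (1, [0, 1, 1, 3, 4]), (4, [0, 1, 2, 0, 1]), (2, [0, 1, 2, 0, 4]), (2, [0, 1, 2, 1,
      4]), (1, [0, 1, 2, 3, 0]), (3, [0, 1, 2, 3, 1])]
  | [true, true, false, false] => [(4, [0, 1, 2, 0, 0]), (4, [0, 1, 2, 0, 1]), (4, [0, 1, 2, 0,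
      2]), (4, [0, 1, 2, 0, 4]), (4, [0, 1, 2, 1, 0]), (4, [0, 1, 2, 1, 1]), (4, [0, 1, 2, 1,
      2]), (4, [0, 1, 2, 1, 4]), (4, [0, 1, 2, 2, 0]), (4, [0, 1, 2, 2, 1]), (4, [0, 1, 2, 2,
      2]), (4, [0, 1, 2, 2, 4]), (4, [0, 1, 2, 3, 0]), (4, [0, 1, 2, 3, 1]), (4, [0, 1, 2, 3,
      2]), (4, [0, 1, 2, 3, 3])]
  | [true, true, false, true] => [(4, [0, 1, 2, 0, 1]), (4, [0, 1, 2, 0, 2]), (3, [0, 1, 2, 0,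
      4]), (4, [0, 1, 2, 1, 2]), (2, [0, 1, 2, 1, 4]), (1, [0, 1, 2, 2, 4]), (1, [0, 1, 2, 3,
      0]), (2, [0, 1, 2, 3, 1]), (3, [0, 1, 2, 3, 2])]
  | [true, true, true, false] => [(1, [0, 1, 2, 3, 0]), (1, [0, 1, 2, 3, 1]), (1, [0, 1, 2, 3,
      2]), (1, [0, 1, 2, 3, 3])]
  | _ => []

/-- Handing the tail on to `f` makes nested sums run over strictly increasing entries. -/
def sumTails (f : ℕ → List ℕ → ℕ) (l : List ℕ) : ℕ :=
  List.rec 0 (fun a t ih => Nat.add (f a t) ih) l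

/-- The sum of `f` over the lists of denominations that extend `acc`, whose first entry is `r`, by
denominations from `t`, those marked `true` being equal to their predecessors. -/
def sumRankLists (f : List ℕ → ℕ) (bits : List Bool) : List ℕ → ℕ → List ℕ → ℕ :=
  List.rec (fun acc _ _ => f acc) (fun b _ ih acc r t =>
    bsel b (ih (List.cons r acc) r t) (sumTails (fun r' t' => ih (List.cons r' acc) r' t') t)) bits

/-- One plus the number of leading `true`s. -/
def wildCount (bits : List Bool) : ℕ := List.rec 1 (fun b _ ih => bsel b (Nat.succ ih) 1) bits

def apply5 (f : ℕ → ℕ → ℕ → ℕ → ℕ → ℕ) : List ℕ → ℕ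
  | [e, d, c, b, a] => f a b c d e
  | _ => 0

/-- The contribution of all hands with denominations `l`. -/
def cellSum (ls : List (ℕ × List ℕ)) (mk : List ℕ → ℕ) (l : List ℕ) : ℕ :=
  decodeSum ls (apply5 (cell (ones ls)
    (mk []) (mk [4]) (mk [3]) (mk [3, 4]) (mk [2]) (mk [2, 4]) (mk [2, 3]) (mk [2, 3, 4]) (mk
    [1]) (mk [1, 4]) (mk [1, 3]) (mk [1, 3, 4]) (mk [1, 2]) (mk [1, 2, 4]) (mk [1, 2, 3]) (mk [1,
    2, 3, 4]) (mk [0]) (mk [0, 4]) (mk [0, 3]) (mk [0, 3, 4]) (mk [0, 2]) (mk [0, 2, 4]) (mk [0,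
    2, 3]) (mk [0, 2, 3, 4]) (mk [0, 1]) (mk [0, 1, 4]) (mk [0, 1, 3]) (mk [0, 1, 3, 4]) (mk [0,
    1, 2]) (mk [0, 1, 2, 4]) (mk [0, 1, 2, 3]) (mk [0, 1, 2, 3, 4])) l)

/-- The contribution of all hands that contain a deuce and whose denominations have the pattern
`bits`. -/
def wildSum (bits : List Bool) : ℕ :=
  (fun ls => sumRankLists (cellSum ls (maskVec ls (wildCount bits))) bits [0] 0
    [1, 2, 3, 4, 5, 6, 7, 8, 9, 10, 11, 12]) (lanes bits)

/-- The contribution of all hands without deuces whose denominations have the pattern `bits`. -/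
def naturalSum (bits : List Bool) : ℕ :=
  (fun ls => sumTails (fun r t => sumRankLists (cellSum ls (maskVec ls 0)) bits [r] r t)
    [1, 2, 3, 4, 5, 6, 7, 8, 9, 10, 11, 12]) (lanes bits)

end

/-! ### Kernel computations: consistency of the tables, sums over all hands. -/

set_option maxRecDepth 100000

/-- Together the five checks tie the tables to `handEntry`, which `look` returns for five
denominations: entries for `k` cards are determined by those for `k + 1` cards. -/
theorem allLists_checkEntry_0 : allLists (checkEntry 5) 0 [] ranks = true := by
  decide +kernel

theorem allLists_checkEntry_1 : allLists (checkEntry 4) 1 [] ranks = true := by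
  decide +kernel

theorem allLists_checkEntry_2 : allLists (checkEntry 3) 2 [] ranks = true := by
  decide +kernel

theorem allLists_checkEntry_3 : allLists (checkEntry 2) 3 [] ranks = true := by
  decide +kernel

theorem allLists_checkEntry_4 : allLists (checkEntry 1) 4 [] ranks = true := by
  decide +kernel

/-- Each value packs three sums over hands, starting at the bits 0, 100 and 200: those of M_1, of
2^43 M_1 - M_2, and of M_1², for the best holds. -/
theorem wildSum_0000 : wildSum [false, false, false, false] =
    0x2bcd6178bc17d4b1000021917ac1cf52de777c1270000000000000004322f5839f0 := by
  decide +kernel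

theorem naturalSum_0000 : naturalSum [false, false, false, false] =
    0x980a7291101c0d2fc00012db8975e1a96b9cbcbf840000000000000025b712ebc4c := by
  decide +kernel

theorem wildSum_0001 : wildSum [false, false, false, true] =
    0x11c30384593b645f0000098e03d0aa7af7f2259a1000000000000000131c07a1550 := by
  decide +kernel

theorem naturalSum_0001 : naturalSum [false, false, false, true] =
    0x4899f293f13fe8f800006302ff80f67a2e573f008000000000000000c605ff01f0 := by
  decide +kernel

theorem wildSum_0010 : wildSum [false, false, true, false] =
    0x11c30384593b645f0000098e03d0aa7af7f2259a1000000000000000131c07a1550 := by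
  decide +kernel

theorem naturalSum_0010 : naturalSum [false, false, true, false] =
    0x48a09e9fd56e9fe800006305b53dae7a2c76e43d8000000000000000c60b6a7b60 := by
  decide +kernel

theorem wildSum_0011 : wildSum [false, false, true, true] =
    0x760d146a98b7b480000016113330bfec308f22c800000000000000002c22666180 := by
  decide +kernel

theorem naturalSum_0011 : naturalSum [false, false, true, true] =
    0x2ec9da7909398f000000195d3b0a7ff325d7ea70000000000000000032ba761500 := by
  decide +kernel

theorem wildSum_0100 : wildSum [false, true, false, false] =
    0x11c30384593b645f0000098e03d0aa7af7f2259a1000000000000000131c07a1550 := by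
  decide +kernel

theorem naturalSum_0100 : naturalSum [false, true, false, false] =
    0x48a09e9fd56e9fe800006305b53dae7a2c76e43d8000000000000000c60b6a7b60 := by
  decide +kernel

theorem wildSum_0101 : wildSum [false, true, false, true] =
    0x45d3cb2c96e85e20000019751f5c4ff674143d62000000000000000032ea3eb8a0 := by
  decide +kernel

theorem naturalSum_0101 : naturalSum [false, true, false, true] =
    0x89295d4c8c37d3c0000101f8585f1e1d81ca659c000000000000000203f0b0be4 := by
  decide +kernel

theorem wildSum_0110 : wildSum [false, true, true, false] =
    0x760d146a98b7b480000016113330bfec308f22c800000000000000002c22666180 := by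
  decide +kernel

theorem naturalSum_0110 : naturalSum [false, true, true, false] =
    0x2ec9da7909398f000000195d3b0a7ff325d7ea70000000000000000032ba761500 := by
  decide +kernel

theorem wildSum_0111 : wildSum [false, true, true, true] =
    0x8d10b6e5b754230000000a492e497fecb6c93630000000000000000014925c930 := by
  decide +kernel

theorem naturalSum_0111 : naturalSum [false, true, true, true] =
    0x760d146a98b7b480000016113330bfec308f22c800000000000000002c2266618 := by
  decide +kernel

theorem wildSum_1000 : wildSum [true, false, false, false] =
    0x3dcf8a3a51da3173000010a4344b5eba6fe50c23a00000000000000021486896be0 := by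
  decide +kernel

theorem naturalSum_1000 : naturalSum [true, false, false, false] =
    0x46a65a219a5c76f0000061e071a06aea7f99271c0000000000000000c3c0e340d8 := by
  decide +kernel

theorem wildSum_1001 : wildSum [true, false, false, true] =
    0x1099d6defd79d5620000031a6b32dafd36d420e420000000000000000634d665b60 := by
  decide +kernel

theorem naturalSum_1001 : naturalSum [true, false, false, true] =
    0x89295d4c8c37d3c0000101f8585f1e1d81ca659c000000000000000203f0b0be4 := by
  decide +kernel

theorem wildSum_1010 : wildSum [true, false, true, false] =
    0x1099d6defd79d5620000031a6b32dafd36d420e420000000000000000634d665b60 := by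
  decide +kernel

theorem naturalSum_1010 : naturalSum [true, false, true, false] =
    0x89295d4c8c37d3c0000101f8585f1e1d81ca659c000000000000000203f0b0be4 := by
  decide +kernel

theorem wildSum_1011 : wildSum [true, false, true, true] =
    0x34e6449624bf8d20000003db715b8ff8c48b7452000000000000000007b6e2b720 := by
  decide +kernel

theorem naturalSum_1011 : naturalSum [true, false, true, true] =
    0xba34c876e7c0fb00000043e2fe4b7fe68ae0a3b0000000000000000087c5fc970 := by
  decide +kernel

theorem wildSum_1100 : wildSum [true, true, false, false] =
    0x33d27e8f08f9cbf0000003a09f895fcd4732541dc00000000000000007413f12c00 := by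
  decide +kernel

theorem naturalSum_1100 : naturalSum [true, true, false, false] =
    0x2ec9da7909398f000000195d3b0a7ff325d7ea70000000000000000032ba761500 := by
  decide +kernel

theorem wildSum_1101 : wildSum [true, true, false, true] =
    0x352a9f70e0d0c1e0000003ddedeed7dbdde92b5f000000000000000007bbdbddb0 := by
  decide +kernel

theorem naturalSum_1101 : naturalSum [true, true, false, true] =
    0xba34c876e7c0fb00000043e2fe4b7fe68ae0a3b0000000000000000087c5fc970 := by
  decide +kernel

theorem wildSum_1110 : wildSum [true, true, true, false] =
    0x61f6461f866c34c0000000892513d3f29b61104c000000000000000001124a27a80 := by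
  decide +kernel

theorem naturalSum_1110 : naturalSum [true, true, true, false] =
    0x760d146a98b7b480000016113330bfec308f22c800000000000000002c2266618 := by
  decide +kernel

/-- Five cards of one denomination do not exist, and `lanes` is empty for this pattern. -/
theorem wildSum_1111 : wildSum [true, true, true, true] =
    0x0 := by
  decide +kernel

theorem naturalSum_1111 : naturalSum [true, true, true, true] =
    0x0 := by
  decide +kernel

/-! ### Correctness of the list functions. -/

theorem bsel_eq_ite {α : Type} (b : Bool) (x y : α) : bsel b x y = if b then x else y := by
  cases b <;> rfl

theorem bsel_beq {α : Type} (a b : ℕ) (x y : α) :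
    bsel (Nat.beq a b) x y = if a = b then x else y := by
  by_cases h : a = b
  · rw [bsel_eq_ite, if_pos h, if_pos ((Nat.beq_eq ..).mpr h)]
  · rw [bsel_eq_ite, if_neg h, if_neg fun h' => h ((Nat.beq_eq ..).mp h')]

theorem bsel_ble {α : Type} (a b : ℕ) (x y : α) :
    bsel (Nat.ble a b) x y = if a ≤ b then x else y := by
  by_cases h : a ≤ b
  · rw [bsel_eq_ite, if_pos h, if_pos (Nat.ble_eq.mpr h)]
  · rw [bsel_eq_ite, if_neg h, if_neg fun h' => h (Nat.ble_eq.mp h')]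

theorem cnt_eq_count (x : ℕ) (l : List ℕ) : cnt x l = l.count x := by
  induction l with
  | nil => rfl
  | cons a t ih =>
    change Nat.add (bsel (Nat.beq a x) 1 0) (cnt x t) = _
    rw [ih, bsel_beq, List.count_cons, Nat.add_eq, add_comm]
    simp

theorem nonzeros_eq_filter (l : List ℕ) : nonzeros l = l.filter (· ≠ 0) := by
  induction l with
  | nil => rfl
  | cons a t ih =>
    change bsel (Nat.beq a 0) (nonzeros t) (a :: nonzeros t) = _
    rw [ih, bsel_beq, List.filter_cons]
    by_cases h : a = 0 <;> simp [h]

theorem allb_iff (f : ℕ → Bool) (l : List ℕ) : allb f l = true ↔ ∀ a ∈ l, f a = true := by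
  induction l with
  | nil => simp [allb]
  | cons a t ih =>
    change bsel (f a) (allb f t) false = true ↔ _
    rw [bsel_eq_ite]
    cases h : f a <;> simp [ih, h]

theorem nmax_eq_max (a b : ℕ) : nmax a b = max a b := by
  rw [nmax, bsel_ble, max_def]

theorem nmin_eq_min (a b : ℕ) : nmin a b = min a b := by
  rw [nmin, bsel_ble, min_def]

theorem maxCnt_cons (a : ℕ) (t : List ℕ) : maxCnt (a :: t) = max (t.count a + 1) (maxCnt t) := by
  rw [← cnt_eq_count, ← nmax_eq_max]; rfl

theorem count_le_maxCnt (x : ℕ) (l : List ℕ) : l.count x ≤ maxCnt l := by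
  induction l with
  | nil => simp
  | cons a t ih =>
    rw [maxCnt_cons, List.count_cons]
    by_cases h : a = x
    · subst h; simp
    · simp [h, ih]

theorem exists_count_eq_maxCnt {l : List ℕ} (hl : l ≠ []) : ∃ x ∈ l, l.count x = maxCnt l := by
  induction l with
  | nil => exact absurd rfl hl
  | cons a t ih =>
    rcases le_total (maxCnt t) (t.count a + 1) with h | h
    · exact ⟨a, by simp, by rw [maxCnt_cons, max_eq_left h]; simp⟩
    · have ht : t ≠ [] := by rintro rfl; simp [maxCnt] at h
      obtain ⟨x, hx, hxe⟩ := ih ht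
      refine ⟨x, by simp [hx], le_antisymm (count_le_maxCnt _ _) ?_⟩
      rw [maxCnt_cons, max_eq_right h, ← hxe]
      exact List.count_le_count_cons

theorem maxCnt_le_one_iff (l : List ℕ) : maxCnt l ≤ 1 ↔ l.Nodup := by
  rw [List.nodup_iff_count_le_one]
  refine ⟨fun h a => (count_le_maxCnt a l).trans h, fun h => ?_⟩
  rcases eq_or_ne l [] with rfl | hl
  · simp [maxCnt]
  · obtain ⟨x, -, hx⟩ := exists_count_eq_maxCnt hl
    exact hx ▸ h x

theorem one_le_maxCnt {l : List ℕ} (hl : l ≠ []) : 1 ≤ maxCnt l := by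
  obtain ⟨x, hx, hxe⟩ := exists_count_eq_maxCnt hl
  rw [← hxe]
  exact List.count_pos_iff.2 hx

theorem distinctCount_eq_card (l : List ℕ) : distinctCount l = l.toFinset.card := by
  induction l with
  | nil => rfl
  | cons a t ih =>
    change Nat.add (bsel (Nat.beq (cnt a t) 0) 1 0) (distinctCount t) = _
    rw [ih, bsel_beq, cnt_eq_count, Nat.add_eq, List.toFinset_cons]
    by_cases h : a ∈ t
    · rw [Finset.insert_eq_of_mem (by simpa using h), if_neg (by simpa [List.count_eq_zero] using h),
        zero_add]
    · rw [Finset.card_insert_of_notMem (by simpa using h),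
        if_pos (by simpa [List.count_eq_zero] using h), add_comm]

theorem le_minL_iff (k : ℕ) (hk : k ≤ 12) (l : List ℕ) : k ≤ minL l ↔ ∀ x ∈ l, k ≤ x := by
  induction l with
  | nil => simp [minL, hk]
  | cons a t ih =>
    change k ≤ nmin a (minL t) ↔ _
    rw [nmin_eq_min, le_min_iff, ih]; simp

theorem maxL_le_iff (k : ℕ) (l : List ℕ) : maxL l ≤ k ↔ ∀ x ∈ l, x ≤ k := by
  induction l with
  | nil => simp [maxL]
  | cons a t ih =>
    change nmax a (maxL t) ≤ k ↔ _
    rw [nmax_eq_max, max_le_iff, ih]; simp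

theorem minL_le_twelve (l : List ℕ) : minL l ≤ 12 := by
  induction l with
  | nil => simp [minL]
  | cons a t ih =>
    change nmin a (minL t) ≤ 12
    rw [nmin_eq_min]; omega

/-- The runs are the windows `{i, …, i + 4}` with `i ≤ 8` and the run with the ace low. Some window
contains `l` iff the maximum exceeds the minimum by at most 4. -/
theorem inRun_iff (l : List ℕ) (h12 : ∀ x ∈ l, x ≤ 12) :
    inRun l = true ↔
      (∀ x ∈ l, x ≤ 3 ∨ x = 12) ∨ ∃ i ≤ 8, ∀ x ∈ l, i ≤ x ∧ x ≤ i + 4 := by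
  rw [inRun, bsel_ble, Nat.add_eq]
  split_ifs with h <;> rw [maxL_le_iff] at h
  -- A window that starts above 8 would extend beyond the ace, hence the cap at 8.
  · refine iff_of_true rfl (Or.inr ⟨min (minL l) 8, min_le_right _ _, fun x hx => ?_⟩)
    have h1 := (le_minL_iff _ (minL_le_twelve l) l).1 le_rfl x hx
    have h2 := h x hx
    have h3 := h12 x hx
    omega
  · rw [allb_iff]
    -- The spread is too large for a window, so only the run with the low ace remains.
    have hn : ¬ ∃ i ≤ 8, ∀ x ∈ l, i ≤ x ∧ x ≤ i + 4 := by
      rintro ⟨i, hi, hx⟩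
      refine h fun x hxl => ?_
      have := (le_minL_iff i (by omega) l).2 fun y hy => (hx y hy).1
      have := (hx x hxl).2
      omega
    rw [or_iff_left hn]
    refine forall₂_congr fun x _ => ?_
    rw [bsel_ble]
    by_cases h3 : x ≤ 3 <;> simp [h3]

/-! ### The payout in terms of the list of denominations. -/

/-- `l` lists the denominations of the cards of `h`. -/
def Lists (l : List ℕ) (h : Finset Card) : Prop := (l : Multiset ℕ) = h.val.map fun c => c.1.val

theorem Lists.count_eq {l : List ℕ} {h : Finset Card} (H : Lists l h) (r : ℕ) :
    l.count r = (h.filter fun c => c.1.val = r).card := by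
  rw [← Multiset.coe_count, H, Multiset.count_map, Finset.card, Finset.filter_val]
  simp only [eq_comm]

theorem Lists.length_eq {l : List ℕ} {h : Finset Card} (H : Lists l h) : l.length = h.card := by
  rw [← Multiset.coe_card, H, Multiset.card_map, Finset.card]

theorem Lists.mem_iff {l : List ℕ} {h : Finset Card} (H : Lists l h) (r : ℕ) :
    r ∈ l ↔ ∃ c ∈ h, c.1.val = r := by
  rw [← Multiset.mem_coe, H, Multiset.mem_map]; rfl

theorem Lists.wilds_eq {l : List ℕ} {h : Finset Card} (H : Lists l h) : wilds h = l.count 0 := by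
  rw [H.count_eq, wilds]
  simp only [← Fin.val_eq_zero_iff]

theorem Lists.mem_nonzeros_iff {l : List ℕ} {h : Finset Card} (H : Lists l h) (r : ℕ) :
    r ∈ nonzeros l ↔ ∃ c ∈ naturals h, c.1.val = r := by
  rw [nonzeros_eq_filter, List.mem_filter, H.mem_iff]
  simp only [naturals, Finset.mem_filter, ne_eq, ← Fin.val_eq_zero_iff, decide_not,
    Bool.not_eq_eq_eq_not, Bool.not_true, decide_eq_false_iff_not]
  constructor
  · rintro ⟨⟨c, hc, rfl⟩, h0⟩
    exact ⟨c, ⟨hc, h0⟩, rfl⟩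
  · rintro ⟨c, ⟨hc, h0⟩, rfl⟩
    exact ⟨⟨c, hc, rfl⟩, h0⟩

theorem Lists.forall_naturals_iff {l : List ℕ} {h : Finset Card} (H : Lists l h) (p : ℕ → Prop) :
    (∀ c ∈ naturals h, p c.1.val) ↔ ∀ x ∈ nonzeros l, p x := by
  constructor
  · intro hp x hx
    obtain ⟨c, hc, rfl⟩ := (H.mem_nonzeros_iff x).1 hx
    exact hp c hc
  · intro hp c hc
    exact hp _ ((H.mem_nonzeros_iff _).2 ⟨c, hc, rfl⟩)

theorem Lists.mult_eq {l : List ℕ} {h : Finset Card} (H : Lists l h) (r : Fin 13) :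
    mult h r = (nonzeros l).count r.val := by
  rw [nonzeros_eq_filter]
  by_cases hr : r = 0
  · subst hr
    rw [List.count_eq_zero.2 (by simp), mult, Finset.card_eq_zero, Finset.filter_eq_empty_iff]
    intro c hc
    simpa [naturals] using (Finset.mem_filter.1 hc).2
  · have h0 : r.val ≠ 0 := by simpa using hr
    rw [List.count_filter (by simpa using hr), H.count_eq, mult, naturals, Finset.filter_filter]
    congr 1
    ext c
    simp only [Finset.mem_filter, ← Fin.val_inj]
    constructor
    · rintro ⟨a, -, b⟩; exact ⟨a, b⟩
    · rintro ⟨a, b⟩; exact ⟨a, by rintro h; rw [h] at b; exact h0 b.symm, b⟩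

theorem Lists.le_twelve {l : List ℕ} {h : Finset Card} (H : Lists l h) {x : ℕ} (hx : x ∈ l) :
    x ≤ 12 := by
  obtain ⟨c, -, rfl⟩ := (H.mem_iff x).1 hx
  omega

theorem mem_of_mem_nonzeros {l : List ℕ} {x : ℕ} (hx : x ∈ nonzeros l) : x ∈ l := by
  rw [nonzeros_eq_filter] at hx
  exact List.mem_of_mem_filter hx

theorem count_zero_add_length_nonzeros (l : List ℕ) :
    l.count 0 + (nonzeros l).length = l.length := by
  rw [nonzeros_eq_filter]
  induction l with
  | nil => rfl
  | cons a t ih =>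
    by_cases h : a = 0 <;> simp [h] at ih ⊢ <;> omega

theorem wilds_le_four (h : Finset Card) : wilds h ≤ 4 := by
  have : (h.filter fun c => c.1 = 0) ⊆ (Finset.univ : Finset (Fin 4)).image fun s => ((0, s) : Card) := by
    rintro ⟨r, s⟩ hc
    simp only [Finset.mem_filter] at hc
    simp [hc.2]
  exact (Finset.card_le_card this).trans (Finset.card_image_le.trans (by simp))

/-- The deuces are best added to a most frequent natural denomination, which exists by `hn`. -/
theorem Lists.hasKind_iff {l : List ℕ} {h : Finset Card} (H : Lists l h) (hn : nonzeros l ≠ [])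
    (k : ℕ) : HasKind k h ↔ k ≤ maxCnt (nonzeros l) + l.count 0 := by
  rw [← H.wilds_eq]
  constructor
  · rintro ⟨r, hr⟩
    rw [H.mult_eq] at hr
    have := count_le_maxCnt r.val (nonzeros l)
    omega
  · intro hk
    obtain ⟨x, hx, hxe⟩ := exists_count_eq_maxCnt hn
    have := H.le_twelve (mem_of_mem_nonzeros hx)
    refine ⟨⟨x, by omega⟩, ?_⟩
    rw [H.mult_eq, hxe]
    exact hk

theorem Lists.isStraight_iff {l : List ℕ} {h : Finset Card} (H : Lists l h)
    (hn : nonzeros l ≠ []) :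
    IsStraight h ↔ maxCnt (nonzeros l) = 1 ∧ inRun (nonzeros l) = true := by
  have h1 : (∀ r, mult h r ≤ 1) ↔ maxCnt (nonzeros l) = 1 := by
    constructor
    · intro hm
      refine le_antisymm ?_ (one_le_maxCnt hn)
      obtain ⟨x, hx, hxe⟩ := exists_count_eq_maxCnt hn
      have := H.le_twelve (mem_of_mem_nonzeros hx)
      have := hm ⟨x, by omega⟩
      rwa [H.mult_eq, hxe] at this
    · intro hm r
      rw [H.mult_eq, ← hm]
      exact count_le_maxCnt _ _
  have h2 : (∃ W ∈ runs, ∀ c ∈ naturals h, c.1 ∈ W) ↔ inRun (nonzeros l) = true := by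
    rw [inRun_iff _ fun x hx => H.le_twelve (mem_of_mem_nonzeros hx)]
    have e0 : ∀ r : Fin 13, r ∈ ({12, 0, 1, 2, 3} : Finset (Fin 13)) ↔ r.val ≤ 3 ∨ r.val = 12 := by
      decide
    -- Entry 0 of `runs` has the ace low; entry `i + 1` is the window that starts at `i`.
    have e1 : ∀ i : Fin 9, ∀ r : Fin 13, r ∈ runs[i.val + 1]'(by simp [runs]; omega) ↔
        i.val ≤ r.val ∧ r.val ≤ i.val + 4 := by
      set_option maxRecDepth 10000 in decide
    have e : ∀ i : Fin 9, ∃ W ∈ runs, ∀ r : Fin 13, r ∈ W ↔ i.val ≤ r.val ∧ r.val ≤ i.val + 4 :=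
      fun i => ⟨_, List.getElem_mem _, e1 i⟩
    have e' : ∀ W ∈ runs, (∀ r : Fin 13, r ∈ W ↔ r.val ≤ 3 ∨ r.val = 12) ∨
        ∃ i : Fin 9, ∀ r : Fin 13, r ∈ W ↔ i.val ≤ r.val ∧ r.val ≤ i.val + 4 := by
      intro W hW
      obtain ⟨j, hj, rfl⟩ := List.getElem_of_mem hW
      rcases j with - | j
      · exact Or.inl e0
      · have hj9 : j < 9 := by simp [runs] at hj; omega
        exact Or.inr ⟨⟨j, hj9⟩, e1 ⟨j, hj9⟩⟩
    rw [← H.forall_naturals_iff fun x => x ≤ 3 ∨ x = 12]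
    simp_rw [← H.forall_naturals_iff fun x => _ ≤ x ∧ x ≤ _ + 4]
    constructor
    · rintro ⟨W, hW, hc⟩
      rcases e' W hW with h | ⟨i, h⟩
      · exact Or.inl fun c hcn => (h _).1 (hc c hcn)
      · exact Or.inr ⟨i.val, by omega, fun c hcn => (h _).1 (hc c hcn)⟩
    · rintro (hc | ⟨i, hi, hc⟩)
      · exact ⟨_, by simp [runs], fun c hcn => (e0 _).2 (hc c hcn)⟩
      · obtain ⟨W, hW, h⟩ := e ⟨i, by omega⟩
        exact ⟨W, hW, fun c hcn => (h _).2 (hc c hcn)⟩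
  rw [IsStraight, h1, h2]

/-- Two cards of the same suit and denomination coincide. -/
theorem Lists.maxCnt_eq_one_of_isFlush {l : List ℕ} {h : Finset Card} (H : Lists l h)
    (hn : nonzeros l ≠ []) (hf : IsFlush h) : maxCnt (nonzeros l) = 1 := by
  refine le_antisymm ?_ (one_le_maxCnt hn)
  obtain ⟨x, hx, hxe⟩ := exists_count_eq_maxCnt hn
  have := H.le_twelve (mem_of_mem_nonzeros hx)
  rw [← hxe, show x = (⟨x, by omega⟩ : Fin 13).val from rfl, ← H.mult_eq, mult, Finset.card_le_one]
  intro a ha b hb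
  rw [Finset.mem_filter] at ha hb
  exact Prod.ext (ha.2.trans hb.2.symm) (hf a ha.1 b hb.1)

/-- Natural cards of a single denomination would give five of a kind together with the deuces, which
`hk` excludes. If there are two denominations, `hk` bounds both multiplicities by 3, and they cannot
both be 3, since there are only five cards. -/
theorem Lists.isFullHouse_iff {l : List ℕ} {h : Finset Card} (H : Lists l h) (h5 : h.card = 5)
    (hk : ¬ 4 ≤ maxCnt (nonzeros l) + l.count 0) :
    IsFullHouse h ↔ distinctCount (nonzeros l) = 2 := by
  have hlen := count_zero_add_length_nonzeros l
  rw [H.length_eq, h5] at hlen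
  have hlen2 : (nonzeros l).length = ∑ x ∈ (nonzeros l).toFinset, (nonzeros l).count x :=
    (List.sum_toFinset_count_eq_length _).symm
  rw [distinctCount_eq_card]
  constructor
  · rintro ⟨a, b, hab, ha, hb, hc⟩
    have hsub : (nonzeros l).toFinset ⊆ {a.val, b.val} := by
      intro x hx
      rw [List.mem_toFinset, H.mem_nonzeros_iff] at hx
      obtain ⟨c, hcn, rfl⟩ := hx
      rcases hc c hcn with h | h <;> simp [h]
    have hle := Finset.card_le_card hsub
    have h2 : ({a.val, b.val} : Finset ℕ).card = 2 := Finset.card_pair (by simpa [Fin.val_inj] using hab)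
    rw [h2] at hle
    by_contra hne
    have hle1 : (nonzeros l).toFinset.card ≤ 1 := by omega
    have : (nonzeros l).length ≤ maxCnt (nonzeros l) := by
      rw [hlen2]
      calc _ ≤ ∑ x ∈ (nonzeros l).toFinset, maxCnt (nonzeros l) :=
            Finset.sum_le_sum fun x _ => count_le_maxCnt x _
        _ ≤ maxCnt (nonzeros l) := by
          rw [Finset.sum_const, smul_eq_mul]
          exact (Nat.mul_le_mul_right _ hle1).trans (by rw [one_mul])
    omega
  · intro h2
    obtain ⟨a, b, hab, hS⟩ := Finset.card_eq_two.1 h2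
    rw [hS, Finset.sum_pair hab] at hlen2
    have ha := count_le_maxCnt a (nonzeros l)
    have hb := count_le_maxCnt b (nonzeros l)
    have hma : a ∈ nonzeros l := by rw [← List.mem_toFinset, hS]; simp
    have hmb : b ∈ nonzeros l := by rw [← List.mem_toFinset, hS]; simp
    have ha12 := H.le_twelve (mem_of_mem_nonzeros hma)
    have hb12 := H.le_twelve (mem_of_mem_nonzeros hmb)
    have key : ∀ a b : ℕ, a ≤ 12 → b ≤ 12 → a ≠ b → (nonzeros l).toFinset = {a, b} →
        (nonzeros l).count a ≤ 3 → (nonzeros l).count b ≤ 2 → IsFullHouse h := by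
      intro a b ha hb hab hS h3 h2
      refine ⟨⟨a, by omega⟩, ⟨b, by omega⟩, by simpa using hab, by rwa [H.mult_eq],
        by rwa [H.mult_eq], fun c hc => ?_⟩
      have : c.1.val ∈ (nonzeros l).toFinset := by
        rw [List.mem_toFinset, H.mem_nonzeros_iff]; exact ⟨c, hc, rfl⟩
      rw [hS] at this
      simpa [Fin.ext_iff] using this
    by_cases h2' : (nonzeros l).count b ≤ 2
    · exact key a b ha12 hb12 hab hS (by omega) h2'
    · exact key b a hb12 ha12 hab.symm (by rw [hS, Finset.pair_comm]) (by omega) (by omega)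

theorem Lists.isRoyal_iff {l : List ℕ} {h : Finset Card} (H : Lists l h) :
    IsRoyal h ↔ IsFlush h ∧ 8 ≤ minL (nonzeros l) := by
  rw [IsRoyal, le_minL_iff 8 (by norm_num), ← H.forall_naturals_iff fun x => 8 ≤ x]
  rfl

theorem Lists.nonzeros_ne_nil {l : List ℕ} {h : Finset Card} (H : Lists l h) (h5 : h.card = 5) :
    nonzeros l ≠ [] := by
  intro h0
  have h1 := count_zero_add_length_nonzeros l
  have h2 := wilds_le_four h
  rw [H.wilds_eq] at h2
  rw [h0, H.length_eq, h5, List.length_nil] at h1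
  omega

/-- Suits enter through the flush property only. The natural cards of a flush have distinct
denominations; hence all multiplicity comes from the deuces, and a full house would need three
deuces, which already make four of a kind. -/
theorem Lists.payout_eq {l : List ℕ} {h : Finset Card} (H : Lists l h) (h5 : h.card = 5) :
    payout h = if IsFlush h then flushPay (l.count 0) (nonzeros l)
      else plainPay (l.count 0) (maxCnt (nonzeros l)) (nonzeros l) := by
  have hn := H.nonzeros_ne_nil h5
  have hlen := count_zero_add_length_nonzeros l
  rw [H.length_eq, h5] at hlen
  have hw := wilds_le_four h
  rw [H.wilds_eq] at hw
  have hm1 := one_le_maxCnt hn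
  have hK : ∀ k, HasKind k h ↔ k ≤ maxCnt (nonzeros l) + l.count 0 := H.hasKind_iff hn
  have hS := H.isStraight_iff hn
  have hR := H.isRoyal_iff
  rw [payout]
  simp only [flushPay, plainPay, bsel_eq_ite, Nat.beq_eq, Nat.ble_eq, Nat.add_eq, hK, hS, hR,
    H.wilds_eq]
  by_cases hf : IsFlush h
  · have hm := H.maxCnt_eq_one_of_isFlush hn hf
    have hd : distinctCount (nonzeros l) = (nonzeros l).length := by
      rw [distinctCount_eq_card]
      exact List.toFinset_card_of_nodup ((maxCnt_le_one_iff _).1 hm.le)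
    have hfh : ¬ 4 ≤ maxCnt (nonzeros l) + l.count 0 → ¬ IsFullHouse h := by
      intro hk hfh
      rw [H.isFullHouse_iff h5 hk, hd] at hfh
      omega
    rw [hm] at hfh
    simp only [eq_true hf, hm, true_and, and_true, if_true]
    by_cases hk : 4 ≤ 1 + l.count 0
    · simp only [eq_true hk, if_true]
      split_ifs <;> first | rfl | omega
    · simp only [eq_false hk, eq_false (hfh hk), if_false]
      split_ifs <;> first | rfl | omega
  · simp only [eq_false hf, false_and, and_false, if_false]
    by_cases hk : 4 ≤ maxCnt (nonzeros l) + l.count 0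
    · simp only [eq_true hk, if_true]
    · simp only [eq_false hk, if_false, H.isFullHouse_iff h5 hk, Bool.if_false_right,
        Bool.and_eq_true, decide_eq_true_eq]

/-! ### Scores of complete hands. -/

theorem score_eq (p : ℕ) : score p = p * 2 ^ 43 - p * p := rfl

theorem plainPay_mem (w m : ℕ) (l : List ℕ) :
    plainPay w m l = 200 ∧ w = 4 ∨ plainPay w m l = 15 ∧ 5 ≤ m + w ∨
      plainPay w m l = 5 ∧ 4 ≤ m + w ∨ plainPay w m l = 3 ∧ distinctCount l = 2 ∨
      plainPay w m l = 2 ∧ inRun l = true ∨ plainPay w m l = 1 ∨ plainPay w m l = 0 := by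
  simp only [plainPay, bsel_eq_ite, Nat.beq_eq, Nat.ble_eq, Nat.add_eq]
  split_ifs <;> simp_all

/-- This makes the truncated subtraction in `handEntry` exact: for distinct natural denominations a
common suit never lowers the score. -/
theorem score_plainPay_le (w : ℕ) (l : List ℕ) (hw : w ≤ 4) (hl : w + l.length = 5)
    (hm : maxCnt l = 1) : score (plainPay w 1 l) ≤ score (flushPay w l) := by
  have hd : distinctCount l = l.length := by
    rw [distinctCount_eq_card]
    exact List.toFinset_card_of_nodup ((maxCnt_le_one_iff _).1 hm.le)
  rcases plainPay_mem w 1 l with ⟨h, h'⟩ | ⟨h, h'⟩ | ⟨h, h'⟩ | ⟨h, h'⟩ | ⟨h, h'⟩ | h | h <;> rw [h] <;>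
    simp only [flushPay, bsel_eq_ite, Nat.beq_eq, Nat.ble_eq] <;> split_ifs <;>
    first | (exfalso; simp_all; done) | (exfalso; omega) | decide

theorem score_plainPay_lt (w m : ℕ) (l : List ℕ) : score (plainPay w m l) < 2 ^ 64 := by
  rcases plainPay_mem w m l with ⟨h, h'⟩ | ⟨h, h'⟩ | ⟨h, h'⟩ | ⟨h, h'⟩ | ⟨h, h'⟩ | h | h <;> rw [h] <;>
    decide

theorem lower_add_mul (a b : ℕ) (ha : a < 2 ^ 64) : lower (a + b * 2 ^ 64) = a := by
  change (a + b * 2 ^ 64) % 2 ^ 64 = a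
  rw [Nat.add_mul_mod_self_right, Nat.mod_eq_of_lt ha]

theorem upper_add_mul (a b : ℕ) (ha : a < 2 ^ 64) : upper (a + b * 2 ^ 64) = b := by
  change (a + b * 2 ^ 64) / 2 ^ 64 = b
  rw [Nat.add_mul_div_right _ _ (by norm_num), Nat.div_eq_of_lt ha, zero_add]

theorem handEntry_eq (l : List ℕ) :
    handEntry l = score (plainPay (l.count 0) (maxCnt (nonzeros l)) (nonzeros l)) +
      (if maxCnt (nonzeros l) = 1 then score (flushPay (l.count 0) (nonzeros l)) -
        score (plainPay (l.count 0) (maxCnt (nonzeros l)) (nonzeros l)) else 0) * 2 ^ 64 := by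
  rw [handEntry]
  simp only [bsel_beq, cnt_eq_count, Nat.add_eq, Nat.mul_eq, Nat.sub_eq]
  split_ifs <;> simp

theorem Lists.score_payout_eq {l : List ℕ} {h : Finset Card} (H : Lists l h) (h5 : h.card = 5) :
    score (payout h) = lower (handEntry l) + if IsFlush h then upper (handEntry l) else 0 := by
  have hn := H.nonzeros_ne_nil h5
  have hlen := count_zero_add_length_nonzeros l
  rw [H.length_eq, h5] at hlen
  have hw := wilds_le_four h
  rw [H.wilds_eq] at hw
  rw [H.payout_eq h5, handEntry_eq, lower_add_mul _ _ (score_plainPay_lt _ _ _),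
    upper_add_mul _ _ (score_plainPay_lt _ _ _)]
  by_cases hf : IsFlush h
  · have hm := H.maxCnt_eq_one_of_isFlush hn hf
    have := score_plainPay_le _ _ hw hlen hm
    rw [hm, if_pos hf, if_pos hf, if_pos rfl]
    omega
  · rw [if_neg hf, if_neg hf, add_zero]

theorem payout_le (h : Finset Card) : payout h ≤ 800 := by
  rw [payout]
  split_ifs <;> norm_num

/-! ### Totals over the hands that contain given cards, and correctness of the tables. -/

/-- The total score of the hands that contain all cards in `S` and none in `T`. -/
def total (S T : Finset Card) : ℕ :=
  ∑ H ∈ (Finset.powersetCard 5 Finset.univ).filter (fun H => S ⊆ H ∧ Disjoint H T), score (payout H)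

/-- This split by the presence of `c` is the inclusion-exclusion step behind all differences in
`best1`, …, `best5` and `bestWith`. -/
theorem total_eq_add (S T : Finset Card) (c : Card) :
    total S T = total S (insert c T) + total (insert c S) T := by
  rw [total, ← Finset.sum_filter_not_add_sum_filter _ (fun H => c ∈ H), Finset.filter_filter,
    Finset.filter_filter, total, total]
  congr 2 <;> ext H <;>
    simp only [Finset.mem_filter, Finset.disjoint_insert_right, Finset.insert_subset_iff] <;> tauto

/-- Double counting: a five-card hand `H ⊇ S` occurs once for each of its `5 - S.card` cards outside
`S`. -/
theorem sum_total_insert (S : Finset Card) :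
    ∑ c ∈ Sᶜ, total (insert c S) ∅ = (5 - S.card) * total S ∅ := by
  simp only [total, Finset.disjoint_empty_right, and_true, Finset.mul_sum, Finset.sum_filter]
  rw [Finset.sum_comm]
  refine Finset.sum_congr rfl fun H hH => ?_
  rw [Finset.mem_powersetCard] at hH
  by_cases hS : S ⊆ H
  · rw [if_pos hS, ← hH.2, ← Finset.card_sdiff_of_subset hS, ← smul_eq_mul, ← Finset.sum_const,
      ← Finset.sum_filter]
    congr 1
    ext c
    simp only [Finset.mem_filter, Finset.mem_compl, Finset.mem_sdiff, Finset.insert_subset_iff]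
    tauto
  · rw [if_neg hS, mul_zero]
    exact Finset.sum_eq_zero fun c _ => if_neg fun h => hS ((Finset.subset_insert _ _).trans h)

theorem total_of_card_eq_five {S : Finset Card} (h5 : S.card = 5) : total S ∅ = score (payout S) := by
  rw [total]
  convert Finset.sum_singleton _ S
  ext H
  simp only [Finset.mem_filter, Finset.mem_powersetCard, Finset.subset_univ, true_and,
    Finset.disjoint_empty_right, and_true, Finset.mem_singleton]
  constructor
  · rintro ⟨h, hS⟩
    exact (Finset.eq_of_subset_of_card_le hS (by omega)).symm
  · rintro rfl
    exact ⟨h5, Finset.Subset.refl _⟩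

theorem card_filter_rank (r : ℕ) (hr : r < 13) :
    ((Finset.univ : Finset Card).filter fun c => c.1.val = r).card = 4 := by
  have : ((Finset.univ : Finset Card).filter fun c => c.1.val = r) =
      {(⟨r, hr⟩ : Fin 13)} ×ˢ Finset.univ := by
    ext ⟨a, b⟩
    simp [Fin.ext_iff, eq_comm]
  rw [this]
  simp

theorem Lists.card_filter_compl {l : List ℕ} {S : Finset Card} (H : Lists l S) {r : ℕ}
    (hr : r < 13) : (Sᶜ.filter fun c => c.1.val = r).card = 4 - l.count r := by
  have h := Finset.card_sdiff_of_subset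
    (Finset.filter_subset_filter (fun c : Card => c.1.val = r) (Finset.subset_univ S))
  rw [card_filter_rank r hr] at h
  rw [H.count_eq, ← h]
  congr 1
  ext c
  simp only [Finset.mem_filter, Finset.mem_compl, Finset.mem_sdiff, Finset.mem_univ, true_and]
  tauto

theorem Lists.sum_compl {l : List ℕ} {S : Finset Card} (H : Lists l S) (φ : ℕ → ℕ) :
    ∑ c ∈ Sᶜ, φ c.1.val = ∑ r ∈ Finset.range 13, (4 - l.count r) * φ r := by
  rw [← Finset.sum_fiberwise_of_maps_to (t := Finset.range 13) (g := fun c : Card => c.1.val)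
    (fun c _ => Finset.mem_range.2 c.1.isLt)]
  refine Finset.sum_congr rfl fun r hr => ?_
  rw [← H.card_filter_compl (Finset.mem_range.1 hr), ← smul_eq_mul, ← Finset.sum_const]
  refine Finset.sum_congr rfl fun c hc => ?_
  rw [(Finset.mem_filter.1 hc).2]

theorem isFlush_of_subset {S S' : Finset Card} (h : S ⊆ S') (hf : IsFlush S') : IsFlush S :=
  fun c hc d hd => hf c (Finset.filter_subset_filter _ h hc) d (Finset.filter_subset_filter _ h hd)

theorem mem_naturals_insert {S : Finset Card} {c d : Card} :
    d ∈ naturals (insert c S) ↔ d = c ∧ c.1 ≠ 0 ∨ d ∈ naturals S := by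
  simp only [naturals, Finset.mem_filter, Finset.mem_insert]
  constructor
  · rintro ⟨rfl | h, h0⟩
    · exact Or.inl ⟨rfl, h0⟩
    · exact Or.inr ⟨h, h0⟩
  · rintro (⟨rfl, h0⟩ | ⟨h, h0⟩)
    · exact ⟨Or.inl rfl, h0⟩
    · exact ⟨Or.inr h, h0⟩

theorem isFlush_insert_iff {S : Finset Card} {c : Card} (hf : IsFlush S) :
    IsFlush (insert c S) ↔ c.1 = 0 ∨ ∀ d ∈ naturals S, c.2 = d.2 := by
  constructor
  · intro h
    by_cases h0 : c.1 = 0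
    · exact Or.inl h0
    · exact Or.inr fun d hd => h c (mem_naturals_insert.2 (Or.inl ⟨rfl, h0⟩)) d
        (mem_naturals_insert.2 (Or.inr hd))
  · intro h a ha b hb
    rw [mem_naturals_insert] at ha hb
    rcases ha with ⟨rfl, ha⟩ | ha <;> rcases hb with ⟨rfl, hb⟩ | hb
    · rfl
    · rcases h with h | h
      · exact absurd h ha
      · exact h b hb
    · rcases h with h | h
      · exact absurd h hb
      · exact (h a ha).symm
    · exact hf a ha b hb

theorem suitedCount_eq (r : ℕ) (l : List ℕ) : suitedCount r l =
    if (∀ a ∈ l, a = 0) ∨ r = 0 then 4 - l.count r else 1 - l.count r := by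
  rw [suitedCount, bsel_beq, bsel_eq_ite, cnt_eq_count]
  simp only [allb_iff, Nat.beq_eq, Nat.sub_eq]
  split_ifs <;> first | rfl | tauto

/-- All missing cards of denomination `r` are allowed if they are deuces or if `S` has no natural
card. Otherwise the suit is forced, and a single card remains, unless it is already in `S`. -/
theorem Lists.card_filter_isFlush {l : List ℕ} {S : Finset Card} (H : Lists l S) (hf : IsFlush S)
    {r : ℕ} (hr : r < 13) :
    (Sᶜ.filter fun c => IsFlush (insert c S) ∧ c.1.val = r).card = suitedCount r l := by
  rw [suitedCount_eq]
  split_ifs with h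
  · rw [← H.card_filter_compl hr]
    congr 1
    ext c
    simp only [Finset.mem_filter, Finset.mem_compl]
    refine and_congr_right fun _ => and_iff_right_of_imp fun hc => ?_
    rw [isFlush_insert_iff hf]
    rcases h with h | rfl
    · refine Or.inr fun d hd => ?_
      have hd' := Finset.mem_filter.1 hd
      exact absurd (Fin.val_eq_zero_iff.1 (h _ ((H.mem_iff _).2 ⟨d, hd'.1, rfl⟩))) hd'.2
    · exact Or.inl (Fin.val_eq_zero_iff.1 hc)
  · push Not at h
    obtain ⟨⟨a, ha, ha0⟩, hr0⟩ := h
    obtain ⟨d, hd, hda⟩ := (H.mem_iff a).1 ha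
    have hdn : d ∈ naturals S :=
      Finset.mem_filter.2 ⟨hd, fun h0 => ha0 (by rw [← hda, h0]; rfl)⟩
    -- The natural card `d` of `S` prescribes the suit, so `e` is the only candidate of denomination
    -- `r`.
    set e : Card := (⟨r, hr⟩, d.2) with he
    have he0 : e.1 ≠ 0 := fun h0 => hr0 (by rw [show r = e.1.val from rfl, h0]; rfl)
    have hfe : ∀ c : Card, c.1.val = r → (IsFlush (insert c S) ↔ c = e) := by
      intro c hc
      have hc1 : c.1 = e.1 := Fin.ext hc
      rw [isFlush_insert_iff hf, hc1, or_iff_right he0]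
      constructor
      · intro h
        exact Prod.ext hc1 (h d hdn)
      · rintro rfl d' hd'
        exact hf d hdn d' hd'
    have hS : ∀ c ∈ S, c.1.val = r → c = e := by
      intro c hc hcr
      refine (hfe c hcr).1 ?_
      rwa [Finset.insert_eq_of_mem hc]
    by_cases heS : e ∈ S
    · have : l.count r = 1 := by
        rw [H.count_eq, Finset.card_eq_one]
        refine ⟨e, ?_⟩
        ext c
        simp only [Finset.mem_filter, Finset.mem_singleton]
        constructor
        · rintro ⟨h1, h2⟩; exact hS c h1 h2
        · rintro rfl; exact ⟨heS, rfl⟩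
      rw [this, Finset.card_eq_zero, Finset.filter_eq_empty_iff]
      rintro c hc ⟨h1, h2⟩
      rw [(hfe c h2).1 h1] at hc
      exact Finset.mem_compl.1 hc heS
    · have : l.count r = 0 := by
        rw [H.count_eq, Finset.card_eq_zero, Finset.filter_eq_empty_iff]
        intro c hc hcr
        rw [hS c hc hcr] at hc
        exact heS hc
      rw [this, Finset.card_eq_one]
      refine ⟨e, ?_⟩
      ext c
      simp only [Finset.mem_filter, Finset.mem_singleton, Finset.mem_compl]
      constructor
      · rintro ⟨-, h1, h2⟩; exact (hfe c h2).1 h1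
      · rintro rfl; exact ⟨heS, (hfe e rfl).2 rfl, rfl⟩

theorem Lists.sum_compl_isFlush {l : List ℕ} {S : Finset Card} (H : Lists l S) (φ : ℕ → ℕ) :
    ∑ c ∈ Sᶜ, (if IsFlush (insert c S) then φ c.1.val else 0) =
      if IsFlush S then ∑ r ∈ Finset.range 13, suitedCount r l * φ r else 0 := by
  split_ifs with hf
  · rw [← Finset.sum_filter, ← Finset.sum_fiberwise_of_maps_to (t := Finset.range 13)
      (g := fun c : Card => c.1.val) (fun c _ => Finset.mem_range.2 c.1.isLt)]
    refine Finset.sum_congr rfl fun r hr => ?_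
    rw [← H.card_filter_isFlush hf (Finset.mem_range.1 hr), ← smul_eq_mul, ← Finset.sum_const,
      Finset.filter_filter]
    refine Finset.sum_congr rfl fun c hc => ?_
    rw [(Finset.mem_filter.1 hc).2.2]
  · exact Finset.sum_eq_zero fun c _ =>
      if_neg fun h => hf (isFlush_of_subset (Finset.subset_insert _ _) h)

theorem ins_perm (r : ℕ) (l : List ℕ) : (ins r l).Perm (r :: l) := by
  induction l with
  | nil => exact List.Perm.refl _
  | cons a t ih =>
    change (bsel (Nat.ble r a) (a :: ins r t) (r :: a :: t)).Perm _
    rw [bsel_ble]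
    split_ifs
    · exact (ih.cons a).trans (List.Perm.swap r a t)
    · exact List.Perm.refl _

theorem ins_pairwise (r : ℕ) {l : List ℕ} (hl : l.Pairwise (· ≥ ·)) :
    (ins r l).Pairwise (· ≥ ·) := by
  induction l with
  | nil => simp [ins]
  | cons a t ih =>
    change (bsel (Nat.ble r a) (a :: ins r t) (r :: a :: t)).Pairwise _
    rw [bsel_ble]
    rw [List.pairwise_cons] at hl
    split_ifs with h
    · refine List.pairwise_cons.2 ⟨fun b hb => ?_, ih hl.2⟩
      rcases List.mem_cons.1 ((ins_perm r t).mem_iff.1 hb) with rfl | hb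
      · exact h
      · exact hl.1 b hb
    · refine List.pairwise_cons.2 ⟨fun b hb => ?_, List.pairwise_cons.2 hl⟩
      rcases List.mem_cons.1 hb with rfl | hb
      · omega
      · have := hl.1 b hb
        omega

theorem Lists.insert_card {l l' : List ℕ} {S : Finset Card} (H : Lists l S) {c : Card} (hc : c ∉ S)
    (hl : l'.Perm (c.1.val :: l)) : Lists l' (insert c S) := by
  rw [Lists, Multiset.coe_eq_coe.2 hl, Finset.insert_val_of_notMem hc, Multiset.map_cons,
    ← Multiset.cons_coe]
  exact congrArg _ H

theorem sumRanks_eq (f : ℕ → ℕ) : sumRanks f = ∑ r ∈ Finset.range 13, f r := by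
  simp only [Finset.sum_range_succ, Finset.sum_range_zero]
  change f 0 + (f 1 + (f 2 + (f 3 + (f 4 + (f 5 + (f 6 + (f 7 + (f 8 + (f 9 + (f 10 + (f 11 +
    (f 12 + 0)))))))))))) = _
  ring

theorem checkEntry_iff (n : ℕ) (l : List ℕ) : checkEntry n l = true ↔
    n * lower (look l) = ∑ r ∈ Finset.range 13, (4 - l.count r) * lower (look (ins r l)) ∧
    n * upper (look l) = ∑ r ∈ Finset.range 13, suitedCount r l * upper (look (ins r l)) := by
  rw [checkEntry, bsel_eq_ite, sumRanks_eq, sumRanks_eq]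
  simp only [cnt_eq_count, Nat.mul_eq, Nat.sub_eq, Nat.beq_eq]
  split_ifs with h
  · simp [h, Nat.beq_eq]
  · simp [h]

/-- The remaining denominations are always `m, …, 12`. Either `m` is the next entry, and then it
stays available for repetitions, or it is dropped for good. Ascending lists are pushed onto `acc`
entry by entry, so `f` sees them reversed. -/
theorem allLists_spec (f : List ℕ → Bool) (k : ℕ) (acc : List ℕ) (m : ℕ) :
    ∀ n, m + n = 13 → allLists f k acc (List.range' m n) = true →
    ∀ l : List ℕ, l.length = k → l.Pairwise (· ≤ ·) → (∀ x ∈ l, m ≤ x ∧ x ≤ 12) →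
      f (l.reverseAux acc) = true := by
  induction k generalizing acc m with
  | zero =>
    intro n _ h l hl _ _
    rw [List.length_eq_zero_iff.1 hl]
    exact h
  | succ k ih =>
    intro n
    induction n generalizing m with
    | zero =>
      intro hm _ l hl _ hx
      obtain ⟨a, t, rfl⟩ := List.exists_cons_of_length_eq_add_one hl
      have := hx a (by simp)
      omega
    | succ n ihn =>
      intro hm h l hl hp hx
      rw [List.range'_succ] at h
      change bsel (allLists f k (m :: acc) (m :: List.range' (m + 1) n))
        (allLists f (k + 1) acc (List.range' (m + 1) n)) false = true at h
      rw [bsel_eq_ite] at h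
      split_ifs at h with h1
      obtain ⟨a, t, rfl⟩ := List.exists_cons_of_length_eq_add_one hl
      rw [List.pairwise_cons] at hp
      have ha := hx a (by simp)
      rcases Nat.eq_or_lt_of_le ha.1 with rfl | hlt
      · exact ih (m :: acc) m (n + 1) hm (by rw [List.range'_succ]; exact h1) t (by simpa using hl)
          hp.2 fun x hxt => ⟨hp.1 x hxt, (hx x (by simp [hxt])).2⟩
      · refine ihn (m + 1) (by omega) h (a :: t) hl (List.pairwise_cons.2 hp) fun x hxt => ?_
        refine ⟨?_, (hx x hxt).2⟩
        rcases List.mem_cons.1 hxt with rfl | hxt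
        · exact hlt
        · exact hlt.trans_le (hp.1 x hxt)

theorem checkEntry_of_allLists {k n : ℕ} (h : allLists (checkEntry n) k [] ranks = true)
    {l : List ℕ} (hl : l.length = k) (hp : l.Pairwise (· ≥ ·)) (hx : ∀ x ∈ l, x ≤ 12) :
    checkEntry n l = true := by
  have := allLists_spec (checkEntry n) k [] 0 13 rfl h l.reverse (by simpa using hl)
    (List.pairwise_reverse.2 hp) fun x hxl => ⟨Nat.zero_le _, hx x (by simpa using hxl)⟩
  simpa [List.reverseAux_eq] using this

theorem checkEntry_of_length {n : ℕ} {l : List ℕ} (hl : l.length + (n + 1) = 5)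
    (hp : l.Pairwise (· ≥ ·)) (hx : ∀ x ∈ l, x ≤ 12) : checkEntry (n + 1) l = true := by
  have hn : n ≤ 4 := by omega
  interval_cases n
  · exact checkEntry_of_allLists allLists_checkEntry_4 (by omega) hp hx
  · exact checkEntry_of_allLists allLists_checkEntry_3 (by omega) hp hx
  · exact checkEntry_of_allLists allLists_checkEntry_2 (by omega) hp hx
  · exact checkEntry_of_allLists allLists_checkEntry_1 (by omega) hp hx
  · exact checkEntry_of_allLists allLists_checkEntry_0 (by omega) hp hx

theorem look_of_length {l : List ℕ} (hl : l.length = 5) : look l = handEntry l := by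
  match l, hl with
  | [_, _, _, _, _], _ => rfl

/-- Induction on the number `n` of missing cards. For `n = 0` the entry is the score of the hand
itself. Otherwise both sides satisfy the same double counting identity: the left by
`sum_total_insert`, the right by the table check. A set that is not a flush has no flush extensions,
hence its excess vanishes. -/
theorem Lists.total_eq {n : ℕ} : ∀ {l : List ℕ} {S : Finset Card}, Lists l S →
    l.Pairwise (· ≥ ·) → l.length + n = 5 →
    total S ∅ = lower (look l) + if IsFlush S then upper (look l) else 0 := by
  induction n with
  | zero =>
    intro l S H _ hl
    have h5 : S.card = 5 := by rw [← H.length_eq]; omega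
    rw [total_of_card_eq_five h5, H.score_payout_eq h5, look_of_length (by omega)]
  | succ n ih =>
    intro l S H hp hl
    obtain ⟨h1, h2⟩ := (checkEntry_iff _ _).1
      (checkEntry_of_length hl hp fun x hx => H.le_twelve hx)
    have hS : 5 - S.card = n + 1 := by rw [← H.length_eq]; omega
    have key := sum_total_insert S
    have hsum : ∀ c ∈ Sᶜ, total (insert c S) ∅ = lower (look (ins c.1.val l)) +
        if IsFlush (insert c S) then upper (look (ins c.1.val l)) else 0 := by
      intro c hc
      refine ih (H.insert_card (Finset.mem_compl.1 hc) (ins_perm _ _)) (ins_pairwise _ hp) ?_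
      rw [(ins_perm _ _).length_eq, List.length_cons]
      omega
    -- The plain parts are summed over all additional cards, the excesses only over those that keep
    -- one suit; the two halves of the table check evaluate these sums.
    rw [Finset.sum_congr rfl hsum, Finset.sum_add_distrib,
      H.sum_compl fun r => lower (look (ins r l)),
      H.sum_compl_isFlush fun r => upper (look (ins r l)), ← h1, ← h2, hS] at key
    refine Nat.eq_of_mul_eq_mul_left (Nat.succ_pos n) (key.symm.trans ?_)
    rw [Nat.succ_eq_add_one, mul_add, mul_ite, mul_zero]

/-! ### Packed vectors of natural numbers. -/

/-- The vector with the lanes `φ s`, `s ∈ ls`, each of 80 bits. -/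
def packed {α : Type} (ls : List α) (φ : α → ℕ) : ℕ := ls.foldr (fun s v => φ s + 2 ^ 80 * v) 0

theorem packed_cons {α : Type} (s : α) (ls : List α) (φ : α → ℕ) :
    packed (s :: ls) φ = φ s + 2 ^ 80 * packed ls φ := rfl

theorem packed_congr {α : Type} {ls : List α} {φ ψ : α → ℕ} (h : ∀ s ∈ ls, φ s = ψ s) :
    packed ls φ = packed ls ψ := by
  induction ls with
  | nil => rfl
  | cons s t ih =>
    rw [packed_cons, packed_cons, h s (by simp), ih fun x hx => h x (by simp [hx])]

theorem packed_add {α : Type} (ls : List α) (φ ψ : α → ℕ) :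
    packed ls φ + packed ls ψ = packed ls fun s => φ s + ψ s := by
  induction ls with
  | nil => rfl
  | cons s t ih => rw [packed_cons, packed_cons, packed_cons, ← ih]; ring

theorem mul_packed {α : Type} (c : ℕ) (ls : List α) (φ : α → ℕ) :
    c * packed ls φ = packed ls fun s => c * φ s := by
  induction ls with
  | nil => rfl
  | cons s t ih => rw [packed_cons, packed_cons, ← ih]; ring

/-- By `h` no lane borrows from the next one. -/
theorem packed_sub {α : Type} (ls : List α) (φ ψ : α → ℕ) (h : ∀ s ∈ ls, ψ s ≤ φ s) :
    packed ls φ - packed ls ψ = packed ls fun s => φ s - ψ s := by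
  rw [Nat.sub_eq_iff_eq_add, packed_add]
  · exact packed_congr fun s hs => (Nat.sub_add_cancel (h s hs)).symm
  · have : packed ls φ = packed ls (fun s => φ s - ψ s) + packed ls ψ := by
      rw [packed_add]
      exact packed_congr fun s hs => (Nat.sub_add_cancel (h s hs)).symm
    omega

theorem add_mul_land_add_mul {k a b : ℕ} (ha : a < 2 ^ k) (hb : b < 2 ^ k) (x y : ℕ) :
    (a + 2 ^ k * x) &&& (b + 2 ^ k * y) = (a &&& b) + 2 ^ k * (x &&& y) := by
  apply Nat.eq_of_testBit_eq
  intro i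
  rw [add_comm a, add_comm b, add_comm (a &&& b), Nat.testBit_and,
    Nat.testBit_two_pow_mul_add _ ha, Nat.testBit_two_pow_mul_add _ hb,
    Nat.testBit_two_pow_mul_add _ (Nat.and_lt_two_pow _ hb)]
  split_ifs <;> rw [Nat.testBit_and]

theorem packed_land {α : Type} (ls : List α) (φ ψ : α → ℕ) (hφ : ∀ s ∈ ls, φ s < 2 ^ 80)
    (hψ : ∀ s ∈ ls, ψ s < 2 ^ 80) :
    packed ls φ &&& packed ls ψ = packed ls fun s => φ s &&& ψ s := by
  induction ls with
  | nil => simp [packed]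
  | cons s t ih =>
    rw [packed_cons, packed_cons, packed_cons,
      add_mul_land_add_mul (hφ s (by simp)) (hψ s (by simp)),
      ih (fun x hx => hφ x (by simp [hx])) (fun x hx => hψ x (by simp [hx]))]

theorem land_two_pow_of_lt {k x : ℕ} (hx : x < 2 ^ (k + 1)) :
    x &&& 2 ^ k = 2 ^ k * if 2 ^ k ≤ x then 1 else 0 := by
  rw [Nat.and_two_pow]
  split_ifs with h
  · obtain ⟨y, rfl⟩ := Nat.exists_eq_add_of_le h
    rw [Nat.testBit_two_pow_add_eq, Nat.testBit_lt_two_pow (by rw [pow_succ] at hx; omega)]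
    simp
  · rw [Nat.testBit_lt_two_pow (by omega)]
    simp

/-- Adding `2 ^ 79` to each lane before subtracting prevents borrows, and bit 79 of the result tells
whether `ψ s ≤ φ s`. This bit minus its shift by 79 is the mask `2 ^ 79 - 1` or 0, which cuts the
lane down to `φ s - ψ s` or to 0; adding `ψ s` gives the maximum. -/
theorem packedMax_packed {α : Type} (ls : List α) (φ ψ : α → ℕ) (hφ : ∀ s ∈ ls, φ s < 2 ^ 79)
    (hψ : ∀ s ∈ ls, ψ s < 2 ^ 79) :
    packedMax (packed ls fun _ => 2 ^ 79) (packed ls φ) (packed ls ψ) =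
      packed ls fun s => max (φ s) (ψ s) := by
  change packed ls ψ + (((packed ls φ + packed ls fun _ => 2 ^ 79) - packed ls ψ) &&&
    (((packed ls φ + packed ls fun _ => 2 ^ 79) - packed ls ψ) &&& (packed ls fun _ => 2 ^ 79)) -
    (((packed ls φ + packed ls fun _ => 2 ^ 79) - packed ls ψ) &&&
      (packed ls fun _ => 2 ^ 79)) >>> 79) = _
  have hlt : ∀ s ∈ ls, φ s + 2 ^ 79 - ψ s < 2 ^ 80 := by
    intro s hs
    have := hφ s hs
    omega
  rw [packed_add, packed_sub _ _ _ fun s hs => by have := hψ s hs; omega,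
    packed_land _ _ _ hlt fun s _ => by norm_num,
    packed_congr fun s hs => land_two_pow_of_lt (k := 79) (hlt s hs), ← mul_packed,
    Nat.shiftRight_eq_div_pow, Nat.mul_div_cancel_left _ (by positivity),
    ← Nat.sub_one_mul, mul_packed, packed_land _ _ _ hlt, packed_add]
  · refine packed_congr fun s hs => ?_
    have h1 := hφ s hs
    have h2 := hψ s hs
    by_cases h : ψ s ≤ φ s
    · rw [if_pos (by omega), mul_one, Nat.and_two_pow_sub_one_eq_mod, max_eq_left h,
        show φ s + 2 ^ 79 - ψ s = φ s - ψ s + 2 ^ 79 by omega, Nat.add_mod_right,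
        Nat.mod_eq_of_lt (by omega)]
      omega
    · rw [if_neg (by omega), mul_zero, Nat.and_zero, max_eq_right (by omega), add_zero]
  · intro s _
    split_ifs <;> norm_num

/-! ### The best hold by successive decisions, in all lanes at once. -/

/-- The value of the best hold, where `f V` refers to the hands that contain the cards selected
by `V`, and the hold of `k` cards has the weight `c k`; `k` cards are held already and `n` are still
to be decided on. The maximum is taken by `m`. -/
def bestWith (m : ℕ → ℕ → ℕ) (c : ℕ → ℕ) : ℕ → ℕ → (List Bool → ℕ) → ℕ
  | 0, k, f => c k * f []
  | n + 1, k, f => m (bestWith m c n (k + 1) fun V => f (true :: V))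
      (bestWith m c n k fun V => f (false :: V) - f (true :: V))

/-- All differences that occur in `bestWith` are differences of larger and smaller numbers, and all
weighted values are below `2 ^ 79`. -/
def Admissible (c : ℕ → ℕ) : ℕ → ℕ → (List Bool → ℕ) → Prop
  | 0, k, f => c k * f [] < 2 ^ 79
  | n + 1, k, f => (∀ V, V.length = n → f (true :: V) ≤ f (false :: V)) ∧
      (Admissible c n (k + 1) fun V => f (true :: V)) ∧
      Admissible c n k fun V => f (false :: V) - f (true :: V)

theorem Admissible.bestWith_lt {c : ℕ → ℕ} {n k : ℕ} {f : List Bool → ℕ}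
    (h : Admissible c n k f) : bestWith max c n k f < 2 ^ 79 := by
  induction n generalizing k f with
  | zero => exact h
  | succ n ih => exact max_lt (ih h.2.1) (ih h.2.2)

theorem bestWith_congr {m : ℕ → ℕ → ℕ} {c : ℕ → ℕ} {n k : ℕ} {f g : List Bool → ℕ}
    (h : ∀ V, V.length = n → f V = g V) : bestWith m c n k f = bestWith m c n k g := by
  induction n generalizing k f g with
  | zero => rw [bestWith, bestWith, h [] rfl]
  | succ n ih =>
    rw [bestWith, bestWith]
    congr 1
    · exact ih fun V hV => h (true :: V) (by simp [hV])
    · exact ih fun V hV => by rw [h (false :: V) (by simp [hV]), h (true :: V) (by simp [hV])]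

theorem Admissible.congr {c : ℕ → ℕ} {n k : ℕ} {f g : List Bool → ℕ} (hf : Admissible c n k f)
    (h : ∀ V, V.length = n → f V = g V) : Admissible c n k g := by
  induction n generalizing k f g with
  | zero => rw [Admissible, ← h [] rfl]; exact hf
  | succ n ih =>
    refine ⟨fun V hV => ?_, ih hf.2.1 fun V hV => h _ (by simp [hV]), ih hf.2.2 fun V hV => ?_⟩
    · rw [← h _ (by simp [hV]), ← h _ (by simp [hV])]
      exact hf.1 V hV
    · rw [h (false :: V) (by simp [hV]), h (true :: V) (by simp [hV])]

/-- Admissibility in every lane excludes borrows and overflow, so one run of the recursion on packed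
vectors performs it in all lanes simultaneously. -/
theorem bestWith_packed {α : Type} (ls : List α) (c : ℕ → ℕ) (n k : ℕ) (f : List Bool → ℕ)
    (g : α → List Bool → ℕ) (hf : ∀ V, V.length = n → f V = packed ls fun s => g s V)
    (hg : ∀ s ∈ ls, Admissible c n k (g s)) :
    bestWith (packedMax (packed ls fun _ => 2 ^ 79)) c n k f =
      packed ls fun s => bestWith max c n k (g s) := by
  induction n generalizing k f g with
  | zero => rw [bestWith, hf [] rfl, mul_packed]; rfl
  | succ n ih =>
    rw [bestWith, ih (k + 1) (fun V => f (true :: V)) (fun s V => g s (true :: V))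
        (fun V hV => hf _ (by simp [hV])) fun s hs => (hg s hs).2.1,
      ih k (fun V => f (false :: V) - f (true :: V)) (fun s V => g s (false :: V) - g s (true :: V))
        (fun V hV => ?_) fun s hs => (hg s hs).2.2,
      packedMax_packed _ _ _ (fun s hs => (hg s hs).2.1.bestWith_lt)
        fun s hs => (hg s hs).2.2.bestWith_lt]
    · rfl
    · rw [hf _ (by simp [hV]), hf _ (by simp [hV]), packed_sub _ _ _ fun s hs => (hg s hs).1 V hV]

/-! ### Weighted totals of the holds of a hand. -/

/-- The common denominator of all expected returns, divided by the number of draws to `k` cards. -/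
def drawWeight : ℕ → ℕ
  | 0 => 5
  | 1 => 43
  | 2 => 473
  | 3 => 7095
  | 4 => 163185
  | _ => 7669695

/-- The number 7669695 = 3 · 5 · 11 · 23 · 43 · 47 is the least common multiple of the numbers of
draws. -/
theorem drawWeight_mul_choose {k : ℕ} (hk : k ≤ 5) :
    drawWeight k * Nat.choose 47 (5 - k) = 7669695 := by
  interval_cases k <;> decide +kernel

/-- With `S` held and `T` discarded, `D ↦ S ∪ D` and `H ↦ H \ S` are inverse bijections between
draws and final hands. Thus totals over hands compute sums over draws. -/
theorem total_eq_sum_draws {S T : Finset Card} (hST : Disjoint S T) (hS : S.card ≤ 5) :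
    total S T = ∑ D ∈ Finset.powersetCard (5 - S.card) (S ∪ T)ᶜ, score (payout (S ∪ D)) := by
  rw [total]
  symm
  refine Finset.sum_bij' (fun D _ => S ∪ D) (fun H _ => H \ S) ?_ ?_ ?_ ?_ fun _ _ => rfl
  · intro D hD
    rw [Finset.mem_powersetCard] at hD
    have h1 : Disjoint D (S ∪ T) := Finset.subset_compl_iff_disjoint_right.1 hD.1
    rw [Finset.disjoint_union_right] at h1
    simp only [Finset.mem_filter, Finset.mem_powersetCard, Finset.subset_univ, true_and]
    refine ⟨?_, Finset.subset_union_left, Finset.disjoint_union_left.2 ⟨hST, h1.2⟩⟩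
    rw [Finset.card_union_of_disjoint h1.1.symm, hD.2]
    omega
  · intro H hH
    simp only [Finset.mem_filter, Finset.mem_powersetCard, Finset.subset_univ, true_and] at hH
    rw [Finset.mem_powersetCard, Finset.subset_compl_iff_disjoint_right,
      Finset.disjoint_union_right, Finset.card_sdiff_of_subset hH.2.1, hH.1]
    exact ⟨⟨Finset.sdiff_disjoint, hH.2.2.mono_left Finset.sdiff_subset⟩, rfl⟩
  · intro D hD
    rw [Finset.mem_powersetCard] at hD
    have h1 : Disjoint D (S ∪ T) := Finset.subset_compl_iff_disjoint_right.1 hD.1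
    rw [Finset.disjoint_union_right] at h1
    exact Finset.union_sdiff_cancel_left h1.1.symm
  · intro H hH
    simp only [Finset.mem_filter] at hH
    exact Finset.union_sdiff_of_subset hH.2.1

theorem score_payout_le (h : Finset Card) : score (payout h) ≤ 800 * 2 ^ 43 := by
  rw [score_eq]
  exact (Nat.sub_le _ _).trans (Nat.mul_le_mul_right _ (payout_le h))

/-- The average score of a hold is at most 800 · 2^43. After scaling by 7669695 this leaves the top
bit of an 80-bit lane free, as `packedMax` requires. -/
theorem drawWeight_mul_total_lt {S T : Finset Card} (hST : Disjoint S T)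
    (h5 : S.card + T.card = 5) : drawWeight S.card * total S T < 2 ^ 79 := by
  have hS : S.card ≤ 5 := by omega
  have hc : ((S ∪ T)ᶜ).card = 47 := by
    rw [Finset.card_compl, Finset.card_union_of_disjoint hST, h5]
    simp
  calc drawWeight S.card * total S T
      ≤ drawWeight S.card * (Nat.choose 47 (5 - S.card) * (800 * 2 ^ 43)) := by
        refine Nat.mul_le_mul_left _ ?_
        rw [total_eq_sum_draws hST hS, ← hc, ← Finset.card_powersetCard, ← smul_eq_mul]
        exact Finset.sum_le_card_nsmul _ _ _ fun D _ => score_payout_le _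
    _ = 7669695 * (800 * 2 ^ 43) := by rw [← mul_assoc, drawWeight_mul_choose hS]
    _ < 2 ^ 79 := by norm_num

/-- `S` together with the cards of `cs` that are selected by `V`. -/
def pick : List Bool → List Card → Finset Card → Finset Card
  | b :: V, c :: cs, S => pick V cs (if b then insert c S else S)
  | _, _, S => S

theorem pick_insert (V : List Bool) (cs : List Card) (S : Finset Card) (c : Card) :
    pick V cs (insert c S) = insert c (pick V cs S) := by
  induction V generalizing cs S with
  | nil => simp [pick]
  | cons b V ih =>
    cases cs with
    | nil => simp [pick]
    | cons d cs =>
      cases b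
      · exact ih cs S
      · change pick V cs (insert d (insert c S)) = insert c (pick V cs (insert d S))
        rw [Finset.insert_comm, ih]

theorem total_insert_le (S T : Finset Card) (c : Card) : total (insert c S) T ≤ total S T := by
  have := total_eq_add S T c
  omega

/-- Subtracting the total with `c` moves `c` to the discards. -/
theorem total_pick_sub (V : List Bool) (cs : List Card) (S T : Finset Card) (c : Card) :
    total (pick (false :: V) (c :: cs) S) T - total (pick (true :: V) (c :: cs) S) T =
      total (pick V cs S) (insert c T) := by
  change total (pick V cs S) T - total (pick V cs (insert c S)) T = _
  rw [pick_insert]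
  have := total_eq_add (pick V cs S) T c
  omega

/-- Every difference is again a total, with one more discard. When all cards have been decided on,
`S` and `T` make up a five-card hand, and the bound for weighted totals applies. -/
theorem admissible_total (cs : List Card) (S T : Finset Card) (hST : Disjoint S T)
    (hcs : cs.Nodup) (hS : ∀ c ∈ cs, c ∉ S) (hT : ∀ c ∈ cs, c ∉ T)
    (h5 : S.card + T.card + cs.length = 5) :
    Admissible drawWeight cs.length S.card fun V => total (pick V cs S) T := by
  induction cs generalizing S T with
  | nil => exact drawWeight_mul_total_lt hST h5
  | cons c cs ih =>
    rw [List.nodup_cons] at hcs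
    have hcS := hS c (by simp)
    have hcT := hT c (by simp)
    refine ⟨fun V _ => ?_, ?_, ?_⟩
    · change total (pick V cs (insert c S)) T ≤ total (pick V cs S) T
      rw [pick_insert]
      exact total_insert_le _ _ _
    · have := ih (insert c S) T (Finset.disjoint_insert_left.2 ⟨hcT, hST⟩) hcs.2
        (fun d hd => by
          rw [Finset.mem_insert]
          rintro (rfl | h)
          · exact hcs.1 hd
          · exact hS d (by simp [hd]) h)
        (fun d hd => hT d (by simp [hd]))
        (by rw [Finset.card_insert_of_notMem hcS]; simp at h5; omega)
      rw [Finset.card_insert_of_notMem hcS] at this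
      exact this
    · simp only [total_pick_sub]
      exact ih S (insert c T) (Finset.disjoint_insert_right.2 ⟨hcS, hST⟩) hcs.2
        (fun d hd => hS d (by simp [hd]))
        (fun d hd => by
          rw [Finset.mem_insert]
          rintro (rfl | h)
          · exact hcs.1 hd
          · exact hT d (by simp [hd]) h)
        (by rw [Finset.card_insert_of_notMem hcT]; simp at h5; omega)

/-- The value of the best hold of the cards `cs`, if the cards in `S` are held and those in `T` are
discarded. -/
def bestTotal (k : ℕ) (cs : List Card) (S T : Finset Card) : ℕ :=
  bestWith max drawWeight cs.length k fun V => total (pick V cs S) T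

theorem bestTotal_cons (k : ℕ) (c : Card) (cs : List Card) (S T : Finset Card) :
    bestTotal k (c :: cs) S T =
      max (bestTotal (k + 1) cs (insert c S) T) (bestTotal k cs S (insert c T)) := by
  simp only [bestTotal, ← total_pick_sub]
  rfl

/-- Induction on the undecided cards: subsets `U` that contain `c` correspond to the branch with `c`
moved to `S`, the others to the branch with `c` moved to `T`. -/
theorem bestTotal_spec (cs : List Card) (hcs : cs.Nodup) (k : ℕ) (S T : Finset Card) :
    IsGreatest ((fun U => drawWeight (k + U.card) * total (S ∪ U) (T ∪ (cs.toFinset \ U))) ''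
      (cs.toFinset.powerset : Set (Finset Card))) (bestTotal k cs S T) := by
  induction cs generalizing k S T with
  | nil =>
    simp [bestTotal, bestWith, pick]
  | cons c cs ih =>
    rw [List.nodup_cons] at hcs
    have hc : c ∉ cs.toFinset := by simpa using hcs.1
    obtain ⟨⟨U₁, hU₁, e₁⟩, u₁⟩ := ih hcs.2 (k + 1) (insert c S) T
    obtain ⟨⟨U₂, hU₂, e₂⟩, u₂⟩ := ih hcs.2 k S (insert c T)
    rw [bestTotal_cons]
    simp only [Finset.coe_powerset, Set.mem_preimage, Set.mem_powerset_iff, Finset.coe_subset]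
      at hU₁ hU₂
    have h1 : ∀ U ⊆ cs.toFinset, drawWeight (k + 1 + U.card) *
        total (insert c S ∪ U) (T ∪ (cs.toFinset \ U)) = drawWeight (k + (insert c U).card) *
        total (S ∪ insert c U) (T ∪ ((c :: cs).toFinset \ insert c U)) := by
      intro U hU
      rw [Finset.card_insert_of_notMem fun h => hc (hU h), List.toFinset_cons,
        Finset.insert_sdiff_insert, Finset.sdiff_insert_of_notMem hc, Finset.insert_union,
        Finset.union_insert, add_assoc, add_comm 1]
    have h2 : ∀ U ⊆ cs.toFinset, drawWeight (k + U.card) *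
        total (S ∪ U) (insert c T ∪ (cs.toFinset \ U)) = drawWeight (k + U.card) *
        total (S ∪ U) (T ∪ ((c :: cs).toFinset \ U)) := by
      intro U hU
      rw [List.toFinset_cons, Finset.insert_sdiff_of_notMem _ fun h => hc (hU h),
        Finset.insert_union, Finset.union_insert]
    refine ⟨?_, ?_⟩
    · rcases max_choice (bestTotal (k + 1) cs (insert c S) T) (bestTotal k cs S (insert c T))
        with h | h <;> rw [h]
      · refine ⟨insert c U₁, ?_, by rw [← e₁]; exact (h1 U₁ hU₁).symm⟩
        simp only [Finset.coe_powerset, Set.mem_preimage, Set.mem_powerset_iff, Finset.coe_subset]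
        rw [List.toFinset_cons]
        exact Finset.insert_subset_insert _ hU₁
      · refine ⟨U₂, ?_, by rw [← e₂]; exact (h2 U₂ hU₂).symm⟩
        simp only [Finset.coe_powerset, Set.mem_preimage, Set.mem_powerset_iff, Finset.coe_subset]
        rw [List.toFinset_cons]
        exact hU₂.trans (Finset.subset_insert _ _)
    · rintro _ ⟨U, hU, rfl⟩
      simp only [Finset.coe_powerset, Set.mem_preimage, Set.mem_powerset_iff, Finset.coe_subset]
        at hU
      rw [List.toFinset_cons] at hU
      by_cases hcU : c ∈ U
      · refine le_max_of_le_left (u₁ ⟨U.erase c, ?_, ?_⟩)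
        · simp only [Finset.coe_powerset, Set.mem_preimage, Set.mem_powerset_iff,
            Finset.coe_subset]
          exact Finset.subset_insert_iff.1 hU
        · have := h1 (U.erase c) (Finset.subset_insert_iff.1 hU)
          rw [Finset.insert_erase hcU] at this
          exact this
      · refine le_max_of_le_right (u₂ ⟨U, ?_, h2 U ?_⟩)
        · simp only [Finset.coe_powerset, Set.mem_preimage, Set.mem_powerset_iff,
            Finset.coe_subset]
          exact (Finset.subset_insert_iff_of_notMem hcU).1 hU
        · exact (Finset.subset_insert_iff_of_notMem hcU).1 hU

/-! ### Suit patterns and their multiplicities. -/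

/-- The suits of the cards after a card of suit `s`, the `true`s marking the cards that have the
same denomination as their predecessors. -/
def suitLists : List Bool → ℕ → List (List ℕ)
  | [], _ => [[]]
  | b :: bs, s => ((List.range 4).filter fun s' => !b || Nat.blt s s').flatMap fun s' =>
      (suitLists bs s').map (List.cons s')

def indexIn (l : List ℕ) (x : ℕ) : ℕ :=
  List.rec 0 (fun a _ ih => bsel (Nat.beq a x) 0 (Nat.succ ih)) l

/-- The pattern of equal entries of `l`, each entry being replaced by its first position. -/
def canon (l : List ℕ) : List ℕ := l.map (indexIn l)

noncomputable section

/-- Base 5 suffices, as the entries of a pattern of five suits are positions from 0 to 4. -/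
def code (l : List ℕ) : ℕ := List.rec 0 (fun a _ ih => Nat.add a (Nat.mul 5 ih)) l

/-- The leading `false` leaves the suit of the first card free, so the starting suit 0 is
irrelevant. -/
def suitCodes (bits : List Bool) : List ℕ := (suitLists (false :: bits) 0).map fun σ => code (canon σ)

/-- Whether the list `ls` consists of the distinct members of `cs` with their multiplicities. -/
def checkLanes (cs : List ℕ) (ls : List (ℕ × List ℕ)) : Bool :=
  bsel (allb (fun c => Nat.beq (cnt c (ls.map fun p => code p.2)) 1) cs)
    (List.rec true (fun p _ ih => bsel (Nat.beq (cnt (code p.2) cs) p.1) ih false) ls) false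

end

def boolLists : ℕ → List (List Bool)
  | 0 => [[]]
  | n + 1 => (boolLists n).map (List.cons true) ++ (boolLists n).map (List.cons false)

set_option maxRecDepth 100000 in
-- The literal lists in `lanes` are checked here against the enumeration of all suit assignments.
theorem checkLanes_lanes :
    ∀ bits ∈ boolLists 4, checkLanes (suitCodes bits) (lanes bits) = true := by
  decide +kernel

set_option maxRecDepth 100000 in
theorem lanes_wellFormed : ∀ bits ∈ boolLists 4, ∀ p ∈ lanes bits,
    p.1 ≠ 0 ∧ p.2.length = 5 ∧ ∀ x ∈ p.2, x < 5 := by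
  decide +kernel

theorem indexIn_eq_idxOf (l : List ℕ) (x : ℕ) : indexIn l x = l.idxOf x := by
  induction l with
  | nil => rfl
  | cons a t ih =>
    change bsel (Nat.beq a x) 0 (Nat.succ (indexIn t x)) = _
    rw [bsel_beq, ih, List.idxOf_cons]
    by_cases h : a = x
    · simp [h]
    · rw [if_neg h, beq_eq_false_iff_ne.2 h]
      rfl

theorem code_eq_ofDigits (l : List ℕ) : code l = Nat.ofDigits 5 l := by
  induction l with
  | nil => rfl
  | cons a t ih =>
    rw [Nat.ofDigits_cons, ← ih]
    rfl

/-- Grouping the sum over `cs` by value gives one term for each distinct code, with its count as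
factor. The check says that each such code belongs to exactly one lane and that the factors are the
counts; `h0` ensures that no lane has a code outside `cs`. -/
theorem sum_eq_of_checkLanes {cs : List ℕ} {ls : List (ℕ × List ℕ)} (h : checkLanes cs ls = true)
    (h0 : ∀ p ∈ ls, p.1 ≠ 0) (f : ℕ → ℕ) :
    (cs.map f).sum = (ls.map fun p => p.1 * f (code p.2)).sum ∧ ∀ p ∈ ls, code p.2 ∈ cs := by
  rw [checkLanes, bsel_eq_ite] at h
  split_ifs at h with h1
  rw [allb_iff] at h1
  simp only [cnt_eq_count, Nat.beq_eq] at h1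
  have h2 : ∀ ls : List (ℕ × List ℕ), (List.rec true (fun p _ ih =>
      bsel (Nat.beq (cnt (code p.2) cs) p.1) ih false) ls : Bool) = true →
      ∀ p ∈ ls, cs.count (code p.2) = p.1 := by
    intro ls
    induction ls with
    | nil => simp
    | cons p t ih =>
      intro hp
      change bsel (Nat.beq (cnt (code p.2) cs) p.1) _ false = true at hp
      rw [bsel_beq, cnt_eq_count] at hp
      split_ifs at hp with hc
      simpa [hc] using ih hp
  replace h := h2 ls h
  have hmem : ∀ p ∈ ls, code p.2 ∈ cs := fun p hp =>
    List.count_pos_iff.1 (by rw [h p hp]; exact Nat.pos_of_ne_zero (h0 p hp))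
  refine ⟨?_, hmem⟩
  set K := ls.map fun p => code p.2 with hK
  have hnd : K.Nodup := List.nodup_iff_count_eq_one.2 fun c hc => by
    obtain ⟨p, hp, rfl⟩ := List.mem_map.1 hc
    exact h1 _ (hmem p hp)
  have hS : cs.toFinset = K.toFinset := by
    ext c
    rw [List.mem_toFinset, List.mem_toFinset]
    constructor
    · intro hc
      exact List.count_pos_iff.1 (by rw [h1 c hc]; exact one_pos)
    · intro hc
      obtain ⟨p, hp, rfl⟩ := List.mem_map.1 hc
      exact hmem p hp
  rw [Finset.sum_list_map_count, hS, List.sum_toFinset _ hnd, hK, List.map_map]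
  refine congrArg _ (List.map_congr_left fun p hp => ?_)
  simp [h p hp]

theorem suitLists_length {bits : List Bool} {s : ℕ} {σ : List ℕ} (h : σ ∈ suitLists bits s) :
    σ.length = bits.length := by
  induction bits generalizing s σ with
  | nil => simp [suitLists] at h; simp [h]
  | cons b bs ih =>
    rw [suitLists, List.mem_flatMap] at h
    obtain ⟨s', -, h⟩ := h
    obtain ⟨τ, hτ, rfl⟩ := List.mem_map.1 h
    simp [ih hτ]

theorem suitLists_lt {bits : List Bool} {s : ℕ} {σ : List ℕ} (h : σ ∈ suitLists bits s) :
    ∀ x ∈ σ, x < 4 := by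
  induction bits generalizing s σ with
  | nil => simp [suitLists] at h; simp [h]
  | cons b bs ih =>
    rw [suitLists, List.mem_flatMap] at h
    obtain ⟨s', hs', h⟩ := h
    obtain ⟨τ, hτ, rfl⟩ := List.mem_map.1 h
    have := List.mem_range.1 (List.mem_filter.1 hs').1
    simpa [this] using ih hτ

theorem canon_lt {l : List ℕ} {x : ℕ} (hx : x ∈ canon l) : x < l.length := by
  obtain ⟨y, hy, rfl⟩ := List.mem_map.1 hx
  rw [indexIn_eq_idxOf]
  exact List.idxOf_lt_length_of_mem hy

/-- Every sum over suit assignments that depends on the suit pattern only is a sum over lanes. -/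
theorem sum_lanes {bits : List Bool} (hb : bits ∈ boolLists 4) (hl : bits.length = 4)
    (f : List ℕ → ℕ) :
    ((suitLists (false :: bits) 0).map fun σ => f (canon σ)).sum =
      ((lanes bits).map fun p => p.1 * f p.2).sum ∧
    ∀ p ∈ lanes bits, ∃ σ ∈ suitLists (false :: bits) 0, p.2 = canon σ := by
  have hw := lanes_wellFormed bits hb
  have hσ : ∀ σ ∈ suitLists (false :: bits) 0, (canon σ).length = 5 ∧ ∀ x ∈ canon σ, x < 5 := by
    intro σ hσ
    have := suitLists_length hσ
    rw [List.length_cons, hl] at this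
    exact ⟨by rw [canon, List.length_map, this], fun x hx => by have := canon_lt hx; omega⟩
  have : Nonempty {l : List ℕ // l.length = 5 ∧ ∀ x ∈ l, x < 5} := ⟨⟨[0, 0, 0, 0, 0], by simp⟩⟩
  -- A left inverse of `code` on the lists of five digits below 5; it turns a function of the
  -- pattern into a function of the code.
  set D : ℕ → List ℕ := fun n => Function.invFun (fun l : {l : List ℕ // l.length = 5 ∧
    ∀ x ∈ l, x < 5} => code l.1) n |>.1 with hD
  have hinj : Function.Injective (fun l : {l : List ℕ // l.length = 5 ∧
      ∀ x ∈ l, x < 5} => code l.1) := by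
    intro l l' h
    simp only [code_eq_ofDigits] at h
    exact Subtype.ext (Nat.ofDigits_inj_of_len_eq (by norm_num) (l.2.1.trans l'.2.1.symm) l.2.2
      l'.2.2 h)
  have hDc : ∀ l : List ℕ, l.length = 5 → (∀ x ∈ l, x < 5) → D (code l) = l := fun l h1 h2 =>
    congrArg Subtype.val (Function.leftInverse_invFun hinj ⟨l, h1, h2⟩)
  obtain ⟨h1, h2⟩ := sum_eq_of_checkLanes (checkLanes_lanes bits hb) (fun p hp => (hw p hp).1)
    fun n => f (D n)
  constructor
  · rw [suitCodes, List.map_map] at h1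
    rw [← List.map_congr_left (f := (fun n => f (D n)) ∘ fun σ => code (canon σ))
      fun σ hs => ?_, h1]
    · refine congrArg _ (List.map_congr_left fun p hp => ?_)
      rw [hDc _ (hw p hp).2.1 (hw p hp).2.2]
    · rw [Function.comp, hDc _ (hσ σ hs).1 (hσ σ hs).2]
  · intro p hp
    obtain ⟨σ, hs, he⟩ := List.mem_map.1 (h2 p hp)
    refine ⟨σ, hs, ?_⟩
    rw [← hDc _ (hw p hp).2.1 (hw p hp).2.2, ← he, hDc _ (hσ σ hs).1 (hσ σ hs).2]

/-! ### From the lanes of a cell to the totals of actual cards. -/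

/-- The positions at which `V` is `true`, counted from `i`. -/
def positions : List Bool → ℕ → List ℕ
  | [], _ => []
  | true :: V, i => i :: positions V (i + 1)
  | false :: V, i => positions V (i + 1)

/-- The entries of `l` selected by `V`, in reverse order, followed by `acc`. -/
def selectRev : List Bool → List ℕ → List ℕ → List ℕ
  | true :: V, r :: l, acc => selectRev V l (r :: acc)
  | false :: V, _ :: l, acc => selectRev V l acc
  | _, _, acc => acc

/-- The total score of the hands that contain the cards selected by `V`, if the cards have the
denominations `l` and suits with pattern `t`, the first `w` cards being deuces. -/
noncomputable def laneTotal (w : ℕ) (l t : List ℕ) (V : List Bool) : ℕ :=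
  lower (look (selectRev V l [])) +
    if constant (restrict w t (positions V 0)) then upper (look (selectRev V l [])) else 0

theorem ones_eq_packed (ls : List (ℕ × List ℕ)) : ones ls = packed ls fun _ => 1 := by
  induction ls with
  | nil => rfl
  | cons p t ih => rw [packed_cons, ← ih]; rfl

theorem maskVec_eq_packed (ls : List (ℕ × List ℕ)) (w : ℕ) (V : List ℕ) :
    maskVec ls w V = packed ls fun p => bsel (constant (restrict w p.2 V)) 1 0 := by
  induction ls with
  | nil => rfl
  | cons p t ih => rw [packed_cons, ← ih]; rfl

theorem leaf_eq_packed (ls : List (ℕ × List ℕ)) (w : ℕ) (l : List ℕ) (V : List Bool) :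
    leaf (ones ls) (maskVec ls w (positions V 0)) (selectRev V l []) =
      packed ls fun p => laneTotal w l p.2 V := by
  change lower (look _) * _ + upper (look _) * _ = _
  rw [ones_eq_packed, maskVec_eq_packed, mul_packed, mul_packed, packed_add]
  refine packed_congr fun p _ => ?_
  rw [laneTotal, bsel_eq_ite, mul_one, mul_ite, mul_one, mul_zero]

/-- The 32 leaves are the values of the recursion's argument at the Boolean lists of length five;
`best5` is the recursion unrolled. -/
theorem cell_eq_bestWith (o : ℕ) (mk : List ℕ → ℕ) (a b c d e : ℕ) :
    cell o (mk []) (mk [4]) (mk [3]) (mk [3, 4]) (mk [2]) (mk [2, 4]) (mk [2, 3]) (mk [2, 3, 4])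
      (mk [1]) (mk [1, 4]) (mk [1, 3]) (mk [1, 3, 4]) (mk [1, 2]) (mk [1, 2, 4]) (mk [1, 2, 3])
      (mk [1, 2, 3, 4]) (mk [0]) (mk [0, 4]) (mk [0, 3]) (mk [0, 3, 4]) (mk [0, 2]) (mk [0, 2, 4])
      (mk [0, 2, 3]) (mk [0, 2, 3, 4]) (mk [0, 1]) (mk [0, 1, 4]) (mk [0, 1, 3]) (mk [0, 1, 3, 4])
      (mk [0, 1, 2]) (mk [0, 1, 2, 4]) (mk [0, 1, 2, 3]) (mk [0, 1, 2, 3, 4]) a b c d e =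
    bestWith (packedMax (Nat.mul o 0x80000000000000000000)) drawWeight 5 0
      fun V => leaf o (mk (positions V 0)) (selectRev V [a, b, c, d, e] []) := by
  simp only [bestWith, cell, best5, best4, best3, best2, best1, positions, selectRev, drawWeight]
  rfl

theorem decodeSum_packed (ls : List (ℕ × List ℕ)) (φ : ℕ × List ℕ → ℕ)
    (hφ : ∀ p ∈ ls, φ p < 2 ^ 80) :
    decodeSum ls (packed ls φ) = (ls.map fun p => p.1 * decode (φ p)).sum := by
  induction ls with
  | nil => rfl
  | cons p t ih =>
    change p.1 * decode (packed (p :: t) φ % 2 ^ 80) + decodeSum t (packed (p :: t) φ >>> 80) = _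
    have hp := hφ p (by simp)
    rw [packed_cons, Nat.shiftRight_eq_div_pow, Nat.add_mul_mod_self_left, Nat.mod_eq_of_lt hp,
      Nat.add_mul_div_left _ _ (by positivity), Nat.div_eq_of_lt hp, zero_add,
      ih fun q hq => hφ q (by simp [hq]), List.map_cons, List.sum_cons]

theorem cellSum_eq (ls : List (ℕ × List ℕ)) (w a b c d e : ℕ)
    (h : ∀ p ∈ ls, Admissible drawWeight 5 0 (laneTotal w [a, b, c, d, e] p.2)) :
    cellSum ls (maskVec ls w) [e, d, c, b, a] = (ls.map fun p =>
      p.1 * decode (bestWith max drawWeight 5 0 (laneTotal w [a, b, c, d, e] p.2))).sum := by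
  rw [cellSum, apply5, cell_eq_bestWith]
  simp only [leaf_eq_packed]
  rw [show Nat.mul (ones ls) 0x80000000000000000000 = packed ls fun _ => 2 ^ 79 by
      rw [ones_eq_packed, Nat.mul_eq, mul_comm, mul_packed]; rfl,
    bestWith_packed ls drawWeight 5 0 _ _ (fun _ _ => rfl) h,
    decodeSum_packed _ _ fun p hp => (h p hp).bestWith_lt.trans (by norm_num)]

theorem lists_selectRev (V : List Bool) (cs : List Card) (acc : List ℕ) (S : Finset Card)
    (h : Lists acc S) (hcs : cs.Nodup) (hS : ∀ c ∈ cs, c ∉ S) :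
    Lists (selectRev V (cs.map fun c => c.1.val) acc) (pick V cs S) := by
  induction V generalizing cs acc S with
  | nil => simpa [selectRev, pick] using h
  | cons b V ih =>
    cases cs with
    | nil => cases b <;> simpa [selectRev, pick] using h
    | cons c cs =>
      rw [List.nodup_cons] at hcs
      cases b
      · exact ih cs acc S h hcs.2 fun d hd => hS d (by simp [hd])
      · refine ih cs _ (insert c S) (h.insert_card (hS c (by simp)) (List.Perm.refl _)) hcs.2 ?_
        intro d hd
        rw [Finset.mem_insert]
        rintro (rfl | hd')
        · exact hcs.1 hd
        · exact hS d (by simp [hd]) hd'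

/-- The cards of a hand come in ascending order while the tables are indexed by descending lists,
hence the reversal. -/
theorem pairwise_selectRev (V : List Bool) (l acc : List ℕ) (hl : l.Pairwise (· ≤ ·))
    (hacc : acc.Pairwise (· ≥ ·)) (h : ∀ x ∈ acc, ∀ y ∈ l, x ≤ y) :
    (selectRev V l acc).Pairwise (· ≥ ·) := by
  induction V generalizing l acc with
  | nil => simpa [selectRev] using hacc
  | cons b V ih =>
    cases l with
    | nil => cases b <;> simpa [selectRev] using hacc
    | cons r l =>
      rw [List.pairwise_cons] at hl
      cases b
      · exact ih l acc hl.2 hacc fun x hx y hy => h x hx y (by simp [hy])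
      · refine ih l (r :: acc) hl.2 (List.pairwise_cons.2 ⟨fun x hx => h x hx r (by simp), hacc⟩) ?_
        intro x hx y hy
        rcases List.mem_cons.1 hx with rfl | hx
        · exact hl.1 y hy
        · exact h x hx y (by simp [hy])

theorem length_selectRev_le (V : List Bool) (l acc : List ℕ) :
    (selectRev V l acc).length ≤ l.length + acc.length := by
  induction V generalizing l acc with
  | nil => simp [selectRev]
  | cons b V ih =>
    cases l with
    | nil => cases b <;> simp [selectRev]
    | cons r l =>
      cases b
      · have := ih l acc
        simp only [selectRev, List.length_cons]
        omega
      · have := ih l (r :: acc)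
        simp only [selectRev, List.length_cons] at this ⊢
        omega

theorem positions_succ (V : List Bool) (k : ℕ) :
    positions V (k + 1) = (positions V k).map Nat.succ := by
  induction V generalizing k with
  | nil => rfl
  | cons b V ih => cases b <;> simp [positions, ih]

theorem lt_of_mem_positions {V : List Bool} {i : ℕ} (h : i ∈ positions V 0) : i < V.length := by
  induction V generalizing i with
  | nil => simp [positions] at h
  | cons b V ih =>
    cases b <;> simp only [positions, positions_succ, zero_add, List.mem_cons, List.mem_map] at h
    · obtain ⟨j, hj, rfl⟩ := h
      simpa using ih hj
    · rcases h with rfl | ⟨j, hj, rfl⟩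
      · simp
      · simpa using ih hj

theorem mem_pick {V : List Bool} {cs : List Card} {S : Finset Card} {c : Card} :
    c ∈ pick V cs S ↔ c ∈ S ∨ ∃ i ∈ positions V 0, cs[i]? = some c := by
  induction V generalizing cs S with
  | nil => simp [pick, positions]
  | cons b V ih =>
    cases cs with
    | nil => simp [pick]
    | cons d cs =>
      cases b <;> simp [pick, positions, positions_succ, ih, or_assoc, or_left_comm, eq_comm]

theorem constant_iff (l : List ℕ) : constant l = true ↔ ∀ x ∈ l, ∀ y ∈ l, x = y := by
  cases l with
  | nil => simp [constant]
  | cons a t =>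
    change allb (fun b => Nat.beq a b) t = true ↔ _
    simp only [allb_iff, Nat.beq_eq]
    constructor
    · intro h x hx y hy
      have h' : ∀ z ∈ a :: t, a = z := by
        intro z hz
        rcases List.mem_cons.1 hz with rfl | hz
        · rfl
        · exact h z hz
      exact (h' x hx).symm.trans (h' y hy)
    · exact fun h b hb => h a (by simp) b (by simp [hb])

theorem mem_restrict {w : ℕ} {s V : List ℕ} {x : ℕ} :
    x ∈ restrict w s V ↔ ∃ i ∈ V, w ≤ i ∧ s.getD i 0 = x := by
  induction V with
  | nil => simp [restrict]
  | cons i V ih =>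
    change x ∈ bsel (Nat.ble w i) (s.getD i 0 :: restrict w s V) (restrict w s V) ↔ _
    rw [bsel_ble]
    split_ifs with h
    · simp [ih, h, eq_comm]
    · simp [ih, h]

theorem constant_restrict_iff (w : ℕ) (s V : List ℕ) : constant (restrict w s V) = true ↔
    ∀ i ∈ V, ∀ j ∈ V, w ≤ i → w ≤ j → s.getD i 0 = s.getD j 0 := by
  rw [constant_iff]
  constructor
  · intro h i hi j hj hwi hwj
    exact h _ (mem_restrict.2 ⟨i, hi, hwi, rfl⟩) _ (mem_restrict.2 ⟨j, hj, hwj, rfl⟩)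
  · intro h x hx y hy
    obtain ⟨i, hi, hwi, rfl⟩ := mem_restrict.1 hx
    obtain ⟨j, hj, hwj, rfl⟩ := mem_restrict.1 hy
    exact h i hi j hj hwi hwj

theorem canon_getD_eq_iff {s : List ℕ} {i j : ℕ} (hi : i < s.length) (hj : j < s.length) :
    (canon s).getD i 0 = (canon s).getD j 0 ↔ s.getD i 0 = s.getD j 0 := by
  rw [canon, List.getD_eq_getElem _ _ (by simpa), List.getD_eq_getElem _ _ (by simpa),
    List.getD_eq_getElem _ _ hi, List.getD_eq_getElem _ _ hj, List.getElem_map, List.getElem_map,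
    indexIn_eq_idxOf, indexIn_eq_idxOf]
  exact List.idxOf_inj (List.getElem_mem hi)

/-- By `hw` the deuces occupy exactly the first `w` positions; their suits are irrelevant. Among the
other positions `canon` preserves equality and inequality of suits. -/
theorem isFlush_pick_iff {V : List Bool} {cs : List Card} {w : ℕ} (hV : V.length = cs.length)
    (hw : ∀ i c, cs[i]? = some c → (w ≤ i ↔ c.1 ≠ 0)) :
    IsFlush (pick V cs ∅) ↔
      constant (restrict w (canon (cs.map fun c => c.2.val)) (positions V 0)) = true := by
  have hlt : ∀ i ∈ positions V 0, i < cs.length := fun i hi => hV ▸ lt_of_mem_positions hi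
  have hget : ∀ (i : ℕ) (hi : i < cs.length), (cs.map fun c => c.2.val).getD i 0 = cs[i].2.val := by
    intro i hi
    rw [List.getD_eq_getElem _ _ (by simpa), List.getElem_map]
  rw [constant_restrict_iff]
  have hmem : ∀ c, c ∈ naturals (pick V cs ∅) ↔
      ∃ i ∈ positions V 0, cs[i]? = some c ∧ w ≤ i := by
    intro c
    simp only [naturals, Finset.mem_filter, mem_pick, Finset.notMem_empty, false_or]
    constructor
    · rintro ⟨⟨i, hi, he⟩, h0⟩
      exact ⟨i, hi, he, (hw i c he).2 h0⟩
    · rintro ⟨i, hi, he, h0⟩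
      exact ⟨⟨i, hi, he⟩, (hw i c he).1 h0⟩
  constructor
  · intro h i hi j hj hwi hwj
    rw [canon_getD_eq_iff (by simpa using hlt i hi) (by simpa using hlt j hj), hget i (hlt i hi),
      hget j (hlt j hj)]
    exact congrArg Fin.val (h _ ((hmem _).2 ⟨i, hi, List.getElem?_eq_getElem (hlt i hi), hwi⟩) _
      ((hmem _).2 ⟨j, hj, List.getElem?_eq_getElem (hlt j hj), hwj⟩))
  · intro h c hc d hd
    obtain ⟨i, hi, hci, hwi⟩ := (hmem c).1 hc
    obtain ⟨j, hj, hdj, hwj⟩ := (hmem d).1 hd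
    have := h i hi j hj hwi hwj
    rw [canon_getD_eq_iff (by simpa using hlt i hi) (by simpa using hlt j hj), hget i (hlt i hi),
      hget j (hlt j hj)] at this
    rw [List.getElem?_eq_getElem (hlt i hi), Option.some_inj] at hci
    rw [List.getElem?_eq_getElem (hlt j hj), Option.some_inj] at hdj
    rw [← hci, ← hdj]
    exact Fin.ext this

/-- A total depends on denominations and flush property only, so a lane represents every assignment
of suits with its pattern. -/
theorem laneTotal_eq_total {V : List Bool} {cs : List Card} {w : ℕ} (h5 : cs.length = 5)
    (hcs : cs.Nodup) (hr : (cs.map fun c => c.1.val).Pairwise (· ≤ ·))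
    (hw : ∀ i c, cs[i]? = some c → (w ≤ i ↔ c.1 ≠ 0)) (hV : V.length = 5) :
    laneTotal w (cs.map fun c => c.1.val) (canon (cs.map fun c => c.2.val)) V =
      total (pick V cs ∅) ∅ := by
  have hle := length_selectRev_le V (cs.map fun c => c.1.val) []
  rw [List.length_map, h5, List.length_nil, add_zero] at hle
  rw [(lists_selectRev V cs [] ∅ rfl hcs (by simp)).total_eq
    (pairwise_selectRev V _ _ hr List.Pairwise.nil (by simp)) (Nat.add_sub_of_le hle), laneTotal]
  simp only [isFlush_pick_iff (hV.trans h5.symm) hw]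

/-- The maximum of the weighted totals over all ways to hold cards of the hand `h`. -/
def handBest (h : Finset Card) : ℕ :=
  h.powerset.sup fun U => drawWeight U.card * total U (h \ U)

/-- Both numbers are the greatest element of the set of weighted totals over all holds. -/
theorem bestWith_laneTotal {cs : List Card} {w : ℕ} (h5 : cs.length = 5) (hcs : cs.Nodup)
    (hr : (cs.map fun c => c.1.val).Pairwise (· ≤ ·))
    (hw : ∀ i c, cs[i]? = some c → (w ≤ i ↔ c.1 ≠ 0)) :
    Admissible drawWeight 5 0
      (laneTotal w (cs.map fun c => c.1.val) (canon (cs.map fun c => c.2.val))) ∧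
    bestWith max drawWeight 5 0
      (laneTotal w (cs.map fun c => c.1.val) (canon (cs.map fun c => c.2.val))) =
        handBest cs.toFinset := by
  have h : ∀ V : List Bool, V.length = 5 → total (pick V cs ∅) ∅ =
      laneTotal w (cs.map fun c => c.1.val) (canon (cs.map fun c => c.2.val)) V :=
    fun V hV => (laneTotal_eq_total h5 hcs hr hw hV).symm
  constructor
  · have := admissible_total cs ∅ ∅ (by simp) hcs (by simp) (by simp) (by simpa using h5)
    rw [h5, Finset.card_empty] at this
    exact this.congr h
  · rw [← bestWith_congr h]
    have h1 := bestTotal_spec cs hcs 0 ∅ ∅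
    rw [bestTotal, h5] at h1
    simp only [zero_add, Finset.empty_union] at h1
    refine h1.unique ⟨?_, ?_⟩
    · obtain ⟨U, hU, he⟩ := Finset.exists_mem_eq_sup cs.toFinset.powerset
        (Finset.powerset_nonempty _) fun U => drawWeight U.card * total U (cs.toFinset \ U)
      exact ⟨U, hU, he.symm⟩
    · rintro _ ⟨U, hU, rfl⟩
      exact Finset.le_sup (f := fun U => drawWeight U.card * total U (cs.toFinset \ U)) hU

/-! ### Enumeration of all hands by denominations and suits. -/

theorem list_sum_comm {α β : Type} (l : List α) (l' : List β) (f : α → β → ℕ) :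
    (l.map fun a => (l'.map fun b => f a b).sum).sum =
      (l'.map fun b => (l.map fun a => f a b).sum).sum := by
  induction l with
  | nil => simp
  | cons a t ih => simp [ih, List.sum_map_add]

theorem sum_flatMap_map {α β : Type} (l : List α) (L : α → List β) (f : β → ℕ) :
    ((l.flatMap L).map f).sum = (l.map fun a => ((L a).map f).sum).sum := by
  induction l with
  | nil => rfl
  | cons a t ih => simp [ih]

/-- The position of a card in the deck sorted by denomination and suit. -/
def index (c : Card) : ℕ := 4 * c.1.val + c.2.val

theorem index_injective : Function.Injective index := by
  rintro ⟨⟨a, ha⟩, ⟨b, hb⟩⟩ ⟨⟨c, hc⟩, ⟨d, hd⟩⟩ h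
  simp only [index] at h
  simp only [Prod.mk.injEq, Fin.mk.injEq]
  omega

/-- A nonempty set consists of its `f`-least element and a set of elements with larger `f`. -/
theorem sum_powersetCard_succ {α : Type} [DecidableEq α] {f : α → ℕ} (hf : Function.Injective f)
    (A : Finset α) (k : ℕ) (g : Finset α → ℕ) :
    ∑ H ∈ Finset.powersetCard (k + 1) A, g H =
      ∑ d ∈ A, ∑ H ∈ Finset.powersetCard k (A.filter fun c => f d < f c), g (insert d H) := by
  induction A using Finset.induction_on_min_value f with
  | empty => simp
  | insert a s ha hmin ih =>
    -- The new element `a` has the least `f`, so it heads exactly the sets that contain it and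
    -- leaves the terms of the other heads unchanged.
    rw [Finset.powersetCard_succ_insert ha, Finset.sum_union, ih, Finset.sum_insert ha,
      Finset.sum_image, add_comm]
    · congr 1
      · rw [Finset.filter_insert, if_neg (lt_irrefl _), Finset.filter_true_of_mem]
        intro x hx
        refine lt_of_le_of_ne (hmin x hx) fun h => ha ?_
        rwa [hf h]
      · refine Finset.sum_congr rfl fun d hd => ?_
        rw [Finset.filter_insert, if_neg (not_lt.2 (hmin d hd))]
    · intro H hH H' hH' h
      rw [Finset.mem_coe, Finset.mem_powersetCard] at hH hH'
      rw [← Finset.erase_insert fun h => ha (hH.1 h), h,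
        Finset.erase_insert fun h => ha (hH'.1 h)]
    · rw [Finset.disjoint_left]
      intro H hH hH'
      obtain ⟨H', -, rfl⟩ := Finset.mem_image.1 hH'
      exact ha ((Finset.mem_powersetCard.1 hH).1 (Finset.mem_insert_self _ _))

/-- The cards after position `m` in the sorted deck. -/
def above (m : ℕ) : Finset Card := Finset.univ.filter fun c => m < index c

def card (r s : ℕ) : Card := (Fin.ofNat 13 r, Fin.ofNat 4 s)

theorem index_card {r s : ℕ} (hr : r ≤ 12) (hs : s < 4) : index (card r s) = 4 * r + s := by
  simp only [index, card, Fin.ofNat, Nat.mod_eq_of_lt hs, Nat.mod_eq_of_lt (Nat.lt_succ_of_le hr)]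

theorem sum_card (F : Card → ℕ) :
    ∑ c, F c = ∑ r ∈ Finset.range 13, ∑ s ∈ Finset.range 4, F (card r s) := by
  rw [Fintype.sum_prod_type, Finset.sum_range]
  refine Finset.sum_congr rfl fun r _ => ?_
  rw [Finset.sum_range]
  refine Finset.sum_congr rfl fun s _ => ?_
  rw [card, Fin.ofNat_val_eq_self, Fin.ofNat_val_eq_self]

theorem sum_range_map (f : ℕ → ℕ) (n : ℕ) :
    ((List.range n).map f).sum = ∑ i ∈ Finset.range n, f i := rfl

theorem sum_range'_map (f : ℕ → ℕ) {r : ℕ} (hr : r ≤ 12) :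
    ((List.range' (r + 1) (12 - r)).map f).sum = ∑ i ∈ Finset.Ico (r + 1) 13, f i := by
  rw [show 12 - r = 13 - (r + 1) by omega]
  rfl

theorem sum_filter_map {α : Type} (l : List α) (p : α → Bool) (f : α → ℕ) :
    ((l.filter p).map f).sum = (l.map fun a => if p a then f a else 0).sum := by
  induction l with
  | nil => rfl
  | cons a t ih => by_cases h : p a <;> simp [h, ih]

/-- The next card either has the same denomination and a larger suit or a larger denomination and
any suit. These are the two meanings of a bit in `rankLists` and `suitLists`. -/
theorem sum_above {r s : ℕ} (hr : r ≤ 12) (hs : s < 4) (F : Card → ℕ) :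
    ∑ c ∈ above (4 * r + s), F c =
      (((List.range 4).filter fun s' => Nat.blt s s').map fun s' => F (card r s')).sum +
      ((List.range' (r + 1) (12 - r)).map fun r' =>
        ((List.range 4).map fun s' => F (card r' s')).sum).sum := by
  rw [above, Finset.sum_filter, sum_card, ← Finset.sum_range_add_sum_Ico _ (show r + 1 ≤ 13 by omega),
    Finset.sum_range_succ, Finset.sum_eq_zero, zero_add, sum_range'_map _ hr, sum_filter_map,
    sum_range_map]
  · congr 1
    · refine Finset.sum_congr rfl fun s' hs' => ?_
      rw [index_card hr (Finset.mem_range.1 hs')]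
      simp
    · refine Finset.sum_congr rfl fun r' hr' => ?_
      rw [sum_range_map]
      refine Finset.sum_congr rfl fun s' hs' => ?_
      rw [Finset.mem_Ico] at hr'
      rw [index_card (by omega) (Finset.mem_range.1 hs'), if_pos (by omega)]
  · intro r' hr'
    refine Finset.sum_eq_zero fun s' hs' => ?_
    rw [Finset.mem_range] at hr' hs'
    rw [index_card (by omega) hs', if_neg (by omega)]

/-- The denominations of the cards after a card of denomination `r`, the `true`s marking the cards
that have the same denomination as their predecessors. -/
def rankLists : List Bool → ℕ → List (List ℕ)
  | [], _ => [[]]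
  | true :: bs, r => (rankLists bs r).map (List.cons r)
  | false :: bs, r => (List.range' (r + 1) (12 - r)).flatMap fun r' =>
      (rankLists bs r').map (List.cons r')

/-- Choosing the least card first makes one bit of the pattern; the sums over denominations and over
suits separate once the pattern is fixed. -/
theorem sum_powersetCard_above (k : ℕ) {r s : ℕ} (hr : r ≤ 12) (hs : s < 4)
    (g : Finset Card → ℕ) :
    ∑ H ∈ Finset.powersetCard k (above (4 * r + s)), g H =
      ((boolLists k).map fun bits => ((rankLists bits r).map fun ρ =>
        ((suitLists bits s).map fun σ => g (List.zipWith card ρ σ).toFinset).sum).sum).sum := by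
  induction k generalizing r s g with
  | zero => simp [boolLists, rankLists, suitLists]
  | succ k ih =>
    rw [sum_powersetCard_succ index_injective]
    have h1 : ∀ d ∈ above (4 * r + s), ((above (4 * r + s)).filter fun c => index d < index c) =
        above (index d) := by
      intro d hd
      rw [above, Finset.mem_filter] at hd
      ext c
      simp only [above, Finset.mem_filter, Finset.mem_univ, true_and]
      exact ⟨fun h => h.2, fun h => ⟨hd.2.trans h, h⟩⟩
    rw [Finset.sum_congr rfl fun d hd => by rw [h1 d hd], sum_above hr hs, boolLists,
      List.map_append, List.sum_append, List.map_map, List.map_map]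
    congr 1
    · have h2 : ∀ s' ∈ (List.range 4).filter (fun s' => Nat.blt s s'), s' < 4 := fun s' hs' =>
        List.mem_range.1 (List.mem_filter.1 hs').1
      rw [List.map_congr_left fun s' hs' => by
        rw [index_card hr (h2 s' hs'), ih hr (h2 s' hs')], list_sum_comm]
      refine congrArg _ (List.map_congr_left fun bs _ => ?_)
      rw [list_sum_comm]
      simp [rankLists, suitLists, sum_flatMap_map, Function.comp_def]
    · have h2 : ∀ r' ∈ List.range' (r + 1) (12 - r), r' ≤ 12 := fun r' hr' => by
        rw [List.mem_range'_1] at hr'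
        omega
      rw [List.map_congr_left fun r' hr' => congrArg List.sum (List.map_congr_left fun s' hs' => by
        rw [index_card (h2 r' hr') (List.mem_range.1 hs'),
          ih (h2 r' hr') (List.mem_range.1 hs')])]
      rw [List.map_congr_left fun r' _ => list_sum_comm _ _ _, list_sum_comm]
      refine congrArg _ (List.map_congr_left fun bs _ => ?_)
      rw [List.map_congr_left fun r' _ => list_sum_comm _ _ _]
      simp [rankLists, suitLists, sum_flatMap_map, Function.comp_def]

/-- The least card has no predecessor, hence the separate loop over its denomination `r` and the
`false` that frees its suit. -/
theorem sum_hands (g : Finset Card → ℕ) :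
    ∑ H ∈ Finset.powersetCard 5 Finset.univ, g H =
      ((boolLists 4).map fun bits => ((List.range 13).map fun r => ((rankLists bits r).map fun ρ =>
        ((suitLists (false :: bits) 0).map fun σ =>
          g (List.zipWith card (r :: ρ) σ).toFinset).sum).sum).sum).sum := by
  have h : ∀ r ∈ List.range 13, (∑ s ∈ Finset.range 4, ∑ H ∈ Finset.powersetCard 4
      (Finset.univ.filter fun c => index (card r s) < index c), g (insert (card r s) H)) =
      ((boolLists 4).map fun bits => ((rankLists bits r).map fun ρ =>
        ((suitLists (false :: bits) 0).map fun σ =>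
          g (List.zipWith card (r :: ρ) σ).toFinset).sum).sum).sum := by
    intro r hr
    have hr' : r ≤ 12 := Nat.le_of_lt_succ (List.mem_range.1 hr)
    rw [← sum_range_map, List.map_congr_left fun s hs => Eq.trans
      (by rw [index_card hr' (List.mem_range.1 hs)]; rfl)
      (sum_powersetCard_above 4 hr' (List.mem_range.1 hs) fun H => g (insert (card r s) H)),
      list_sum_comm]
    refine congrArg _ (List.map_congr_left fun bs _ => ?_)
    rw [list_sum_comm]
    simp [suitLists, sum_flatMap_map, Function.comp_def]
  rw [sum_powersetCard_succ index_injective, sum_card, ← sum_range_map, List.map_congr_left h,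
    list_sum_comm]

theorem sumTails_range' (f : ℕ → List ℕ → ℕ) (a n : ℕ) :
    sumTails f (List.range' a n) =
      ((List.range' a n).map fun r => f r (List.range' (r + 1) (a + n - 1 - r))).sum := by
  induction n generalizing a with
  | zero => rfl
  | succ n ih =>
    rw [List.range'_succ]
    change f a (List.range' (a + 1) n) + sumTails f (List.range' (a + 1) n) = _
    rw [ih, List.map_cons, List.sum_cons, show a + (n + 1) - 1 - a = n by omega,
      show a + 1 + n - 1 = a + (n + 1) - 1 by omega]

theorem sumRankLists_eq (f : List ℕ → ℕ) (bits : List Bool) (acc : List ℕ) {r : ℕ} (hr : r ≤ 12) :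
    sumRankLists f bits acc r (List.range' (r + 1) (12 - r)) =
      ((rankLists bits r).map fun ρ => f (ρ.reverse ++ acc)).sum := by
  induction bits generalizing acc r with
  | nil => simp [sumRankLists, rankLists]
  | cons b bs ih =>
    cases b
    · change sumTails (fun r' t' => sumRankLists f bs (r' :: acc) r' t') _ = _
      rw [sumTails_range', rankLists, sum_flatMap_map]
      refine congrArg _ (List.map_congr_left fun r' hr' => ?_)
      rw [List.mem_range'_1] at hr'
      rw [show r + 1 + (12 - r) - 1 - r' = 12 - r' by omega, ih _ (by omega), List.map_map]
      simp [Function.comp_def]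
    · change sumRankLists f bs (r :: acc) r _ = _
      rw [ih _ hr, rankLists, List.map_map]
      simp [Function.comp_def]

theorem rankLists_spec {bits : List Bool} {r : ℕ} (hr : r ≤ 12) {ρ : List ℕ}
    (h : ρ ∈ rankLists bits r) :
    ρ.length = bits.length ∧ (∀ x ∈ ρ, r ≤ x ∧ x ≤ 12) ∧ ρ.Pairwise (· ≤ ·) := by
  induction bits generalizing r ρ with
  | nil => simp [rankLists] at h; simp [h]
  | cons b bs ih =>
    obtain ⟨r', ρ', hr', hρ', rfl⟩ : ∃ r' ρ', (r ≤ r' ∧ r' ≤ 12) ∧ ρ' ∈ rankLists bs r' ∧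
        r' :: ρ' = ρ := by
      cases b
      · simp only [rankLists, List.mem_flatMap, List.mem_range'_1, List.mem_map] at h
        obtain ⟨r', hr', ρ', hρ', rfl⟩ := h
        exact ⟨r', ρ', by omega, hρ', rfl⟩
      · simp only [rankLists, List.mem_map] at h
        obtain ⟨ρ', hρ', rfl⟩ := h
        exact ⟨r, ρ', by omega, hρ', rfl⟩
    obtain ⟨h1, h2, h3⟩ := ih hr'.2 hρ'
    refine ⟨by simp [h1], ?_, List.pairwise_cons.2 ⟨fun x hx => (h2 x hx).1, h3⟩⟩
    intro x hx
    rcases List.mem_cons.1 hx with rfl | hx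
    · exact hr'
    · exact ⟨hr'.1.trans (h2 x hx).1, (h2 x hx).2⟩

/-- Leading `true`s repeat the deuce; from the first `false` on all denominations are positive. -/
theorem wildCount_le_iff {bits : List Bool} {ρ : List ℕ} (h : ρ ∈ rankLists bits 0) {i x : ℕ}
    (hx : (0 :: ρ)[i]? = some x) : wildCount bits ≤ i ↔ x ≠ 0 := by
  induction bits generalizing ρ i with
  | nil =>
    simp [rankLists] at h
    subst h
    cases i <;> simp at hx
    simp [wildCount, ← hx]
  | cons b bs ih =>
    cases b
    · simp only [rankLists, List.mem_flatMap, List.mem_range'_1, List.mem_map] at h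
      obtain ⟨r', hr', ρ', hρ', rfl⟩ := h
      change 1 ≤ i ↔ _
      cases i with
      | zero => simp at hx; simp [← hx]
      | succ i =>
        have := List.mem_of_getElem? (l := r' :: ρ') (by simpa using hx)
        rcases List.mem_cons.1 this with rfl | h
        · simp; omega
        · have := ((rankLists_spec (by omega) hρ').2.1 x h).1
          simp; omega
    · simp only [rankLists, List.mem_map] at h
      obtain ⟨ρ', hρ', rfl⟩ := h
      change wildCount bs + 1 ≤ i ↔ _
      cases i with
      | zero => simp at hx; simp [← hx]
      | succ i => rw [Nat.succ_le_succ_iff]; exact ih hρ' (by simpa using hx)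

/-- Strict increase in the sorted deck shows that the enumerated cards are distinct. -/
theorem pairwise_index {bits : List Bool} {r s : ℕ} (hr : r ≤ 12) (hs : s < 4) {ρ σ : List ℕ}
    (hρ : ρ ∈ rankLists bits r) (hσ : σ ∈ suitLists bits s) :
    (card r s :: List.zipWith card ρ σ).Pairwise fun c d => index c < index d := by
  induction bits generalizing r s ρ σ with
  | nil => simp [rankLists, suitLists] at hρ hσ; simp [hρ, hσ]
  | cons b bs ih =>
    obtain ⟨r', s', ρ', σ', hr', hs', hlt, hρ', hσ', rfl, rfl⟩ : ∃ r' s' ρ' σ', r' ≤ 12 ∧ s' < 4 ∧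
        4 * r + s < 4 * r' + s' ∧ ρ' ∈ rankLists bs r' ∧ σ' ∈ suitLists bs s' ∧
        r' :: ρ' = ρ ∧ s' :: σ' = σ := by
      simp only [suitLists, List.mem_flatMap, List.mem_map, List.mem_filter, List.mem_range] at hσ
      obtain ⟨s', ⟨hs', hss⟩, σ', hσ', rfl⟩ := hσ
      cases b
      · simp only [rankLists, List.mem_flatMap, List.mem_range'_1, List.mem_map] at hρ
        obtain ⟨r', hr', ρ', hρ', rfl⟩ := hρ
        exact ⟨r', s', ρ', σ', by omega, hs', by omega, hρ', hσ', rfl, rfl⟩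
      · simp only [rankLists, List.mem_map] at hρ
        obtain ⟨ρ', hρ', rfl⟩ := hρ
        simp at hss
        exact ⟨r, s', ρ', σ', hr, hs', by omega, hρ', hσ', rfl, rfl⟩
    have h := ih hr' hs' hρ' hσ'
    rw [List.zipWith_cons_cons, List.pairwise_cons]
    refine ⟨?_, h⟩
    rw [List.pairwise_cons] at h
    intro c hc
    have h0 : index (card r s) < index (card r' s') := by
      rw [index_card hr hs, index_card hr' hs']
      exact hlt
    rcases List.mem_cons.1 hc with rfl | hc
    · exact h0
    · exact h0.trans (h.1 c hc)

theorem map_fst_zipWith_card {ρ σ : List ℕ} (h : ρ.length = σ.length) (hρ : ∀ x ∈ ρ, x ≤ 12) :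
    ((List.zipWith card ρ σ).map fun c => c.1.val) = ρ := by
  induction ρ generalizing σ with
  | nil => rfl
  | cons r ρ ih =>
    cases σ with
    | nil => simp at h
    | cons s σ =>
      have := hρ r (by simp)
      simp only [List.zipWith_cons_cons, List.map_cons]
      rw [ih (by simpa using h) fun x hx => hρ x (by simp [hx])]
      simp [card, Nat.mod_eq_of_lt (show r < 13 by omega)]

theorem map_snd_zipWith_card {ρ σ : List ℕ} (h : ρ.length = σ.length) (hσ : ∀ x ∈ σ, x < 4) :
    ((List.zipWith card ρ σ).map fun c => c.2.val) = σ := by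
  induction ρ generalizing σ with
  | nil => cases σ <;> simp_all
  | cons r ρ ih =>
    cases σ with
    | nil => simp at h
    | cons s σ =>
      have := hσ s (by simp)
      simp only [List.zipWith_cons_cons, List.map_cons]
      rw [ih (by simpa using h) fun x hx => hσ x (by simp [hx])]
      simp [card, Nat.mod_eq_of_lt this]

/-! ### The computed numbers as sums over hands. -/

/-- The sum of the contributions of all hands with denominations `r :: ρ`. -/
theorem cellSum_eq_sum_hands {bits : List Bool} (hb : bits ∈ boolLists 4) (hl : bits.length = 4)
    {w r : ℕ} (hr : r ≤ 12) {ρ : List ℕ} (hρ : ρ ∈ rankLists bits r)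
    (hw : ∀ i x, (r :: ρ)[i]? = some x → (w ≤ i ↔ x ≠ 0)) :
    cellSum (lanes bits) (maskVec (lanes bits) w) (ρ.reverse ++ [r]) =
      ((suitLists (false :: bits) 0).map fun σ =>
        decode (handBest (List.zipWith card (r :: ρ) σ).toFinset)).sum := by
  obtain ⟨h1, h2, h3⟩ := rankLists_spec hr hρ
  rw [hl] at h1
  have hbest : ∀ σ ∈ suitLists (false :: bits) 0,
      Admissible drawWeight 5 0 (laneTotal w (r :: ρ) (canon σ)) ∧
      bestWith max drawWeight 5 0 (laneTotal w (r :: ρ) (canon σ)) =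
        handBest (List.zipWith card (r :: ρ) σ).toFinset := by
    intro σ hσ
    have hσl : σ.length = 5 := by rw [suitLists_length hσ, List.length_cons, hl]
    have e1 := map_fst_zipWith_card (ρ := r :: ρ) (σ := σ) (by simp [h1, hσl]) (by
      intro x hx
      rcases List.mem_cons.1 hx with rfl | hx
      · exact hr
      · exact (h2 x hx).2)
    have e2 := map_snd_zipWith_card (ρ := r :: ρ) (σ := σ) (by simp [h1, hσl]) (suitLists_lt hσ)
    have hnd : (List.zipWith card (r :: ρ) σ).Nodup := by
      simp only [suitLists, List.mem_flatMap, List.mem_map, List.mem_filter, List.mem_range] at hσ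
      obtain ⟨s', ⟨hs', -⟩, σ', hσ', rfl⟩ := hσ
      exact (pairwise_index hr hs' hρ hσ').imp fun h he => by rw [he] at h; exact lt_irrefl _ h
    have := bestWith_laneTotal (w := w) (cs := List.zipWith card (r :: ρ) σ)
      (by simp [h1, hσl]) hnd (by
        rw [e1, List.pairwise_cons]
        exact ⟨fun x hx => (h2 x hx).1, h3⟩) (by
        intro i c hc
        rw [hw i c.1.val (by rw [← e1, List.getElem?_map, hc]; rfl), ne_eq, Fin.val_eq_zero_iff])
    rwa [e1, e2] at this
  -- The suits enter through their pattern only, so the sum over suits is the weighted sum over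
  -- lanes. Each lane is the pattern of some actual suits and inherits admissibility from them.
  obtain ⟨s1, s2⟩ := sum_lanes hb hl fun t =>
    decode (bestWith max drawWeight 5 0 (laneTotal w (r :: ρ) t))
  rw [← List.map_congr_left fun σ hσ => congrArg decode (hbest σ hσ).2, s1]
  obtain ⟨b, c, d, e, rfl⟩ := List.length_eq_four.1 h1
  refine cellSum_eq _ w r b c d e fun p hp => ?_
  obtain ⟨σ, hσ, he⟩ := s2 p hp
  rw [he]
  exact (hbest σ hσ).1

theorem wildSum_eq {bits : List Bool} (hb : bits ∈ boolLists 4) (hl : bits.length = 4) :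
    wildSum bits = ((rankLists bits 0).map fun ρ => ((suitLists (false :: bits) 0).map fun σ =>
      decode (handBest (List.zipWith card (0 :: ρ) σ).toFinset)).sum).sum := by
  change sumRankLists _ bits [0] 0 (List.range' (0 + 1) (12 - 0)) = _
  rw [sumRankLists_eq _ _ _ (by norm_num)]
  exact congrArg _ (List.map_congr_left fun ρ hρ => cellSum_eq_sum_hands hb hl (by norm_num) hρ
    fun i x => wildCount_le_iff hρ)

theorem naturalSum_eq {bits : List Bool} (hb : bits ∈ boolLists 4) (hl : bits.length = 4) :
    naturalSum bits = ((List.range' 1 12).map fun r => ((rankLists bits r).map fun ρ =>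
      ((suitLists (false :: bits) 0).map fun σ =>
        decode (handBest (List.zipWith card (r :: ρ) σ).toFinset)).sum).sum).sum := by
  change sumTails (fun r t => sumRankLists _ bits [r] r t) (List.range' 1 12) = _
  rw [sumTails_range']
  refine congrArg _ (List.map_congr_left fun r hr => ?_)
  rw [List.mem_range'_1] at hr
  rw [sumRankLists_eq _ _ _ (by omega)]
  refine congrArg _ (List.map_congr_left fun ρ hρ => cellSum_eq_sum_hands hb hl (by omega) hρ ?_)
  intro i x hx
  have : r ≤ x := by
    rcases List.mem_cons.1 (List.mem_of_getElem? hx) with rfl | h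
    · exact le_rfl
    · exact ((rankLists_spec (by omega) hρ).2.1 x h).1
  -- Here `w = 0`, and all denominations are at least `r ≥ 1`: there are no deuces.
  omega

theorem length_of_mem_boolLists {k : ℕ} {bits : List Bool} (h : bits ∈ boolLists k) :
    bits.length = k := by
  induction k generalizing bits with
  | zero => simp [boolLists] at h; simp [h]
  | succ k ih =>
    simp only [boolLists, List.mem_append, List.mem_map] at h
    obtain ⟨bs, h, rfl⟩ | ⟨bs, h, rfl⟩ := h <;> simp [ih h]

theorem sum_decode_handBest :
    ∑ h ∈ Finset.powersetCard 5 Finset.univ, decode (handBest h) =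
      0x22703cadcd477bf0f8000922370ae9f993bbf34f260000000000000012446e15d430 := by
  -- For each pattern the least denomination is 0, that of the deuces, or lies between 1 and 12.
  rw [sum_hands, List.map_congr_left (g := fun bits => wildSum bits + naturalSum bits)]
  · simp only [boolLists, List.map_cons, List.map_nil, List.cons_append, List.nil_append,
      List.sum_cons, List.sum_nil, wildSum_0000, naturalSum_0000, wildSum_0001, naturalSum_0001,
      wildSum_0010, naturalSum_0010, wildSum_0011, naturalSum_0011, wildSum_0100, naturalSum_0100,
      wildSum_0101, naturalSum_0101, wildSum_0110, naturalSum_0110, wildSum_0111, naturalSum_0111,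
      wildSum_1000, naturalSum_1000, wildSum_1001, naturalSum_1001, wildSum_1010, naturalSum_1010,
      wildSum_1011, naturalSum_1011, wildSum_1100, naturalSum_1100, wildSum_1101, naturalSum_1101,
      wildSum_1110, naturalSum_1110, wildSum_1111, naturalSum_1111, Nat.reduceAdd]
  · intro bits hb
    rw [wildSum_eq hb (length_of_mem_boolLists hb), naturalSum_eq hb (length_of_mem_boolLists hb),
      show List.range 13 = 0 :: List.range' 1 12 from rfl, List.map_cons, List.sum_cons]

/-! ### Moments of the return and best holds. -/

/-- The sets of new cards that may replace the discards, if the cards `S` of the hand `h` are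
held. -/
def replacements (h S : Finset Card) : Finset (Finset Card) :=
  Finset.powersetCard (5 - S.card) hᶜ

/-- The `j`-th moment of the return, multiplied by 7669695, if the cards `S` of the hand `h` are
held. -/
def moment (j : ℕ) (h S : Finset Card) : ℕ :=
  drawWeight S.card * ∑ D ∈ replacements h S, payout (S ∪ D) ^ j

theorem card_replacements {h S : Finset Card} (h5 : h.card = 5) :
    (replacements h S).card = Nat.choose 47 (5 - S.card) := by
  rw [replacements, Finset.card_powersetCard, Finset.card_compl, h5]
  simp

theorem moment_le {h S : Finset Card} (h5 : h.card = 5) (hS : S ⊆ h) (j : ℕ) :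
    moment j h S ≤ 7669695 * 800 ^ j := by
  have hc := Finset.card_le_card hS
  rw [h5] at hc
  rw [moment, ← drawWeight_mul_choose hc, ← card_replacements h5, mul_assoc]
  exact Nat.mul_le_mul_left _ ((Finset.sum_le_card_nsmul _ _ _ fun D _ =>
    Nat.pow_le_pow_left (payout_le _) j).trans_eq (smul_eq_mul ..))

/-- The factor 2^43 in `score` is chosen for this bound: 7669695 · 800² < 2^43. -/
theorem moment_two_lt {h S : Finset Card} (h5 : h.card = 5) (hS : S ⊆ h) :
    moment 2 h S < 2 ^ 43 :=
  (moment_le h5 hS 2).trans_lt (by norm_num)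

/-- Each draw with return p contributes `score p + p² = 2^43 p`, the subtraction in `score` being
exact because p ≤ 800. -/
theorem weighted_total_add {h S : Finset Card} (h5 : h.card = 5) (hS : S ⊆ h) :
    drawWeight S.card * total S (h \ S) + moment 2 h S = 2 ^ 43 * moment 1 h S := by
  have hc := Finset.card_le_card hS
  rw [h5] at hc
  rw [total_eq_sum_draws Finset.disjoint_sdiff hc, Finset.union_sdiff_of_subset hS, moment, moment,
    ← mul_add, replacements, ← Finset.sum_add_distrib, mul_left_comm (2 ^ 43)]
  congr 1
  rw [Finset.mul_sum]
  refine Finset.sum_congr rfl fun D _ => ?_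
  have := payout_le (S ∪ D)
  rw [score_eq, pow_two, pow_one, mul_comm (2 ^ 43)]
  exact Nat.sub_add_cancel (Nat.mul_le_mul_left _ (this.trans (by norm_num)))

/-- The cards of `h` to be held for the largest mean return and, subject to that, the smallest second
moment of the return. -/
theorem exists_best_hold {h : Finset Card} (h5 : h.card = 5) : ∃ S ⊆ h,
    handBest h + moment 2 h S = 2 ^ 43 * moment 1 h S ∧ ∀ U ⊆ h, moment 1 h U ≤ moment 1 h S ∧
      (moment 1 h U = moment 1 h S → moment 2 h S ≤ moment 2 h U) := by
  obtain ⟨S, hS, he⟩ := Finset.exists_mem_eq_sup h.powerset (Finset.powerset_nonempty _) fun U =>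
    drawWeight U.card * total U (h \ U)
  rw [Finset.mem_powerset] at hS
  have h1 := weighted_total_add h5 hS
  refine ⟨S, hS, by rw [handBest, he, h1], fun U hU => ?_⟩
  have h2 := weighted_total_add h5 hU
  have h3 : drawWeight U.card * total U (h \ U) ≤ drawWeight S.card * total S (h \ S) :=
    he ▸ Finset.le_sup (f := fun U => drawWeight U.card * total U (h \ U))
      (Finset.mem_powerset.2 hU)
  have h4 := moment_two_lt h5 hU
  generalize moment 1 h U = a at *
  generalize moment 1 h S = b at *
  -- With `a` for `U` and `b` for `S`, maximality of `S` gives 2^43 (a - b) ≤ M_2(U) - M_2(S) <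
  -- 2^43, hence a ≤ b; for a = b it gives M_2(S) ≤ M_2(U).
  constructor
  · norm_num at *
    omega
  · rintro rfl
    omega

/-- Since 0 ≤ b < 2^43, rounding k / 2^43 up recovers `a`. -/
theorem decode_eq {k a b : ℕ} (h : k + b = 2 ^ 43 * a) (hb : b < 2 ^ 43) :
    decode k = a + 2 ^ 100 * k + 2 ^ 200 * a ^ 2 := by
  have ha : (k + (2 ^ 43 - 1)) >>> 43 = a := by
    rw [Nat.shiftRight_eq_div_pow]
    norm_num at *
    omega
  change (k + (2 ^ 43 - 1)) >>> 43 * (1 + ((k + (2 ^ 43 - 1)) >>> 43) <<< 200) + k <<< 100 = _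
  rw [ha, Nat.shiftLeft_eq, Nat.shiftLeft_eq]
  ring

open Classical in
/-- A best hold, see `exists_best_hold`. -/
noncomputable def bestHold (h : Finset Card) : Finset Card :=
  if h5 : h.card = 5 then (exists_best_hold h5).choose else ∅

theorem bestHold_spec {h : Finset Card} (h5 : h.card = 5) : bestHold h ⊆ h ∧
    handBest h + moment 2 h (bestHold h) = 2 ^ 43 * moment 1 h (bestHold h) ∧
    ∀ U ⊆ h, moment 1 h U ≤ moment 1 h (bestHold h) ∧
      (moment 1 h U = moment 1 h (bestHold h) → moment 2 h (bestHold h) ≤ moment 2 h U) := by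
  rw [bestHold, dif_pos h5]
  exact (exists_best_hold h5).choose_spec

/-- Here 6135756000 = 7669695 · 800. -/
theorem sum_moment_one_le {P : Finset (Finset Card)} (hP : ∀ h ∈ P, h.card = 5) :
    ∑ h ∈ P, moment 1 h (bestHold h) ≤ P.card * 6135756000 := by
  refine (Finset.sum_le_card_nsmul _ _ 6135756000 fun h hh => ?_).trans_eq (smul_eq_mul ..)
  exact (moment_le (hP h hh) (bestHold_spec (hP h hh)).1 1).trans_eq (by norm_num)

theorem sum_handBest_add {P : Finset (Finset Card)} (hP : ∀ h ∈ P, h.card = 5) :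
    ∑ h ∈ P, handBest h + ∑ h ∈ P, moment 2 h (bestHold h) =
      2 ^ 43 * ∑ h ∈ P, moment 1 h (bestHold h) := by
  rw [← Finset.sum_add_distrib, Finset.mul_sum]
  exact Finset.sum_congr rfl fun h hh => (bestHold_spec (hP h hh)).2.1

theorem sum_decode_eq {P : Finset (Finset Card)} (hP : ∀ h ∈ P, h.card = 5) :
    ∑ h ∈ P, decode (handBest h) = ∑ h ∈ P, moment 1 h (bestHold h) +
      2 ^ 100 * ∑ h ∈ P, handBest h + 2 ^ 200 * ∑ h ∈ P, moment 1 h (bestHold h) ^ 2 := by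
  rw [Finset.mul_sum, Finset.mul_sum, ← Finset.sum_add_distrib, ← Finset.sum_add_distrib]
  exact Finset.sum_congr rfl fun h hh => decode_eq (bestHold_spec (hP h hh)).2.1
    (moment_two_lt (hP h hh) (bestHold_spec (hP h hh)).1)

theorem digits_unique {m a d b X : ℕ} (ha : a < m) (hd : d < m)
    (h : a + m * d + m ^ 2 * b = X) : a = X % m ∧ d = X / m % m ∧ b = X / m / m := by
  have hm : 0 < m := by omega
  have h1 : X = a + m * (d + m * b) := by rw [← h]; ring
  have h2 : X / m = d + m * b := by
    rw [h1, Nat.add_mul_div_left _ _ hm, Nat.div_eq_of_lt ha, zero_add]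
  refine ⟨?_, ?_, ?_⟩
  · rw [h1, Nat.add_mul_mod_self_left, Nat.mod_eq_of_lt ha]
  · rw [h2, Nat.add_mul_mod_self_left, Nat.mod_eq_of_lt hd]
  · rw [h2, Nat.add_mul_div_left _ _ hm, Nat.div_eq_of_lt hd, zero_add]

/-- The sums `a`, `d` and `b` are the digits of the packed sum in base 2^100, the last one
unbounded; the sum `c` of second moments then follows from `h2`. -/
theorem eq_of_decode_sum {a b c d : ℕ} (h1 : a + 2 ^ 100 * d + 2 ^ 200 * b =
      0x22703cadcd477bf0f8000922370ae9f993bbf34f260000000000000012446e15d430)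
    (h2 : d + c = 2 ^ 43 * a) (h3 : a ≤ 2598960 * 6135756000) :
    a = 20085114000432 ∧ b = 635276828634154529016 ∧ c = 535205551738272 := by
  -- No carry into the third digit: d ≤ 2^43 · 2598960 · 6135756000 < 2^100.
  have hd : d < 2 ^ 100 := ((Nat.le_add_right d c).trans_eq h2).trans_lt
    ((Nat.mul_le_mul_left _ h3).trans_lt (by norm_num))
  rw [show 2 ^ 200 = (2 ^ 100) ^ 2 by norm_num] at h1
  obtain ⟨e1, e2, e3⟩ := digits_unique (h3.trans_lt (by norm_num)) hd h1
  norm_num at e1 e2 e3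
  refine ⟨e1, e3, ?_⟩
  rw [e1, e2] at h2
  exact Nat.add_left_cancel (h2.trans (by norm_num))

theorem card_powersetCard_five :
    (Finset.powersetCard 5 (Finset.univ : Finset Card)).card = 2598960 := by
  rw [Finset.card_powersetCard, Finset.card_univ, Fintype.card_prod, Fintype.card_fin,
    Fintype.card_fin]
  decide +kernel

theorem sum_bestHold :
    ∑ h ∈ Finset.powersetCard 5 Finset.univ, moment 1 h (bestHold h) = 20085114000432 ∧
    ∑ h ∈ Finset.powersetCard 5 Finset.univ, moment 1 h (bestHold h) ^ 2 =
      635276828634154529016 ∧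
    ∑ h ∈ Finset.powersetCard 5 Finset.univ, moment 2 h (bestHold h) = 535205551738272 := by
  have h1 := sum_decode_handBest
  have h2 := card_powersetCard_five
  have h3 : ∀ h ∈ Finset.powersetCard 5 (Finset.univ : Finset Card), h.card = 5 :=
    fun h hh => (Finset.mem_powersetCard.1 hh).2
  generalize Finset.powersetCard 5 (Finset.univ : Finset Card) = P at h1 h2 h3 ⊢
  exact eq_of_decode_sum ((sum_decode_eq h3).symm.trans h1) (sum_handBest_add h3)
    ((sum_moment_one_le h3).trans_eq (by rw [h2]))

/-! Exchanging suits. -/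

theorem lists_map {π : Equiv.Perm Card} (hπ : ∀ c, (π c).1 = c.1) {l : List ℕ} {h : Finset Card}
    (H : Lists l h) : Lists l (h.map π.toEmbedding) := by
  refine Eq.trans H ?_
  rw [Finset.map_val, Multiset.map_map]
  simp [hπ]

theorem exists_lists (h : Finset Card) : ∃ l, Lists l h :=
  ⟨(h.val.map fun c : Card => c.1.val).toList, by rw [Lists, Multiset.coe_toList]⟩

/-- A permutation of the deck that leaves the denominations fixed and permutes the suits of the
natural cards. -/
def IsSuitExchange (π : Equiv.Perm Card) : Prop :=
  (∀ c, (π c).1 = c.1) ∧ ∃ σ : Equiv.Perm (Fin 4), ∀ c, c.1 ≠ 0 → (π c).2 = σ c.2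

theorem IsSuitExchange.isFlush_map_iff {π : Equiv.Perm Card} (hπ : IsSuitExchange π)
    (h : Finset Card) : IsFlush (h.map π.toEmbedding) ↔ IsFlush h := by
  obtain ⟨h1, σ, hσ⟩ := hπ
  simp only [IsFlush, naturals, Finset.mem_filter, Finset.mem_map, Equiv.coe_toEmbedding]
  constructor
  · intro H c hc d hd
    have := H (π c) ⟨⟨c, hc.1, rfl⟩, by rw [h1]; exact hc.2⟩ (π d)
      ⟨⟨d, hd.1, rfl⟩, by rw [h1]; exact hd.2⟩
    rw [hσ c hc.2, hσ d hd.2] at this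
    exact σ.injective this
  · rintro H _ ⟨⟨c, hc, rfl⟩, hc0⟩ _ ⟨⟨d, hd, rfl⟩, hd0⟩
    rw [h1] at hc0 hd0
    rw [hσ c hc0, hσ d hd0, H c ⟨hc, hc0⟩ d ⟨hd, hd0⟩]

/-- Denominations and flush property, which determine the payout, are preserved. -/
theorem IsSuitExchange.payout_map {π : Equiv.Perm Card} (hπ : IsSuitExchange π) {h : Finset Card}
    (h5 : h.card = 5) : payout (h.map π.toEmbedding) = payout h := by
  obtain ⟨l, H⟩ := exists_lists h
  rw [H.payout_eq h5, (lists_map hπ.1 H).payout_eq (by rwa [Finset.card_map])]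
  simp only [hπ.isFlush_map_iff]

theorem IsSuitExchange.total_map {π : Equiv.Perm Card} (hπ : IsSuitExchange π)
    (S T : Finset Card) :
    total (S.map π.toEmbedding) (T.map π.toEmbedding) = total S T := by
  rw [total, total]
  symm
  refine Finset.sum_equiv π.finsetCongr (fun H => ?_) fun H hH => ?_
  · simp [Finset.map_subset_map, Finset.disjoint_map, Finset.mem_powersetCard]
  · rw [Finset.mem_filter, Finset.mem_powersetCard] at hH
    rw [Equiv.finsetCongr_apply, hπ.payout_map hH.1.2]

theorem IsSuitExchange.handBest_map {π : Equiv.Perm Card} (hπ : IsSuitExchange π)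
    (h : Finset Card) : handBest (h.map π.toEmbedding) = handBest h := by
  have key : ∀ U ⊆ h, drawWeight (U.map π.toEmbedding).card *
      total (U.map π.toEmbedding) (h.map π.toEmbedding \ U.map π.toEmbedding) =
        drawWeight U.card * total U (h \ U) := by
    intro U _
    rw [Finset.card_map, ← Finset.map_sdiff, hπ.total_map]
  refine le_antisymm (Finset.sup_le fun U hU => ?_) (Finset.sup_le fun U hU => ?_)
  · obtain ⟨U, hU', rfl⟩ := Finset.subset_map_iff.1 (Finset.mem_powerset.1 hU)
    rw [key U hU']
    exact Finset.le_sup (f := fun U => drawWeight U.card * total U (h \ U))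
      (Finset.mem_powerset.2 hU')
  · rw [Finset.mem_powerset] at hU
    rw [← key U hU]
    exact Finset.le_sup (f := fun V => drawWeight V.card * total V (h.map π.toEmbedding \ V))
      (Finset.mem_powerset.2 (Finset.map_subset_map.2 hU))

theorem exists_perm_forall_mem_iff {α : Type} [Fintype α] [DecidableEq α] {s t : Finset α}
    (h : s.card = t.card) : ∃ τ : Equiv.Perm α, ∀ x, τ x ∈ t ↔ x ∈ s := by
  let e : {x // x ∈ s} ≃ {x // x ∈ t} := Finset.equivOfCardEq h
  refine ⟨e.extendSubtype, fun x => ⟨fun hx => ?_, fun hx => e.extendSubtype_mem x hx⟩⟩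
  by_contra hs
  exact e.extendSubtype_not_mem x hs hx

/-- The permutation `σ` moves the natural cards only. Both hands have five cards and equally many
natural ones, hence equally many deuces, which a second permutation `τ` of the suits matches. -/
theorem exists_suitExchange {h h' : Finset Card} (h5 : h.card = 5) (h5' : h'.card = 5)
    {σ : Equiv.Perm (Fin 4)} (hσ : (naturals h).image (fun c => (c.1, σ c.2)) = naturals h') :
    ∃ π, IsSuitExchange π ∧ h.map π.toEmbedding = h' := by
  have hinj : Function.Injective fun c : Card => (c.1, σ c.2) := by
    rintro ⟨a, b⟩ ⟨c, d⟩ h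
    simpa using h
  let w : Finset Card → Finset (Fin 4) := fun h => Finset.univ.filter fun s => (0, s) ∈ h
  have hw : ∀ h : Finset Card, (w h).card = (h.filter fun c => ¬ c.1 ≠ 0).card := by
    intro h
    rw [← Finset.card_map ⟨fun s : Fin 4 => ((0, s) : Card), fun a b h => by simpa using h⟩]
    congr 1
    ext ⟨r, s⟩
    simp only [w, Finset.mem_map, Finset.mem_filter, Finset.mem_univ, true_and,
      not_not]
    constructor
    · rintro ⟨s', hs', he⟩
      cases he
      exact ⟨hs', rfl⟩
    · rintro ⟨hs, rfl⟩
      exact ⟨s, hs, rfl⟩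
  have hcard : (w h).card = (w h').card := by
    have e1 := Finset.card_filter_add_card_filter_not (s := h) fun c => c.1 ≠ 0
    have e2 := Finset.card_filter_add_card_filter_not (s := h') fun c => c.1 ≠ 0
    have e3 := Finset.card_image_of_injective (naturals h) hinj
    rw [hσ] at e3
    simp only [naturals] at e3
    rw [hw, hw]
    omega
  obtain ⟨τ, hτ⟩ := exists_perm_forall_mem_iff hcard
  simp only [w, Finset.mem_filter, Finset.mem_univ, true_and] at hτ
  let π : Equiv.Perm Card :=
    { toFun := fun c => (c.1, if c.1 = 0 then τ c.2 else σ c.2)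
      invFun := fun c => (c.1, if c.1 = 0 then τ.symm c.2 else σ.symm c.2)
      left_inv := fun c => by by_cases h0 : c.1 = 0 <;> simp [h0, Prod.ext_iff]
      right_inv := fun c => by by_cases h0 : c.1 = 0 <;> simp [h0, Prod.ext_iff] }
  refine ⟨π, ⟨fun c => rfl, σ, fun c hc => if_neg hc⟩, ?_⟩
  refine Finset.eq_of_subset_of_card_le ?_ (by rw [Finset.card_map, h5, h5'])
  intro c hc'
  obtain ⟨⟨r, s⟩, hc, rfl⟩ := Finset.mem_map.1 hc'
  by_cases h0 : r = 0
  · subst h0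
    exact (hτ s).2 hc
  · have : ((r, σ s) : Card) ∈ naturals h' := by
      rw [← hσ]
      exact Finset.mem_image.2 ⟨(r, s), Finset.mem_filter.2 ⟨hc, h0⟩, rfl⟩
    change (r, if r = 0 then τ s else σ s) ∈ h'
    rw [if_neg h0]
    exact (Finset.mem_filter.1 this).1

/-- The chosen best holds need not correspond under the exchange of suits, but the maximum
`handBest` is invariant and determines the first moment. -/
theorem moment_bestHold_eq_of_equiv {h h' : Hand} (hh : h ≈ h') :
    moment 1 h.1 (bestHold h.1) = moment 1 h'.1 (bestHold h'.1) := by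
  obtain ⟨σ, hσ⟩ := hh
  obtain ⟨π, hπ, he⟩ := exists_suitExchange h.2 h'.2 hσ
  have hb := hπ.handBest_map h.1
  rw [he] at hb
  have e1 := (bestHold_spec h.2).2.1
  have e2 := (bestHold_spec h'.2).2.1
  have l1 := moment_two_lt h.2 (bestHold_spec h.2).1
  have l2 := moment_two_lt h'.2 (bestHold_spec h'.2).1
  rw [hb] at e2
  generalize moment 1 h.1 (bestHold h.1) = a at *
  generalize moment 1 h'.1 (bestHold h'.1) = b at *
  norm_num at *
  omega

/-! ### Expectations as iterated means over hands and draws. -/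

instance (n : ℕ) : Fintype (Outcome n) := inferInstanceAs (Fintype (Hand × (Fin n → Finset Card)))

instance (n : ℕ) : DiscreteMeasurableSpace (Outcome n) := ⟨fun _ => trivial⟩

instance (s : Strategy) (n : ℕ) : IsProbabilityMeasure (game s n) :=
  PMF.toMeasure.isProbabilityMeasure _

theorem card_hand : Fintype.card Hand = 2598960 := by
  change Fintype.card {h : Finset Card // h.card = 5} = _
  rw [Fintype.card_finset_len, Fintype.card_prod, Fintype.card_fin, Fintype.card_fin]
  decide +kernel

theorem sum_hand {M : Type} [AddCommMonoid M] (f : Finset Card → M) :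
    ∑ h : Hand, f h.1 = ∑ h ∈ Finset.powersetCard 5 Finset.univ, f h :=
  (Finset.sum_subtype (p := fun h : Finset Card => h.card = 5) _
    (fun h => by simp [Finset.mem_powersetCard]) f).symm

/-- The mean of `f` on the set `s`. -/
noncomputable def mean {α : Type} (s : Finset α) (f : α → ℝ) : ℝ := (∑ a ∈ s, f a) / s.card

theorem mean_const {α : Type} {s : Finset α} (hs : s.Nonempty) (c : ℝ) :
    mean s (fun _ => c) = c := by
  have : (s.card : ℝ) ≠ 0 := by exact_mod_cast hs.card_pos.ne'
  rw [mean, Finset.sum_const, nsmul_eq_mul, mul_div_cancel_left₀ _ this]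

theorem mean_sum {α ι : Type} (s : Finset α) (t : Finset ι) (f : ι → α → ℝ) :
    mean s (fun a => ∑ i ∈ t, f i a) = ∑ i ∈ t, mean s (f i) := by
  simp only [mean]
  rw [Finset.sum_comm, Finset.sum_div]

theorem mean_mul {α : Type} (s : Finset α) (c : ℝ) (f : α → ℝ) :
    mean s (fun a => c * f a) = c * mean s f := by
  simp only [mean]
  rw [← Finset.mul_sum, mul_div_assoc]

theorem mean_congr {α : Type} {s : Finset α} {f g : α → ℝ} (h : ∀ a ∈ s, f a = g a) :
    mean s f = mean s g := by
  rw [mean, mean, Finset.sum_congr rfl h]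

theorem outcomePMF_apply (s : Strategy) (n : ℕ) (h : Hand) (d : Fin n → Finset Card) :
    outcomePMF s n (h, d) = (Fintype.card Hand : ENNReal)⁻¹ *
      if d ∈ draws s n h then ((draws s n h).card : ENNReal)⁻¹ else 0 := by
  rw [outcomePMF]
  refine (PMF.bind_apply _ _ _).trans ?_
  rw [tsum_eq_single h]
  · rw [PMF.uniformOfFintype_apply]
    refine congrArg _ ((PMF.map_apply _ _ _).trans ?_)
    rw [tsum_eq_single d]
    · refine (if_pos rfl).trans ?_
      convert PMF.uniformOfFinset_apply (draws_nonempty s n h) d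
    · intro d' hd'
      exact if_neg fun he => hd' (congrArg Prod.snd he).symm
  · intro h' hh'
    refine mul_eq_zero_of_right _ ((PMF.map_apply _ _ _).trans ?_)
    refine (ENNReal.tsum_eq_zero.2 fun d' => if_neg fun he => hh' ?_)
    exact (congrArg Prod.fst he).symm

theorem integral_game (s : Strategy) (n : ℕ) (f : Outcome n → ℝ) :
    ∫ ω, f ω ∂(game s n) = mean Finset.univ fun h => mean (draws s n h) fun d => f (h, d) := by
  rw [game, PMF.integral_eq_sum, mean, Finset.sum_div]
  refine (Fintype.sum_prod_type _).trans (Finset.sum_congr rfl fun h _ => ?_)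
  -- The outcomes outside `draws s n h` have probability zero.
  rw [mean, div_div, Finset.sum_div, ← Finset.sum_filter_add_sum_filter_not Finset.univ
    (fun d => d ∈ draws s n h), add_eq_left.2, Finset.filter_mem_eq_inter, Finset.univ_inter]
  · refine Finset.sum_congr rfl fun d hd => ?_
    rw [outcomePMF_apply, if_pos hd, smul_eq_mul, ENNReal.toReal_mul, ENNReal.toReal_inv,
      ENNReal.toReal_inv, ENNReal.toReal_natCast, ENNReal.toReal_natCast, Finset.card_univ]
    ring
  · refine Finset.sum_eq_zero fun d hd => ?_
    rw [outcomePMF_apply, if_neg (Finset.mem_filter.1 hd).2]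
    simp

/-- Independence of the plays given the hand: `draws s n h` is a product set, so the sum of products
is the product of sums. -/
theorem mean_draws_prod (s : Strategy) (n : ℕ) (h : Hand) (F : Fin n → Finset Card → ℝ) :
    mean (draws s n h) (fun d => ∏ k, F k (d k)) =
      ∏ k, mean (replacements h.1 (s.hold h)) (F k) := by
  simp only [mean]
  rw [draws, ← Finset.prod_univ_sum, Finset.prod_div_distrib, Fintype.card_piFinset]
  simp [replacements]

theorem replacements_nonempty (s : Strategy) (h : Hand) :
    (replacements h.1 (s.hold h)).Nonempty := by
  rw [← Finset.card_pos, card_replacements h.2]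
  exact Nat.choose_pos (by omega)

theorem mean_draws_apply (s : Strategy) {n : ℕ} (h : Hand) (i : Fin n) (f : Finset Card → ℝ) :
    mean (draws s n h) (fun d => f (d i)) = mean (replacements h.1 (s.hold h)) f := by
  -- A function of one play is a product with the factors 1 for the others.
  have := mean_draws_prod s n h fun k D => if k = i then f D else 1
  simp only [Finset.prod_ite_eq', Finset.mem_univ, if_true] at this
  rw [this, Finset.prod_eq_single i]
  · simp
  · intro k _ hk
    simp only [if_neg hk]
    exact mean_const (replacements_nonempty s h) 1
  · simp

theorem mean_draws_mul (s : Strategy) {n : ℕ} (h : Hand) {i j : Fin n} (hij : i ≠ j)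
    (f g : Finset Card → ℝ) :
    mean (draws s n h) (fun d => f (d i) * g (d j)) =
      mean (replacements h.1 (s.hold h)) f * mean (replacements h.1 (s.hold h)) g := by
  have := mean_draws_prod s n h fun k D =>
    (if k = i then f D else 1) * if k = j then g D else 1
  simp only [Finset.prod_mul_distrib, Finset.prod_ite_eq', Finset.mem_univ, if_true] at this
  rw [this]
  have h1 : ∀ k, mean (replacements h.1 (s.hold h))
      (fun D => (if k = i then f D else 1) * if k = j then g D else 1) =
      (if k = i then mean (replacements h.1 (s.hold h)) f else 1) *
        if k = j then mean (replacements h.1 (s.hold h)) g else 1 := by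
    intro k
    by_cases hi : k = i
    · simp [hi, hij]
    · by_cases hj : k = j
      · simp [hj, hij.symm]
      · simp only [if_neg hi, if_neg hj, mul_one]
        exact mean_const (replacements_nonempty s h) 1
  simp only [h1, Finset.prod_mul_distrib, Finset.prod_ite_eq', Finset.mem_univ, if_true]

/-- The `j`-th moment of the return of one play under the strategy `s`, given the initial hand. -/
noncomputable def handMoment (j : ℕ) (s : Strategy) (h : Hand) : ℝ :=
  (moment j h.1 (s.hold h) : ℝ) / 7669695

theorem mean_replacements (s : Strategy) (h : Hand) (j : ℕ) :
    mean (replacements h.1 (s.hold h)) (fun D => (payout (s.hold h ∪ D) : ℝ) ^ j) =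
      handMoment j s h := by
  have hc := Finset.card_le_card (s.hold_subset h)
  rw [h.2] at hc
  have h0 := drawWeight_mul_choose hc
  have h1 : ((drawWeight (s.hold h).card : ℝ) * (replacements h.1 (s.hold h)).card) = 7669695 := by
    rw [card_replacements h.2]
    exact_mod_cast h0
  have h2 : (drawWeight (s.hold h).card : ℝ) ≠ 0 := by
    intro h2
    rw [h2, zero_mul] at h1
    norm_num at h1
  rw [mean, handMoment, moment, ← h1]
  push_cast
  rw [mul_div_mul_left _ _ h2]

theorem integral_of_hand (s : Strategy) (n : ℕ) (F : Hand → ℝ) :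
    ∫ ω : Outcome n, F ω.1 ∂(game s n) = mean Finset.univ F := by
  rw [integral_game]
  exact mean_congr fun h _ => mean_const (draws_nonempty s n h) (F h)

theorem mean_draws_ret (s : Strategy) {n : ℕ} (h : Hand) (i : Fin n) :
    mean (draws s n h) (fun d => ret s i (h, d)) = handMoment 1 s h := by
  rw [← mean_replacements]
  simp only [pow_one]
  exact mean_draws_apply s h i fun D => (payout (s.hold h ∪ D) : ℝ)

theorem mean_draws_ret_mul_ret (s : Strategy) {n : ℕ} (h : Hand) (i j : Fin n) :
    mean (draws s n h) (fun d => ret s i (h, d) * ret s j (h, d)) =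
      handMoment 1 s h ^ 2 + if i = j then handMoment 2 s h - handMoment 1 s h ^ 2 else 0 := by
  split_ifs with hij
  · subst hij
    rw [add_sub_cancel, ← mean_replacements]
    simp only [← pow_two]
    exact mean_draws_apply s h i fun D => (payout (s.hold h ∪ D) : ℝ) ^ 2
  · rw [add_zero, pow_two, ← mean_replacements]
    simp only [pow_one]
    exact mean_draws_mul s h hij (fun D => (payout (s.hold h ∪ D) : ℝ))
      fun D => (payout (s.hold h ∪ D) : ℝ)

theorem integral_avgRet (s : Strategy) {n : ℕ} (hn : 1 ≤ n) :
    ∫ ω, avgRet s n ω ∂(game s n) = mean Finset.univ (handMoment 1 s) := by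
  have hn' : (n : ℝ) ≠ 0 := by positivity
  rw [integral_game]
  refine mean_congr fun h _ => ?_
  simp only [avgRet, div_eq_inv_mul]
  rw [mean_mul, mean_sum]
  simp only [mean_draws_ret, Finset.sum_const, Finset.card_univ, Fintype.card_fin, nsmul_eq_mul]
  field_simp

/-- All n² products of two returns contribute the squared conditional mean, and the n diagonal ones
the conditional variance in addition; division by n² leaves the factor 1/n. -/
theorem integral_avgRet_sq (s : Strategy) {n : ℕ} (hn : 1 ≤ n) :
    ∫ ω, avgRet s n ω ^ 2 ∂(game s n) = mean Finset.univ fun h =>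
      handMoment 1 s h ^ 2 + (handMoment 2 s h - handMoment 1 s h ^ 2) / n := by
  have hn' : (n : ℝ) ≠ 0 := by positivity
  rw [integral_game]
  refine mean_congr fun h _ => ?_
  simp only [avgRet, div_eq_inv_mul, mul_pow]
  rw [mean_mul]
  simp only [pow_two (Finset.sum _ _), Finset.sum_mul_sum]
  simp only [mean_sum, mean_draws_ret_mul_ret, Finset.sum_add_distrib, Finset.sum_const,
    Finset.card_univ, Fintype.card_fin, nsmul_eq_mul, Finset.sum_ite_eq, Finset.mem_univ, if_true]
  field_simp

/-! ### The variance decomposition. -/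

/-- The variance of the mean return, given the initial hand. -/
noncomputable def dealPart (s : Strategy) : ℝ :=
  mean Finset.univ (fun h => handMoment 1 s h ^ 2) - mean Finset.univ (handMoment 1 s) ^ 2

/-- The mean of the variance of the return, given the initial hand. -/
noncomputable def drawPart (s : Strategy) : ℝ :=
  mean Finset.univ (handMoment 2 s) - mean Finset.univ fun h => handMoment 1 s h ^ 2

theorem variance_avgRet (s : Strategy) {n : ℕ} (hn : 1 ≤ n) :
    variance (avgRet s n) (game s n) = dealPart s + drawPart s / n := by
  rw [variance_eq_sub MemLp.of_discrete, integral_avgRet s hn]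
  simp only [Pi.pow_apply]
  rw [integral_avgRet_sq s hn, dealPart, drawPart]
  simp only [mean, Finset.sum_add_distrib, ← Finset.sum_div, Finset.sum_sub_distrib]
  ring

theorem avgRet_one (s : Strategy) : avgRet s 1 = ret s 0 := by
  funext ω
  simp [avgRet]

theorem meanRet_eq (s : Strategy) : meanRet s = mean Finset.univ (handMoment 1 s) := by
  rw [meanRet, ← integral_avgRet s le_rfl, avgRet_one]

theorem varRet_eq (s : Strategy) : varRet s = dealPart s + drawPart s := by
  rw [varRet, ← avgRet_one, variance_avgRet s le_rfl, Nat.cast_one, div_one]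

/-- The conditional mean given the hand has the right integral over every event that depends on the
hand only. By `hs` it factors through the class of the hand, which makes it measurable for the
coarser σ-algebra. -/
theorem condExp_ret {s : Strategy}
    (hs : ∀ h h' : Hand, h ≈ h' → handMoment 1 s h = handMoment 1 s h') :
    (fun ω : Outcome 1 => handMoment 1 s ω.1) =ᵐ[game s 1]
      condExp (dealSigma 1) (game s 1) (ret s 0) := by
  refine ae_eq_condExp_of_forall_setIntegral_eq le_top Integrable.of_finite
    (fun A _ _ => Integrable.of_finite) (fun A hA _ => ?_) ?_
  -- The event is the preimage of a set `B` of classes, so for a fixed hand the indicator is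
  -- constant over the draws.
  · obtain ⟨B, -, rfl⟩ := hA
    have hm : ∀ A : Set (Outcome 1), MeasurableSet A := fun _ => trivial
    rw [← integral_indicator (hm _), ← integral_indicator (hm _), integral_game, integral_game]
    refine mean_congr fun h _ => ?_
    by_cases hB : Quotient.mk handSetoid h ∈ B
    · have hd : ∀ d, ((h, d) : Outcome 1) ∈ initialClass ⁻¹' B := fun _ => hB
      refine (mean_congr fun d _ => Set.indicator_of_mem (hd d) _).trans (Eq.trans ?_
        (mean_congr fun d _ => (Set.indicator_of_mem (hd d) _).symm))
      exact (mean_const (draws_nonempty s 1 h) _).trans (mean_draws_ret s h 0).symm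
    · have hd : ∀ d, ((h, d) : Outcome 1) ∉ initialClass ⁻¹' B := fun _ => hB
      exact mean_congr fun d _ => (Set.indicator_of_notMem (hd d) _).trans
        (Set.indicator_of_notMem (hd d) _).symm
  · refine StronglyMeasurable.aestronglyMeasurable ?_
    refine Measurable.stronglyMeasurable ?_
    exact (measurable_from_top (f := Quotient.lift (handMoment 1 s) hs)).comp
      (comap_measurable (m := ⊤) initialClass)

theorem varDeal_eq {s : Strategy}
    (hs : ∀ h h' : Hand, h ≈ h' → handMoment 1 s h = handMoment 1 s h') :
    varDeal s = dealPart s := by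
  rw [varDeal, ← variance_congr (condExp_ret hs), variance_eq_sub MemLp.of_discrete, dealPart]
  simp only [Pi.pow_apply]
  rw [integral_of_hand s 1 (handMoment 1 s), integral_of_hand s 1 fun h => handMoment 1 s h ^ 2]

/-- By the law of total variance this is the remainder of the variance; the second moments given the
hand need not be constant on the classes. -/
theorem varDraw_eq {s : Strategy}
    (hs : ∀ h h' : Hand, h ≈ h' → handMoment 1 s h = handMoment 1 s h') :
    varDraw s = drawPart s := by
  have h1 := integral_condVar_add_variance_condExp (m := dealSigma 1) (μ := game s 1) (X := ret s 0)
    le_top MemLp.of_discrete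
  have h2 := varDeal_eq hs
  have h3 := varRet_eq s
  rw [varDeal] at h2
  rw [varRet] at h3
  rw [varDraw]
  linarith

/-! Optimal strategies. -/

noncomputable def bestStrategy : Strategy where
  hold h := bestHold h.1
  hold_subset h := (bestHold_spec h.2).1

theorem handMoment_one_le (s : Strategy) (h : Hand) :
    handMoment 1 s h ≤ handMoment 1 bestStrategy h := by
  refine div_le_div_of_nonneg_right ?_ (by norm_num)
  exact_mod_cast ((bestHold_spec h.2).2.2 _ (s.hold_subset h)).1

theorem handMoment_two_le {s : Strategy} {h : Hand}
    (he : handMoment 1 s h = handMoment 1 bestStrategy h) :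
    handMoment 2 bestStrategy h ≤ handMoment 2 s h := by
  refine div_le_div_of_nonneg_right ?_ (by norm_num)
  rw [handMoment, handMoment, div_left_inj' (by norm_num), Nat.cast_inj] at he
  exact_mod_cast ((bestHold_spec h.2).2.2 _ (s.hold_subset h)).2 he

theorem card_hand_pos : (0 : ℝ) < (Finset.univ : Finset Hand).card := by
  rw [Finset.card_univ, card_hand]
  norm_num

/-- The best strategy maximizes every summand of the sum over hands, so the sums agree only if all
summands do. -/
theorem isOptimal_iff (s : Strategy) :
    IsOptimal s ↔ ∀ h, handMoment 1 s h = handMoment 1 bestStrategy h := by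
  simp only [IsOptimal, meanRet_eq, mean]
  constructor
  · intro h h'
    have h1 := h bestStrategy
    rw [div_le_div_iff_of_pos_right card_hand_pos] at h1
    exact (Finset.sum_eq_sum_iff_of_le fun h _ => handMoment_one_le s h).1
      (le_antisymm (Finset.sum_le_sum fun h _ => handMoment_one_le s h) h1) h' (Finset.mem_univ _)
  · intro h t
    rw [div_le_div_iff_of_pos_right card_hand_pos]
    exact Finset.sum_le_sum fun h' _ => (handMoment_one_le t h').trans_eq (h h').symm

/-- All optimal strategies share the mean, so their variances are compared by the second moments. -/
theorem varRet_eq_of_isOptimal {s : Strategy} (hs : IsOptimal s) : varRet s =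
    mean Finset.univ (handMoment 2 s) - mean Finset.univ (handMoment 1 bestStrategy) ^ 2 := by
  rw [varRet_eq, dealPart, drawPart, mean_congr (f := handMoment 1 s)
    fun h _ => (isOptimal_iff s).1 hs h]
  ring

theorem isOptimal_bestStrategy : IsOptimal bestStrategy := (isOptimal_iff _).2 fun _ => rfl

theorem isMinVarOptimal_bestStrategy : IsMinVarOptimal bestStrategy := by
  refine ⟨isOptimal_bestStrategy, fun t ht => ?_⟩
  rw [varRet_eq_of_isOptimal ht, varRet_eq_of_isOptimal isOptimal_bestStrategy, mean, mean]
  exact sub_le_sub_right ((div_le_div_iff_of_pos_right card_hand_pos).2 (Finset.sum_le_sum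
    fun h _ => handMoment_two_le ((isOptimal_iff t).1 ht h))) _

/-- Two minimizers have equal variances. Hence the values found for one strategy hold for all of
them. -/
theorem IsMinVarOptimal.mean_two {s : Strategy} (hs : IsMinVarOptimal s) :
    mean Finset.univ (handMoment 2 s) = mean Finset.univ (handMoment 2 bestStrategy) := by
  have h1 := hs.2 _ isOptimal_bestStrategy
  have h2 := isMinVarOptimal_bestStrategy.2 _ hs.1
  rw [varRet_eq_of_isOptimal hs.1, varRet_eq_of_isOptimal isOptimal_bestStrategy] at h1 h2
  linarith

theorem mean_bestStrategy :
    mean Finset.univ (handMoment 1 bestStrategy) = 32187682693 / 31944279675 ∧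
    mean Finset.univ (fun h => handMoment 1 bestStrategy h ^ 2) =
      635276828634154529016 / (2598960 * 7669695 ^ 2) ∧
    mean Finset.univ (handMoment 2 bestStrategy) = 535205551738272 / (2598960 * 7669695) := by
  obtain ⟨h1, h2, h3⟩ := sum_bestHold
  rw [← sum_hand] at h1 h2 h3
  replace h1 := congrArg (Nat.cast (R := ℝ)) h1
  replace h2 := congrArg (Nat.cast (R := ℝ)) h2
  replace h3 := congrArg (Nat.cast (R := ℝ)) h3
  push_cast at h1 h2 h3
  simp only [mean, handMoment, div_pow, ← Finset.sum_div, Finset.card_univ, card_hand]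
  refine ⟨?_, ?_, ?_⟩
  · exact (congrArg (fun x : ℝ => x / 7669695 / ((2598960 : ℕ) : ℝ)) h1).trans (by norm_num)
  · exact (congrArg (fun x : ℝ => x / 7669695 ^ 2 / ((2598960 : ℕ) : ℝ)) h2).trans (by norm_num)
  · exact (congrArg (fun x : ℝ => x / 7669695 / ((2598960 : ℕ) : ℝ)) h3).trans (by norm_num)

/-- The mean of the return and the two parts of its variance under a minimum-variance optimal
strategy. -/
theorem IsMinVarOptimal.values {s : Strategy} (hs : IsMinVarOptimal s) :
    mean Finset.univ (handMoment 1 s) = 32187682693 / 31944279675 ∧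
    dealPart s = 27769926596703007394837 / 8843787367606690248750 ∧
    drawPart s = 144566104812712980751 / 6370074934650677250 := by
  obtain ⟨h1, h2, h3⟩ := mean_bestStrategy
  have h4 := (isOptimal_iff s).1 hs.1
  have h5 : handMoment 1 s = handMoment 1 bestStrategy := funext h4
  rw [dealPart, drawPart, hs.mean_two, h5, h1, h2, h3]
  norm_num

theorem IsMinVarOptimal.handMoment_eq {s : Strategy} (hs : IsMinVarOptimal s) (h h' : Hand)
    (hh : h ≈ h') : handMoment 1 s h = handMoment 1 s h' := by
  rw [(isOptimal_iff s).1 hs.1, (isOptimal_iff s).1 hs.1, handMoment, handMoment]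
  exact congrArg (fun x : ℕ => (x : ℝ) / 7669695) (moment_bestHold_eq_of_equiv hh)

/-- Squaring reduces the tabulated standard deviations to inequalities between rational numbers. -/
theorem approx_sqrt {x a : ℝ} (h0 : 1 ≤ a) (h1 : (a - 1 / 2 * 10 ^ (-6 : ℤ)) ^ 2 ≤ x)
    (h2 : x ≤ (a + 1 / 2 * 10 ^ (-6 : ℤ)) ^ 2) : Approx (Real.sqrt x) a := by
  have h3 : a - 1 / 2 * 10 ^ (-6 : ℤ) ≤ Real.sqrt x := Real.le_sqrt_of_sq_le h1
  have h4 : Real.sqrt x ≤ a + 1 / 2 * 10 ^ (-6 : ℤ) :=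
    Real.sqrt_le_iff.2 ⟨by positivity, h2⟩
  rw [Approx, abs_le]
  constructor <;> linarith

end DeucesWild

theorem mainTheorem9 :
    (∃ s : DeucesWild.Strategy, DeucesWild.IsMinVarOptimal s) ∧
    ∀ s : DeucesWild.Strategy, DeucesWild.IsMinVarOptimal s →
      -- mean, variance, and variance decomposition of the single-play return
      (DeucesWild.meanRet s = 32187682693 / 31944279675 ∧
        DeucesWild.Approx (DeucesWild.meanRet s) 1.007620) ∧
      (DeucesWild.varRet s = 342713803167529293506213 / 13265681051410035373125 ∧
        DeucesWild.Approx (DeucesWild.varRet s) 25.834618) ∧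
      (DeucesWild.varDeal s = 27769926596703007394837 / 8843787367606690248750 ∧
        DeucesWild.Approx (DeucesWild.varDeal s) 3.140049) ∧
      (DeucesWild.varDraw s = 144566104812712980751 / 6370074934650677250 ∧
        DeucesWild.Approx (DeucesWild.varDraw s) 22.694569) ∧
      DeucesWild.varRet s = DeucesWild.varDeal s + DeucesWild.varDraw s ∧
      -- mean and variance of the return per unit bet from the n-play game
      (∀ n : ℕ, 1 ≤ n →
        ∫ ω, DeucesWild.avgRet s n ω ∂(DeucesWild.game s n) = DeucesWild.meanRet s ∧
        ProbabilityTheory.variance (DeucesWild.avgRet s n) (DeucesWild.game s n) =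
          DeucesWild.varDeal s + DeucesWild.varDraw s / n) ∧
      -- the tabulated means, variances and standard deviations
      ∀ n v d, (n, v, d) ∈ DeucesWild.table →
        DeucesWild.Approx (∫ ω, DeucesWild.avgRet s n ω ∂(DeucesWild.game s n)) 1.007620 ∧
        DeucesWild.Approx
          (ProbabilityTheory.variance (DeucesWild.avgRet s n) (DeucesWild.game s n)) v ∧
        DeucesWild.Approx
          (Real.sqrt
            (ProbabilityTheory.variance (DeucesWild.avgRet s n) (DeucesWild.game s n))) d := by
  refine ⟨⟨_, DeucesWild.isMinVarOptimal_bestStrategy⟩, fun s hs => ?_⟩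
  obtain ⟨h1, h2, h3⟩ := hs.values
  have hmean := DeucesWild.meanRet_eq s
  have hvar := DeucesWild.varRet_eq s
  have hdeal := DeucesWild.varDeal_eq hs.handMoment_eq
  have hdraw := DeucesWild.varDraw_eq hs.handMoment_eq
  rw [h1] at hmean
  rw [h2, h3] at hvar
  rw [h2] at hdeal
  rw [h3] at hdraw
  refine ⟨⟨hmean, ?_⟩, ⟨by rw [hvar]; norm_num, ?_⟩, ⟨hdeal, ?_⟩, ⟨hdraw, ?_⟩,
    by rw [hvar, hdeal, hdraw], fun n hn => ⟨?_, ?_⟩, fun n v d hn => ?_⟩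
  · rw [hmean, DeucesWild.Approx, abs_le]
    norm_num
  · rw [hvar, DeucesWild.Approx, abs_le]
    norm_num
  · rw [hdeal, DeucesWild.Approx, abs_le]
    norm_num
  · rw [hdraw, DeucesWild.Approx, abs_le]
    norm_num
  · rw [DeucesWild.integral_avgRet s hn, h1, hmean]
  · rw [DeucesWild.variance_avgRet s hn, h2, h3, hdeal, hdraw]
  · simp only [DeucesWild.table, List.mem_cons, Prod.mk.injEq, List.not_mem_nil, or_false] at hn
    have hn1 : 1 ≤ n := by omega
    rw [DeucesWild.integral_avgRet s hn1, h1, DeucesWild.variance_avgRet s hn1, h2, h3]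
    refine ⟨by rw [DeucesWild.Approx, abs_le]; norm_num, ?_, ?_⟩
    · rw [DeucesWild.Approx, abs_le]
      rcases hn with ⟨rfl, rfl, -⟩ | ⟨rfl, rfl, -⟩ | ⟨rfl, rfl, -⟩ | ⟨rfl, rfl, -⟩ | ⟨rfl, rfl, -⟩ |
        ⟨rfl, rfl, -⟩ | ⟨rfl, rfl, -⟩ <;> norm_num
    · rcases hn with ⟨rfl, -, rfl⟩ | ⟨rfl, -, rfl⟩ | ⟨rfl, -, rfl⟩ | ⟨rfl, -, rfl⟩ | ⟨rfl, -, rfl⟩ |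
        ⟨rfl, -, rfl⟩ | ⟨rfl, -, rfl⟩ <;> refine DeucesWild.approx_sqrt ?_ ?_ ?_ <;> norm_num
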